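/- **Setting.** Let $n,N\ge 1$, let $D$ be a deterministic complex $n\times N$ matrix, and let $Y_1,Y_2,\dots$ be independent observations of $Y=D+X$, where $X$ is an $n\times N$ matrix with i.i.d. standard complex Gaussian entries (real and imaginary parts independent, centred, of variance $\frac12$). Let $\mathrm{tr}$ be the trace divided by the size of the matrix, and $D_p=\mathrm{tr}\big((\frac1N DD^H)^p\big)$. **Estimators.** For an $n\times N$ matrix $Y$ put $Y_k=\mathrm{tr}\big((\frac1N YY^H)^k\big)$. For $p\ge1$ let $$\widehat{D_p}(Y)=\sum_{\pi}(-1)^{|\rho_1|}\frac{n^{|\sigma(\pi)|-1}}{N^{|\rho_1|}}\,N^{a(\pi)}\,n^{b(\pi)}\,Y_{l_1}\cdots Y_{l_r},$$ where $\pi$ runs over all bijections $q:\rho_1\to\rho_2$ between two (possibly empty) subsets of $\{1,\dots,p\}$. Here one takes a circle with vertices and edges numbered $1,\dots,2p$ clockwise, edge $i$ joining the vertices $i$ and $i+1$ (mod $2p$), and for each $i\in\rho_1$ one identifies the even edge $2i$ with the odd edge $2q(i)-1$, with opposite orientation. The edges that are not identified with another edge are called deterministic; $\sigma(\pi)$ is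 the partition of the deterministic edges into connected components after the identification, $2l_1,\dots,2l_r$ are the sizes of its blocks, and $a(\pi)$ (resp. $b(\pi)$) is the number of classes of even (resp. odd) vertices that do not border to a deterministic edge. For $L=L_1L_2$ observations, stack them in any order into the $(nL_1)\times(NL_2)$ block matrix $Y_{L_1,L_2}$, and let $\widehat{D_{p,L_1,L_2}}=L_1^{1-p}\,\widehat{D_p}(Y_{L_1,L_2})$, where $\widehat{D_p}$ is taken with $nL_1,NL_2$ in place of $n,N$. Averaging is the estimator $\frac1L\sum_{i=1}^L\widehat{D_p}(Y_i)$. Let $v_{p,\cdot,L}$ denote the variance of $\widehat{D_{p,L_1,L_2}}$, where $\cdot$ is $H$ (horizontal: $L_1=1$), $V$ (vertical: $L_2=1$), or $R$ (rectangular: $L_1/L_2\to c$ for some $c\in(0,\infty)$ as $L\to\infty$), and let $v_{p,A,L}$ denote the variance of the averaging estimator. **Theorem.** All these estimators are unbiased estimators of $D_p$, and their variances are all $O(L^{-1})$ (with a constant that may depend on $n,N,p,D$ but not on the stacking). Moreover $$\lim_{L\to\infty}L\,v_{1,\cdot,L}=\frac{2}{nN}D_1+\frac1{nN}\qquad\text{for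 }\cdot=H,V,R,A,$$ and for $p\ge2$ $$\lim_{L\to\infty} L\,v_{p,R,L}=\frac{2p^2}{nN}D_{2p-1},\qquad \lim_{L\to\infty} L\,v_{p,V,L}=\frac{2p^2}{nN}D_{2p-1}+\frac{p^2}{N^2}D_{2p-2},$$ $$\lim_{L\to\infty} L\,v_{p,H,L}=\frac{2p^2}{nN}D_{2p-1}+\frac{p^2}{nN}D_{2p-2},$$ $$\lim_{L\to\infty} L\,v_{p,A,L}=\frac{2p^2}{nN}D_{2p-1}+\Big(\frac{p^2}{N^2}+\frac{p^2}{nN}\Big)D_{2p-2}+Q(D_{2p-3},\dots,D_1),$$ where $Q$ is a polynomial, depending only on $n,N,p$, all of whose nonzero coefficients are positive, which has degree $2p-2$ when the variable $D_k$ is given degree $k$, and has degree $p$ when every variable is given degree $1$. In particular all rectangular stackings have the same limit of $L\,v_{p,R,L}$, and $$\lim L v_{p,R,L}\le\lim L v_{p,V,L}\le\lim L v_{p,A,L},\qquad \lim L v_{p,R,L}\le\lim L v_{p,H,L}\le\lim L v_{p,A,L}.$$ For every $p\ge1$, the variance of $\widehat{D_{p,L_1,L_2}}$ strictly decreases with $L$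 for a fixed aspect ratio $L_1/L_2$. For $p\ge2$, and $D\ne0$ if $p=2$, and for two stackings $R_1,R_2$ of the same number $L=L_1^{(1)}L_2^{(1)}=L_1^{(2)}L_2^{(2)}$ of observations, $v_{p,R_1,L}<v_{p,R_2,L}$ if and only if the $(nL_1^{(1)})\times(NL_2^{(1)})$ compound matrix is more square than the $(nL_1^{(2)})\times(NL_2^{(2)})$ compound matrix, i.e. has a smaller ratio of its longer to its shorter side. Finally, for $p\ge2$ and $L\ge2$, $v_{p,\cdot,L}<v_{p,A,L}$ for any stacking of $L$ observations. -/

import Mathlib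

open MeasureTheory ProbabilityTheory Filter Topology Matrix

universe u

noncomputable section

namespace Stacking

/-- The `p`-th moment `tr(((1/N) Y Yᴴ)^p)` of a complex matrix `Y` with `N` columns, where `tr` is
the trace divided by the number of rows. This number is real (see `matMoment_im`), and we record its
real part. -/
def matMoment {ι κ : Type*} [Fintype ι] [DecidableEq ι] [Fintype κ] (Y : Matrix ι κ ℂ) (p : ℕ) : ℝ :=
  ((Fintype.card ι : ℂ)⁻¹ * (((Fintype.card κ : ℂ)⁻¹ • (Y * Yᴴ)) ^ p).trace).re

/-- Taking the real part in `matMoment` loses nothing. -/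
theorem matMoment_im {ι κ : Type*} [Fintype ι] [DecidableEq ι] [Fintype κ] (Y : Matrix ι κ ℂ)
    (p : ℕ) :
    ((Fintype.card ι : ℂ)⁻¹ * (((Fintype.card κ : ℂ)⁻¹ • (Y * Yᴴ)) ^ p).trace).im = 0 := by
  have hA : (((Fintype.card κ : ℂ)⁻¹ • (Y * Yᴴ)) ^ p)ᴴ = ((Fintype.card κ : ℂ)⁻¹ • (Y * Yᴴ)) ^ p := by
    rw [Matrix.conjTranspose_pow, Matrix.conjTranspose_smul, Matrix.conjTranspose_mul,
      Matrix.conjTranspose_conjTranspose]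
    simp
  rw [← Complex.conj_eq_iff_im, map_mul]
  congr 1
  · simp
  · rw [starRingEnd_apply, ← Matrix.trace_conjTranspose, hA]

/-! ### Partial permutations and the gluing of the circle -/

/-- A partial permutation of `p` elements: a bijection `q : ρ₁ ≃ ρ₂` between two (possibly empty)
subsets of a set of `p` elements. -/
abbrev PartialPerm (p : ℕ) : Type :=
  Σ ρ : Finset (Fin p) × Finset (Fin p), (ρ.1 ≃ ρ.2)

/-- The `2p` vertices of a circle, labelled clockwise by `1, …, 2p`: for `i : Fin p`, `Sum.inl i` is
the odd vertex `2i + 1` and `Sum.inr i` is the even vertex `2i + 2`. -/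
abbrev Vertex (p : ℕ) : Type := Fin p ⊕ Fin p

/-- The `2p` edges of the circle, labelled clockwise by `1, …, 2p`: for `i : Fin p`, `Sum.inl i` is
the odd edge `2i + 1` and `Sum.inr i` is the even edge `2i + 2`. -/
abbrev Edge (p : ℕ) : Type := Fin p ⊕ Fin p

/-- The edge number `m` starts at the vertex number `m`. -/
def edgeStart {p : ℕ} : Edge p → Vertex p
  | Sum.inl i => Sum.inl i
  | Sum.inr i => Sum.inr i

/-- The edge number `m` ends at the vertex number `m + 1` (and the edge `2p` at the vertex `1`). -/
def edgeEnd {p : ℕ} : Edge p → Vertex p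
  | Sum.inl i => Sum.inr i
  | Sum.inr i => Sum.inl (finRotate p i)

/-- For `i ∈ ρ₁`, the `i`-th even edge and the `q i`-th odd edge are identified with opposite
orientation; this identifies the start of each of the two with the end of the other. -/
inductive VertexGlue {p : ℕ} (π : PartialPerm p) : Vertex p → Vertex p → Prop
  | start_end (i : π.1.1) :
      VertexGlue π (edgeStart (Sum.inr (i : Fin p))) (edgeEnd (Sum.inl (π.2 i : Fin p)))
  | end_start (i : π.1.1) :
      VertexGlue π (edgeEnd (Sum.inr (i : Fin p))) (edgeStart (Sum.inl (π.2 i : Fin p)))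

/-- The partition `ρ(π)` of the vertices generated by the identification of edges. -/
def vertexSetoid {p : ℕ} (π : PartialPerm p) : Setoid (Vertex p) :=
  Relation.EqvGen.setoid (VertexGlue π)

/-- The vertices after the identification of edges. -/
abbrev VertexClass {p : ℕ} (π : PartialPerm p) : Type := Quotient (vertexSetoid π)

/-- The class of a vertex. -/
def vertexClass {p : ℕ} (π : PartialPerm p) (v : Vertex p) : VertexClass π :=
  Quotient.mk (vertexSetoid π) v

/-- The deterministic edges are those that are not identified with another edge: the odd edges
outside `ρ₂` and the even edges outside `ρ₁`. -/
def IsDeterministic {p : ℕ} (π : PartialPerm p) : Edge p → Prop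
  | Sum.inl j => j ∉ π.1.2
  | Sum.inr i => i ∉ π.1.1

/-- After the identification, the vertex `c` borders to the edge `e`. -/
def Borders {p : ℕ} (π : PartialPerm p) (e : Edge p) (c : VertexClass π) : Prop :=
  vertexClass π (edgeStart e) = c ∨ vertexClass π (edgeEnd e) = c

/-- `k(ρ(π)) - kd(ρ(π))`: the number of blocks of `ρ(π)` that consist of even vertices and do not
border to a deterministic edge. -/
def freeEven {p : ℕ} (π : PartialPerm p) : ℕ :=
  Nat.card {c : VertexClass π // (∀ v, vertexClass π v = c → v.isRight) ∧
    ∀ e, IsDeterministic π e → ¬ Borders π e c}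

/-- `l(ρ(π)) - ld(ρ(π))`: the number of blocks of `ρ(π)` that consist of odd vertices and do not
border to a deterministic edge. -/
def freeOdd {p : ℕ} (π : PartialPerm p) : ℕ :=
  Nat.card {c : VertexClass π // (∀ v, vertexClass π v = c → v.isLeft) ∧
    ∀ e, IsDeterministic π e → ¬ Borders π e c}

/-- The partition `σ(π)` of the deterministic edges into the connected components that they form
after the identification of edges: it is generated by the pairs that share a vertex. -/
def edgeSetoid {p : ℕ} (π : PartialPerm p) : Setoid {e : Edge p // IsDeterministic π e} :=
  Relation.EqvGen.setoid fun e f => ∃ c, Borders π e.1 c ∧ Borders π f.1 c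

/-- The blocks of `σ(π)`. -/
abbrev EdgeBlock {p : ℕ} (π : PartialPerm p) : Type := Quotient (edgeSetoid π)

/-- The number of edges in a block of `σ(π)`. -/
def blockCard {p : ℕ} (π : PartialPerm p) (b : EdgeBlock π) : ℕ :=
  Nat.card {e : {e : Edge p // IsDeterministic π e} // Quotient.mk (edgeSetoid π) e = b}

/-! ### The estimators -/

open Classical in
/-- The estimator `D̂_p` evaluated at a single observation `Y`, an `n × N` matrix:
`∑_π (-1)^|ρ₁| n^(|σ(π)| - 1) / N^|ρ₁| * N^(k - kd) * n^(l - ld) * Y_{l₁} ⋯ Y_{l_r}`,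
where `π` runs over the partial permutations of `p` elements and `l₁, …, l_r` are the cardinalities
of the blocks of `σ(π)` divided by two. -/
def estimator {ι κ : Type*} [Fintype ι] [DecidableEq ι] [Fintype κ] (p : ℕ)
    (Y : Matrix ι κ ℂ) : ℝ :=
  ∑ π : PartialPerm p,
    (-1 : ℝ) ^ π.1.1.card *
    ((Fintype.card ι : ℝ) ^ ((Nat.card (EdgeBlock π) : ℤ) - 1)
      / (Fintype.card κ : ℝ) ^ π.1.1.card) *
    ((Fintype.card κ : ℝ) ^ freeEven π * (Fintype.card ι : ℝ) ^ freeOdd π) *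
    ∏ b : EdgeBlock π, matMoment Y (blockCard π b / 2)

/-- The `(n L₁) × (N L₂)` compound matrix of the `L₁ L₂` matrices `Y 0, …, Y (L₁ L₂ - 1)`: the
block in position `(a, b)` is the observation number `e (a, b)`. -/
def compound {n N L₁ L₂ : ℕ} (e : Fin L₁ × Fin L₂ ≃ Fin (L₁ * L₂))
    (Y : ℕ → Matrix (Fin n) (Fin N) ℂ) : Matrix (Fin L₁ × Fin n) (Fin L₂ × Fin N) ℂ :=
  Matrix.of fun a b => Y (e (a.1, b.1)) a.2 b.2

/-- The estimator `D̂_{p,L₁,L₂}`: the estimator `D̂_p` of the compound matrix times `L₁^(1-p)`. -/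
def stackEstimator {n N L₁ L₂ : ℕ} (p : ℕ) (e : Fin L₁ × Fin L₂ ≃ Fin (L₁ * L₂))
    (Y : ℕ → Matrix (Fin n) (Fin N) ℂ) : ℝ :=
  (L₁ : ℝ) ^ (1 - (p : ℤ)) * estimator p (compound e Y)

/-- The average of the estimators `D̂_p` over the first `L` observations. -/
def avgEstimator {n N : ℕ} (p L : ℕ) (Y : ℕ → Matrix (Fin n) (Fin N) ℂ) : ℝ :=
  (L : ℝ)⁻¹ * ∑ k ∈ Finset.range L, estimator p (Y k)

/-! ### The model -/

/-- The standard complex Gaussian distribution: the real and the imaginary part are independent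
centred real Gaussians with variance `1/2`. -/
def stdComplexGaussian : Measure ℂ :=
  ((gaussianReal 0 (1 / 2)).prod (gaussianReal 0 (1 / 2))).map fun z => (⟨z.1, z.2⟩ : ℂ)

/-- `Y 0, Y 1, …` are independent observations of the additive model `Y = D + X`, where `D` is
deterministic and `X` is a standard complex Gaussian matrix: the entries of all the noise
matrices `X k` are independent with the standard complex Gaussian distribution. -/
def IsAdditiveModel {n N : ℕ} {Ω : Type*} [MeasurableSpace Ω] (μ : Measure Ω)
    (D : Matrix (Fin n) (Fin N) ℂ) (Y : ℕ → Ω → Matrix (Fin n) (Fin N) ℂ) : Prop :=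
  ∃ X : ℕ → Ω → Matrix (Fin n) (Fin N) ℂ,
    (∀ k ω, Y k ω = D + X k ω) ∧
    (∀ k i j, HasLaw (fun ω => X k ω i j) stdComplexGaussian μ) ∧
    iIndepFun (fun (t : ℕ × Fin n × Fin N) ω => X t.1 ω t.2.1 t.2.2) μ

/-- The variance `v_{p,·,L}` of `D̂_{p,L₁,L₂}`, where `L = L₁ L₂`. -/
def stackVar {n N L₁ L₂ : ℕ} {Ω : Type*} [MeasurableSpace Ω] (μ : Measure Ω)
    (Y : ℕ → Ω → Matrix (Fin n) (Fin N) ℂ) (p : ℕ) (e : Fin L₁ × Fin L₂ ≃ Fin (L₁ * L₂)) : ℝ :=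
  Var[fun ω => stackEstimator p e (fun k => Y k ω); μ]

/-- The variance `v_{p,A,L}` of the average of `L` applications of `D̂_p`. -/
def avgVar {n N : ℕ} {Ω : Type*} [MeasurableSpace Ω] (μ : Measure Ω)
    (Y : ℕ → Ω → Matrix (Fin n) (Fin N) ℂ) (p L : ℕ) : ℝ :=
  Var[fun ω => avgEstimator p L (fun k => Y k ω); μ]

/-- The estimator `T` of the real number `θ` is square integrable and unbiased. -/
def IsUnbiased {Ω : Type*} [MeasurableSpace Ω] (μ : Measure Ω) (T : Ω → ℝ) (θ : ℝ) : Prop :=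
  MemLp T 2 μ ∧ ∫ ω, T ω ∂μ = θ

/-! ### Families of stackings -/

/-- A rectangular stacking, `k` indexing a family of stackings into `L₁ k × L₂ k` blocks: the number
of observations grows to infinity and `L₁ / L₂` has a limit in `(0, ∞)`. -/
def IsRectangular (L₁ L₂ : ℕ → ℕ) : Prop :=
  Tendsto (fun k => L₁ k * L₂ k) atTop atTop ∧
    ∃ c : ℝ, 0 < c ∧ Tendsto (fun k => (L₁ k : ℝ) / (L₂ k : ℝ)) atTop (𝓝 c)

/-- `ℓ` is the limit of `L v_{p,R,L}` for every rectangular stacking, with the observations stacked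
in any order. -/
def RectLimit {n N : ℕ} {Ω : Type*} [MeasurableSpace Ω] (μ : Measure Ω)
    (Y : ℕ → Ω → Matrix (Fin n) (Fin N) ℂ) (p : ℕ) (ℓ : ℝ) : Prop :=
  ∀ L₁ L₂ : ℕ → ℕ, IsRectangular L₁ L₂ →
    ∀ e : (k : ℕ) → Fin (L₁ k) × Fin (L₂ k) ≃ Fin (L₁ k * L₂ k),
      Tendsto (fun k => ((L₁ k * L₂ k : ℕ) : ℝ) * stackVar μ Y p (e k)) atTop (𝓝 ℓ)

/-- `ℓ` is the limit of `L v_{p,V,L}`: vertical stackings, `L₁ = L` and `L₂ = 1`. -/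
def VertLimit {n N : ℕ} {Ω : Type*} [MeasurableSpace Ω] (μ : Measure Ω)
    (Y : ℕ → Ω → Matrix (Fin n) (Fin N) ℂ) (p : ℕ) (ℓ : ℝ) : Prop :=
  ∀ e : (L : ℕ) → Fin L × Fin 1 ≃ Fin (L * 1),
    Tendsto (fun L : ℕ => (L : ℝ) * stackVar μ Y p (e L)) atTop (𝓝 ℓ)

/-- `ℓ` is the limit of `L v_{p,H,L}`: horizontal stackings, `L₁ = 1` and `L₂ = L`. -/
def HorizLimit {n N : ℕ} {Ω : Type*} [MeasurableSpace Ω] (μ : Measure Ω)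
    (Y : ℕ → Ω → Matrix (Fin n) (Fin N) ℂ) (p : ℕ) (ℓ : ℝ) : Prop :=
  ∀ e : (L : ℕ) → Fin 1 × Fin L ≃ Fin (1 * L),
    Tendsto (fun L : ℕ => (L : ℝ) * stackVar μ Y p (e L)) atTop (𝓝 ℓ)

/-- `ℓ` is the limit of `L v_{p,A,L}`: averaging. -/
def AvgLimit {n N : ℕ} {Ω : Type*} [MeasurableSpace Ω] (μ : Measure Ω)
    (Y : ℕ → Ω → Matrix (Fin n) (Fin N) ℂ) (p : ℕ) (ℓ : ℝ) : Prop :=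
  Tendsto (fun L : ℕ => (L : ℝ) * avgVar μ Y p L) atTop (𝓝 ℓ)

/-- An `a × b` matrix is more square than an `a' × b'` matrix: the ratio of the longer to the
shorter side, which is at least `1`, is smaller (all sides being positive). -/
def MoreSquare (a b a' b' : ℕ) : Prop :=
  ((max a b : ℕ) : ℝ) / ((min a b : ℕ) : ℝ) < ((max a' b' : ℕ) : ℝ) / ((min a' b' : ℕ) : ℝ)

end Stacking

end

open Stacking

namespace Stacking

/-! ### Index sums along the cycles of a permutation -/

/-! A partial permutation is encoded by the involution `g` of the edges that exchanges identified
edges; let `φ` be the map to the next edge. The glued circle is then described by the cycles of `φ *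
g`: a cycle on which `g` fixes no edge is a vertex class that borders no deterministic edge, and
every other cycle is a block of σ(π). Summing over all row and column indices, with a Kronecker
delta for each identified edge and a matrix entry for each free one, therefore gives a factor n or N
per free cycle and a trace of `(Y * Yᴴ) ^ l` per block (`sum_kernel_eq_glueWeight`,
`index_sum_eq_glueWeight`). So n N^p times the estimator is a `contractionSum` with weight -1 per
contracted pair (`ofReal_estimator_eq_contractionSum`).

By Wick's formula a sum over partial matchings with arbitrary pair weights is a Gaussian integral,
and averaging over further noise adds the covariances to the weights (`integral_wickSum`). Standard
noise turns a weight ε into ε + 1 (`integral_contractionSum`). The weight -1 becomes 0, only the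
trace for D itself remains, and the estimator is unbiased. The square of the estimator lives on two
circles, with weight -1 inside a circle and 0 across; noise turns these into 0 and 1. Subtracting
the squared mean removes the empty gluing, so the variance is a sum of nonnegative terms over the
nonempty gluings across the two circles (`variance_estimator`, `varTerm_nonneg`).

Take a gluing with k pairs, a free odd classes and b free even classes. Stacking multiplies its term
by L₁^a L₂^b / (L₁ L₂)^k (`stackVar_eq`), averaging by 1/L (`avgVar_eq`). A free cycle alternates
between the circles, whence 2a ≤ k and 2b ≤ k, so that L times the variance contains only the
nonnegative powers k - 1 - a of 1/L₁ and k - 1 - b of 1/L₂ (`mul_stackVar_eq`). This yields the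
O(1/L) bound, the monotonicity, the comparison with averaging and the limits: the power of 1/L₁ is
trivial only if k = 1, or k = 2 and a = 1, and similarly for L₂. There are 2p² gluings of the first
kind and p² of each of the other two. What remains for averaging is the polynomial Q; its degrees
follow from the bound of the number of cycles by k (`card_orb_le_numPairs`) and from explicit
gluings that attain them.

For squareness, conjugating `g` by `φ` exchanges a and b and changes nothing else
(`sum_crossGluings_comm`). The terms can thus be symmetrised to x^a y^b + x^b y^a with x = nL₁ and y
= NL₂. At a fixed product xy this increases strictly with max(x, y) if a ≠ b, and is constant if a =
b. -/

theorem eq_of_sameCycle {C β : Type*} {γ : Equiv.Perm C} {h : C → β} (hh : ∀ x, h (γ x) = h x)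
    {x y : C} (s : γ.SameCycle x y) : h x = h y := by
  obtain ⟨i, rfl⟩ := s
  have hn : ∀ (m : ℕ) (z : C), h ((γ ^ m) z) = h z := by
    intro m
    induction m with
    | zero => intro z; rfl
    | succ m ih => intro z; rw [pow_succ', Equiv.Perm.mul_apply, hh, ih]
  cases i with
  | ofNat m => exact (hn m x).symm
  | negSucc m =>
    rw [zpow_negSucc]
    have := hn (m + 1) ((γ ^ (m + 1))⁻¹ x)
    rw [← Equiv.Perm.mul_apply, mul_inv_cancel, Equiv.Perm.one_apply] at this
    exact this

theorem sameCycle_apply_self {C : Type*} (γ : Equiv.Perm C) (x : C) : γ.SameCycle x (γ x) :=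
  ⟨1, by simp⟩

/-- Each factor `A` exchanges the two projections, so only the parity of the exponent matters. -/
theorem proj_mul_pow {K R : Type*} [Fintype K] [DecidableEq K] [CommRing R] {A : Matrix K K R}
    {P : Bool → Matrix K K R} (hA : ∀ b, P b * A = A * P (!b)) (b : Bool) (w : ℕ) :
    P b * A ^ w = A ^ w * P (b ^^ w.bodd) := by
  induction w with
  | zero => simp
  | succ w ih =>
    rw [pow_succ, ← mul_assoc, ih, mul_assoc, hA, mul_assoc, Nat.bodd_succ]
    congr 2
    cases b <;> cases w.bodd <;> rfl

theorem removeNone_of_apply_eq {α : Type*} {γ : Equiv.Perm (Option α)} {x y : α}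
    (h : γ (some x) = some y) : Equiv.removeNone γ x = y := by
  have := Equiv.removeNone_some γ ⟨y, h⟩
  rw [h] at this
  exact Option.some_injective _ this

theorem removeNone_invariant {α β : Type*} {γ : Equiv.Perm (Option α)} {f : Option α → β}
    (hf : ∀ x, f (γ x) = f x) (x : α) : f (some (Equiv.removeNone γ x)) = f (some x) := by
  cases h : γ (some x) with
  | none => rw [Equiv.removeNone_none γ h, hf, ← h, hf]
  | some y => rw [removeNone_of_apply_eq h, ← h, hf]

/-- The cycle classes of the shortened permutation extend to an invariant of `γ` if `none` receives
the class of its predecessor `b`, and an invariant is constant on cycles. -/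
theorem sameCycle_removeNone {α : Type*} {γ : Equiv.Perm (Option α)} {b y : α}
    (hb : γ (some b) = none) (hy : γ none = some y) {x x' : α}
    (s : γ.SameCycle (some x) (some x')) : Equiv.Perm.SameCycle (Equiv.removeNone γ) x x' := by
  let h : Option α → Quotient (Equiv.Perm.SameCycle.setoid (Equiv.removeNone γ)) :=
    fun z => z.elim (Quotient.mk _ b) (fun a => Quotient.mk _ a)
  have hr : ∀ a, (Quotient.mk (Equiv.Perm.SameCycle.setoid (Equiv.removeNone γ))
      (Equiv.removeNone γ a)) = Quotient.mk _ a := fun a =>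
    Quotient.sound (s := Equiv.Perm.SameCycle.setoid _) (sameCycle_apply_self _ a).symm
  have hh : ∀ z, h (γ z) = h z := by
    intro z
    cases z with
    | none =>
      rw [hy]
      have : Equiv.removeNone γ b = y := by
        apply Option.some_injective
        rw [Equiv.removeNone_none γ hb, hy]
      change Quotient.mk _ y = Quotient.mk _ b
      rw [← this, hr]
    | some a =>
      cases hc : γ (some a) with
      | none =>
        have : a = b := by
          have := γ.injective (hc.trans hb.symm)
          exact Option.some_injective _ this
        rw [this]; rfl
      | some c =>
        change Quotient.mk _ c = Quotient.mk _ a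
        rw [← removeNone_of_apply_eq hc, hr]
  have := eq_of_sameCycle hh s
  exact Quotient.exact (s := Equiv.Perm.SameCycle.setoid _) this

theorem sum_option_fun {α K M : Type*} [Fintype α] [DecidableEq α]
    {_ : DecidableEq (Option α)} [Fintype K] [AddCommMonoid M]
    (F : (Option α → K) → M) :
    ∑ l : Option α → K, F l = ∑ l : α → K, ∑ k : K, F (fun o => o.elim k l) := by
  rw [← Fintype.sum_prod_type']
  refine Fintype.sum_equiv
    (⟨fun l => (fun a => l (some a), l none), fun q o => o.elim q.2 q.1, ?_, ?_⟩ :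
      (Option α → K) ≃ (α → K) × K) _ _ ?_
  · intro l; funext o; cases o <;> rfl
  · intro q; rfl
  · intro l
    congr 1
    funext o
    cases o <;> rfl

section CycleSum

open scoped Classical

variable {K R : Type*} [Fintype K] [DecidableEq K] [CommRing R]

/-- The cyclic kernel sums: if the cycles of `γ` are the fibres of `f`, then the sum over all
labellings of products of the kernels `P (τ c) * A ^ w c` factors into traces. -/
def CycleSumFormula (A : Matrix K K R) (P : Bool → Matrix K K R) (C : Type u) [Fintype C] : Prop :=
  ∀ (γ : Equiv.Perm C) (w : C → ℕ) (τ : C → Bool), (∀ c, τ (γ c) = (τ c ^^ (w c).bodd)) →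
    ∀ (Q : Type u) [Fintype Q] (f : C → Q), Function.Surjective f →
      (∀ x y, f x = f y ↔ γ.SameCycle x y) → ∀ val : Q → R,
      (∀ c, (P (τ c) * A ^ (∑ x with f x = f c, w x)).trace = val (f c)) →
      ∑ l : C → K, ∏ c, (P (τ c) * A ^ (w c)) (l c) (l (γ c)) = ∏ o, val o

variable {A : Matrix K K R} {P : Bool → Matrix K K R}

theorem CycleSumFormula.of_equiv {C C' : Type u} [Fintype C] [Fintype C'] (e : C ≃ C')
    (h : CycleSumFormula A P C) : CycleSumFormula A P C' := by
  intro γ w τ hτ Q _ f hf hfc val hval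
  have key := h (e.trans (γ.trans e.symm)) (w ∘ e) (τ ∘ e) (by intro c; simp [hτ]) Q (f ∘ e)
    (hf.comp e.surjective) (by
      intro x y
      simp only [Function.comp, hfc]
      constructor
      · rintro ⟨i, hi⟩
        refine ⟨i, ?_⟩
        have : (e.trans (γ.trans e.symm)) = e.symm.permCongr γ := by ext; simp
        rw [this, show e.symm.permCongr γ = e.symm.permCongrHom γ from rfl, ← map_zpow]
        simp [hi]
      · rintro ⟨i, hi⟩
        refine ⟨i, ?_⟩
        have : (e.trans (γ.trans e.symm)) = e.symm.permCongr γ := by ext; simp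
        rw [this, show e.symm.permCongr γ = e.symm.permCongrHom γ from rfl, ← map_zpow] at hi
        simpa [Equiv.symm_apply_eq] using hi) val (by
      intro c
      rw [Function.comp_apply (f := f), ← hval (e c)]
      congr 3
      rw [Finset.sum_filter, Finset.sum_filter]
      exact Fintype.sum_equiv e _ _ (by intro x; simp))
  rw [← key]
  refine Fintype.sum_equiv (e.symm.arrowCongr (Equiv.refl K)) _ _ ?_
  intro l
  refine (Fintype.prod_equiv e _ _ ?_).symm
  intro x
  simp

/-- Induction step on the number of elements. A fixed point `none` splits off as a trace of its own.
Otherwise summing over the label of `none` multiplies its kernel into that of its predecessor `b`: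
`none` leaves its cycle and its exponent is added to the one of `b`. -/
theorem CycleSumFormula.option (hP : ∀ b, P b * P b = P b) (hA : ∀ b, P b * A = A * P (!b))
    {C : Type u} [Fintype C] (h : CycleSumFormula A P C) : CycleSumFormula A P (Option C) := by
  intro γ w τ hτ Q _ f hf hfc val hval
  have hinv : ∀ x, f (γ x) = f x := fun x => ((hfc _ _).2 (sameCycle_apply_self γ x)).symm
  rw [sum_option_fun]
  cases hn : γ none with
  | none =>
    have hne : ∀ x : C, f (some x) ≠ f none := by
      intro x hx
      obtain ⟨i, hi⟩ := (hfc _ _).1 hx.symm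
      rw [Equiv.Perm.zpow_apply_eq_self_of_apply_eq_self hn] at hi
      cases hi
    have hsome : ∀ x : C, ∃ y, γ (some x) = some y := by
      intro x
      cases hx : γ (some x) with
      | none => exact absurd (γ.injective (hx.trans hn.symm)) (by simp)
      | some y => exact ⟨y, rfl⟩
    have hrs : ∀ x, γ (some x) = some (Equiv.removeNone γ x) := fun x =>
      (Equiv.removeNone_some γ (hsome x)).symm
    have key := h (Equiv.removeNone γ) (w ∘ some) (τ ∘ some)
      (by intro c; simp only [Function.comp]; rw [← hrs, hτ])
      {o : Q // o ≠ f none} (fun x => ⟨f (some x), hne x⟩)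
      (by
        rintro ⟨o, ho⟩
        obtain ⟨c, rfl⟩ := hf o
        cases c with
        | none => exact absurd rfl ho
        | some c => exact ⟨c, rfl⟩)
      (by
        intro x y
        rw [Subtype.mk.injEq, hfc]
        constructor
        · intro s
          let g : Option C → Option (Quotient (Equiv.Perm.SameCycle.setoid (Equiv.removeNone γ))) :=
            Option.map (fun a => Quotient.mk _ a)
          have := eq_of_sameCycle (h := g) (γ := γ) (by
            intro z
            cases z with
            | none => rw [hn]
            | some a =>
              rw [hrs]
              simp only [g, Option.map_some, Option.some.injEq]
              exact Quotient.sound (s := Equiv.Perm.SameCycle.setoid _)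
                (sameCycle_apply_self _ a).symm) s
          simp only [g, Option.map_some, Option.some.injEq] at this
          exact Quotient.exact (s := Equiv.Perm.SameCycle.setoid _) this
        · intro s
          rw [← hfc]
          exact eq_of_sameCycle (h := fun a => f (some a)) (removeNone_invariant hinv) s)
      (fun o => val o) (by
        intro c
        rw [← hval (some c)]
        congr 3
        rw [Finset.sum_filter, Finset.sum_filter, Fintype.sum_option, if_neg (hne c).symm, zero_add]
        simp)
    rw [Fintype.prod_eq_mul_prod_subtype_ne _ (f none), ← key, ← hval none, Finset.mul_sum]
    refine Finset.sum_congr rfl fun l _ => ?_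
    simp only [Fintype.prod_option, Option.elim_some, Option.elim_none, hn, hrs, ← Finset.sum_mul, Function.comp]
    congr 1
    rw [Matrix.trace]
    refine Finset.sum_congr rfl fun k _ => ?_
    have : ∑ x with f x = f none, w x = w none := by
      rw [Finset.sum_filter, Fintype.sum_option, if_pos rfl]
      simp [hne]
    rw [this, Matrix.diag]
  | some y =>
    obtain ⟨b', hb'⟩ := γ.surjective none
    obtain ⟨b, rfl⟩ : ∃ b, b' = some b := by
      cases b' with
      | none => rw [hn] at hb'; cases hb'
      | some b => exact ⟨b, rfl⟩
    have hrb : Equiv.removeNone γ b = y := by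
      apply Option.some_injective
      rw [Equiv.removeNone_none γ hb', hn]
    have hrs : ∀ x, x ≠ b → γ (some x) = some (Equiv.removeNone γ x) := by
      intro x hx
      refine (Equiv.removeNone_some γ ?_).symm
      cases hc : γ (some x) with
      | none => exact absurd (Option.some_injective _ (γ.injective (hc.trans hb'.symm))) hx
      | some z => exact ⟨z, rfl⟩
    have hfb : f none = f (some b) := by rw [← hb', hinv]
    have key := h (Equiv.removeNone γ) (fun x => w (some x) + if x = b then w none else 0)
      (τ ∘ some) (by
        intro c
        simp only [Function.comp]
        by_cases hc : c = b
        · subst hc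
          rw [hrb, ← hn, hτ, ← hb', hτ, hb', if_pos rfl, Nat.bodd_add, Bool.xor_assoc]
        · rw [← hrs c hc, hτ, if_neg hc, add_zero])
      Q (f ∘ some) (by
        intro o
        obtain ⟨c, rfl⟩ := hf o
        cases c with
        | none => exact ⟨b, hfb.symm⟩
        | some c => exact ⟨c, rfl⟩)
      (by
        intro x x'
        simp only [Function.comp]
        constructor
        · intro s
          exact sameCycle_removeNone hb' hn ((hfc _ _).1 s)
        · intro s
          exact eq_of_sameCycle (h := fun a => f (some a)) (removeNone_invariant hinv) s)
      val (by
        intro c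
        simp only [Function.comp]
        rw [← hval (some c)]
        congr 3
        rw [Finset.sum_filter, Finset.sum_filter, Fintype.sum_option, hfb]
        simp_rw [ite_add_zero]
        rw [Finset.sum_add_distrib, add_comm]
        congr 1
        rw [Fintype.sum_eq_single b]
        · simp
        · intro x hx
          simp [hx])
    rw [← key]
    refine Finset.sum_congr rfl fun l _ => ?_
    simp only [Fintype.prod_option, Option.elim_some, Option.elim_none, hn]
    -- The type condition at `b` lets the projection of `none` move left past the power of `A`,
    -- where idempotence absorbs it.
    have hmul : P (τ (some b)) * A ^ (w (some b) + w none) =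
        (P (τ (some b)) * A ^ w (some b)) * (P (τ none) * A ^ w none) := by
      rw [← hb', hτ, mul_assoc, ← mul_assoc (A ^ w (some b)), ← proj_mul_pow hA, pow_add]
      simp only [← mul_assoc, hP]
    have hprod : ∀ k : K, ∏ x : C, (P (τ (some x)) * A ^ w (some x)) (l x)
        ((γ (some x)).elim k l) = (P (τ (some b)) * A ^ w (some b)) (l b) k *
          ∏ x ∈ Finset.univ.erase b, (P (τ (some x)) * A ^ w (some x)) (l x)
            (l (Equiv.removeNone γ x)) := by
      intro k
      rw [← Finset.mul_prod_erase _ _ (Finset.mem_univ b), hb']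
      congr 1
      refine Finset.prod_congr rfl fun x hx => ?_
      rw [hrs x (Finset.ne_of_mem_erase hx)]
      rfl
    simp_rw [hprod]
    rw [← Finset.mul_prod_erase _ _ (Finset.mem_univ b)]
    simp only [if_pos, Function.comp, hrb]
    rw [hmul, Matrix.mul_apply, Finset.sum_mul]
    refine Finset.sum_congr rfl fun k _ => ?_
    have : ∏ x ∈ Finset.univ.erase b, (P (τ (some x)) *
          A ^ (w (some x) + if x = b then w none else 0)) (l x) (l (Equiv.removeNone γ x)) =
        ∏ x ∈ Finset.univ.erase b, (P (τ (some x)) * A ^ w (some x)) (l x)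
            (l (Equiv.removeNone γ x)) := by
      refine Finset.prod_congr rfl fun x hx => ?_
      rw [if_neg (Finset.ne_of_mem_erase hx), add_zero]
    rw [this]
    ring

theorem cycleSumFormula (hP : ∀ b, P b * P b = P b) (hA : ∀ b, P b * A = A * P (!b))
    (C : Type u) [Fintype C] : CycleSumFormula A P C := by
  refine Fintype.induction_empty_option (P := fun C _ => CycleSumFormula A P C) ?_ ?_ ?_ C
  · intro α β _ e h
    let _ := Fintype.ofEquiv β e.symm
    have := CycleSumFormula.of_equiv e h
    convert this
  · intro γ w τ hτ Q _ f hf hfc val hval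
    have : IsEmpty Q := ⟨fun o => (hf o).choose.elim⟩
    simp
  · intro C _ h
    exact CycleSumFormula.option hP hA h

end CycleSum

end Stacking

namespace Stacking

/-! ### Gluings of edges and the cycles they create -/

/-- The set of cycles (including fixed points) of a permutation. -/
abbrev Orb {E : Type*} (γ : Equiv.Perm E) : Type _ := Quotient (Equiv.Perm.SameCycle.setoid γ)

/-- The cycle of an element. -/
abbrev orb {E : Type*} (γ : Equiv.Perm E) (e : E) : Orb γ :=
  Quotient.mk (Equiv.Perm.SameCycle.setoid γ) e

theorem orb_eq_iff {E : Type*} {γ : Equiv.Perm E} {e f : E} :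
    orb γ e = orb γ f ↔ γ.SameCycle e f :=
  ⟨fun h => Quotient.exact (s := Equiv.Perm.SameCycle.setoid γ) h,
    fun h => Quotient.sound (s := Equiv.Perm.SameCycle.setoid γ) h⟩

theorem orb_apply {E : Type*} (γ : Equiv.Perm E) (e : E) : orb γ (γ e) = orb γ e :=
  (orb_eq_iff.2 (sameCycle_apply_self γ e)).symm

theorem orb_out {E : Type*} {γ : Equiv.Perm E} (o : Orb γ) : orb γ o.out = o := Quotient.out_eq o

theorem orb_surjective {E : Type*} (γ : Equiv.Perm E) : Function.Surjective (orb γ) :=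
  fun o => ⟨o.out, orb_out o⟩

/-- `g` identifies some pairs of edges of opposite type. -/
structure IsGluing {E : Type*} (τ : E → Bool) (g : Equiv.Perm E) : Prop where
  invol : ∀ e, g (g e) = e
  type : ∀ e, g e ≠ e → τ (g e) = !τ e

/-! ### Free edges and the weights of cycles. -/

section Weights

open scoped Classical

variable {E : Type*}

/-- The number `1` for an unidentified edge, and `0` otherwise. -/
noncomputable def freeEdge (g : Equiv.Perm E) (e : E) : ℕ := if g e = e then 1 else 0

theorem freeEdge_pos {g : Equiv.Perm E} {e : E} (h : g e = e) : freeEdge g e = 1 := if_pos h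

theorem freeEdge_neg {g : Equiv.Perm E} {e : E} (h : g e ≠ e) : freeEdge g e = 0 := if_neg h

/-- `φ` flips the type, and so does `g` on identified edges, where the two flips cancel. This is the
compatibility required in `CycleSumFormula` for the exponents `freeEdge g`. -/
theorem type_turn {τ : E → Bool} {φ g : Equiv.Perm E} (hφ : ∀ e, τ (φ e) = !τ e)
    (hg : IsGluing τ g) (e : E) : τ ((φ * g) e) = (τ e ^^ (freeEdge g e).bodd) := by
  rw [Equiv.Perm.mul_apply, hφ]
  by_cases h : g e = e
  · rw [freeEdge_pos h, h]; simp
  · rw [hg.type e h, freeEdge_neg h]; simp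

variable [Fintype E]

/-- The number of unidentified edges on a cycle. -/
noncomputable def orbWeight (φ g : Equiv.Perm E) (o : Orb (φ * g)) : ℕ :=
  (Finset.univ.filter fun e => orb (φ * g) e = o ∧ g e = e).card

/-- The factor that a cycle contributes: `x` or `y` for a cycle without unidentified edges, and
`θ l` for a cycle with `2 l` unidentified edges. -/
noncomputable def orbFactor {R : Type*} (τ : E → Bool) (φ g : Equiv.Perm E) (x y : R) (θ : ℕ → R)
    (o : Orb (φ * g)) : R :=
  if orbWeight φ g o = 0 then bif τ o.out then y else x else θ (orbWeight φ g o / 2)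

/-- The product of the factors of all cycles. -/
noncomputable def glueWeight {R : Type*} [CommMonoid R] (τ : E → Bool) (φ g : Equiv.Perm E)
    (x y : R) (θ : ℕ → R) : R :=
  ∏ o : Orb (φ * g), orbFactor τ φ g x y θ o

variable {τ : E → Bool} {φ g : Equiv.Perm E}

theorem orbWeight_eq_sum (o : Orb (φ * g)) :
    orbWeight φ g o = ∑ e with orb (φ * g) e = o, freeEdge g e := by
  rw [orbWeight, Finset.card_filter, Finset.sum_filter]
  refine Finset.sum_congr rfl fun e _ => ?_
  by_cases h : orb (φ * g) e = o <;> simp [h, freeEdge]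

/-- Along a cycle the type changes exactly at the unidentified edges and has to return to its
initial value. Formally, the sum of the types mod 2 over the cycle is invariant under `φ * g`. -/
theorem even_orbWeight (hφ : ∀ e, τ (φ e) = !τ e) (hg : IsGluing τ g) (o : Orb (φ * g)) :
    Even (orbWeight φ g o) := by
  rw [orbWeight_eq_sum, ← ZMod.natCast_eq_zero_iff_even]
  let b : E → ZMod 2 := fun e => bif τ e then 1 else 0
  have hb : ∀ e, b ((φ * g) e) = b e + (freeEdge g e : ZMod 2) := by
    intro e
    simp only [b]
    rw [type_turn hφ hg]
    by_cases h : g e = e <;> cases τ e <;> simp [h, freeEdge]; decide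
  have h1 : ∑ e with orb (φ * g) e = o, b ((φ * g) e) = ∑ e with orb (φ * g) e = o, b e := by
    rw [Finset.sum_filter, Finset.sum_filter]
    refine Fintype.sum_equiv (φ * g) _ _ fun e => ?_
    rw [orb_apply]
  simp_rw [hb, Finset.sum_add_distrib] at h1
  push_cast
  simpa using h1

theorem gluing_of_orbWeight_eq_zero {e : E} (h : orbWeight φ g (orb (φ * g) e) = 0) :
    g e ≠ e := by
  intro he
  rw [orbWeight, Finset.card_eq_zero] at h
  have : e ∈ Finset.univ.filter fun e' => orb (φ * g) e' = orb (φ * g) e ∧ g e' = e' := by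
    simp [he]
  rw [h] at this
  simp at this

theorem type_eq_of_orbWeight_eq_zero (hφ : ∀ e, τ (φ e) = !τ e) (hg : IsGluing τ g)
    {o : Orb (φ * g)} (h : orbWeight φ g o = 0) {e : E} (he : orb (φ * g) e = o) :
    τ e = τ o.out := by
  have key : ∀ e f, (φ * g).SameCycle e f → orb (φ * g) e = o → τ e = τ f := by
    intro e f hs heo
    -- Replaced by a constant off the cycle `o`, the type is invariant under the whole permutation.
    have := eq_of_sameCycle (γ := φ * g) (h := fun e => if orb (φ * g) e = o then τ e else true) (by
      intro e
      simp only [orb_apply]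
      by_cases h1 : orb (φ * g) e = o
      · have : g e ≠ e := gluing_of_orbWeight_eq_zero (φ := φ) (by rw [h1, h])
        rw [if_pos h1, if_pos h1, type_turn hφ hg, freeEdge_neg this]
        simp
      · rw [if_neg h1, if_neg h1]) hs
    simp only [if_pos heo] at this
    rwa [← orb_eq_iff.2 hs, if_pos heo] at this
  exact key e o.out (orb_eq_iff.1 (by rw [orb_out, he])) he

end Weights

/-! ### Index sums as weights of cycles. -/

section IndexSum

variable {ι κ : Type*} [Fintype ι] [Fintype κ] [DecidableEq ι] [DecidableEq κ]

/-- The block matrix with off-diagonal blocks `Y` and `Yᴴ`. -/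
def hermBlock (Y : Matrix ι κ ℂ) : Matrix (ι ⊕ κ) (ι ⊕ κ) ℂ := Matrix.fromBlocks 0 Y Yᴴ 0

/-- The projections to the two kinds of indices. -/
def kindProj (b : Bool) : Matrix (ι ⊕ κ) (ι ⊕ κ) ℂ :=
  bif b then Matrix.fromBlocks 0 0 0 1 else Matrix.fromBlocks 1 0 0 0

theorem kindProj_mul_self (b : Bool) :
    kindProj b * kindProj b = (kindProj b : Matrix (ι ⊕ κ) (ι ⊕ κ) ℂ) := by
  cases b <;> simp [kindProj, Matrix.fromBlocks_multiply]

theorem kindProj_mul_hermBlock (Y : Matrix ι κ ℂ) (b : Bool) :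
    kindProj b * hermBlock Y = hermBlock Y * kindProj (!b) := by
  cases b <;> simp [kindProj, hermBlock, Matrix.fromBlocks_multiply]

theorem hermBlock_pow (Y : Matrix ι κ ℂ) (l : ℕ) :
    hermBlock Y ^ (2 * l) = Matrix.fromBlocks ((Y * Yᴴ) ^ l) 0 0 ((Yᴴ * Y) ^ l) := by
  rw [pow_mul]
  have : hermBlock Y ^ 2 = Matrix.fromBlocks (Y * Yᴴ) 0 0 (Yᴴ * Y) := by
    rw [pow_two, hermBlock, Matrix.fromBlocks_multiply]; simp
  rw [this, Matrix.fromBlocks_diagonal_pow]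

theorem trace_pow_comm (Y : Matrix ι κ ℂ) {l : ℕ} (hl : l ≠ 0) :
    ((Yᴴ * Y) ^ l).trace = ((Y * Yᴴ) ^ l).trace := by
  obtain ⟨l, rfl⟩ := Nat.exists_eq_succ_of_ne_zero hl
  have h : ∀ l : ℕ, Y * (Yᴴ * Y) ^ l = (Y * Yᴴ) ^ l * Y := by
    intro l
    induction l with
    | zero => simp
    | succ l ih => rw [pow_succ, ← Matrix.mul_assoc, ih, pow_succ]; simp only [Matrix.mul_assoc]
  rw [Nat.succ_eq_add_one, pow_succ', Matrix.mul_assoc, Matrix.trace_mul_comm, h, Matrix.mul_assoc,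
    pow_succ]

theorem trace_kindProj_mul (Y : Matrix ι κ ℂ) (b : Bool) {l : ℕ} (hl : l ≠ 0) :
    (kindProj b * hermBlock Y ^ (2 * l)).trace = ((Y * Yᴴ) ^ l).trace := by
  rw [hermBlock_pow]
  cases b
  · simp [kindProj, Matrix.fromBlocks_multiply, Matrix.trace]
  · rw [← trace_pow_comm Y hl]
    simp [kindProj, Matrix.fromBlocks_multiply, Matrix.trace]

theorem trace_kindProj (b : Bool) : (kindProj b : Matrix (ι ⊕ κ) (ι ⊕ κ) ℂ).trace =
    bif b then (Fintype.card κ : ℂ) else (Fintype.card ι : ℂ) := by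
  cases b <;> simp [kindProj, Matrix.trace]

/-- The kernel of an edge: a matrix entry, or a Kronecker delta if the edge is identified. -/
noncomputable def edgeKernel {E : Type*} (τ : E → Bool) (g : Equiv.Perm E) (Y : Matrix ι κ ℂ)
    (e : E) : Matrix (ι ⊕ κ) (ι ⊕ κ) ℂ :=
  kindProj (τ e) * hermBlock Y ^ freeEdge g e

/-- The cycle sum formula for `A = hermBlock Y`. A cycle with `2 * l > 0` free edges gives the same
trace for either type, since `Y * Yᴴ` and `Yᴴ * Y` have the same trace moments; a cycle with none
gives the trace of a projection, the number of rows or of columns. -/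
theorem sum_kernel_eq_glueWeight {E : Type u} [Fintype E] [DecidableEq E] {τ : E → Bool}
    {φ g : Equiv.Perm E}
    (hφ : ∀ e, τ (φ e) = !τ e) (hg : IsGluing τ g) (Y : Matrix ι κ ℂ) :
    ∑ l : E → ι ⊕ κ, ∏ e, edgeKernel τ g Y e (l e) (l ((φ * g) e)) =
    glueWeight τ φ g (Fintype.card ι : ℂ) (Fintype.card κ) fun l => ((Y * Yᴴ) ^ l).trace := by
  classical
  have key := cycleSumFormula (A := hermBlock Y) (P := kindProj) kindProj_mul_self
    (kindProj_mul_hermBlock Y) E (φ * g) (freeEdge g) τ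
    (fun e => type_turn hφ hg e) (Orb (φ * g)) (orb (φ * g)) (orb_surjective _)
    (fun x y => orb_eq_iff)
    (orbFactor τ φ g (Fintype.card ι : ℂ) (Fintype.card κ) fun l => ((Y * Yᴴ) ^ l).trace) ?_
  · rw [glueWeight, ← key]
    refine Finset.sum_congr (by ext; simp) fun l _ => rfl
  intro e
  have hw : (∑ x with orb (φ * g) x = orb (φ * g) e, freeEdge g x) =
      orbWeight φ g (orb (φ * g) e) := by
    rw [orbWeight_eq_sum]
  refine Eq.trans (congrArg (fun m => (kindProj (τ e) * hermBlock Y ^ m).trace) ?_)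
    (?_ : (kindProj (τ e) * hermBlock Y ^ (orbWeight φ g (orb (φ * g) e))).trace = _)
  · rw [← hw]
    exact Finset.sum_congr (by ext; simp) fun _ _ => rfl
  obtain ⟨l, hl⟩ := even_orbWeight hφ hg (orb (φ * g) e)
  rw [orbFactor]
  by_cases h0 : orbWeight φ g (orb (φ * g) e) = 0
  · rw [if_pos h0, ← type_eq_of_orbWeight_eq_zero hφ hg h0 rfl, h0, pow_zero, mul_one,
      trace_kindProj]
  · rw [if_neg h0, hl, ← two_mul, Nat.mul_div_cancel_left _ two_pos,
      trace_kindProj_mul Y (τ e) (by omega : l ≠ 0)]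

end IndexSum

/-! ### Partial matchings and their involutions. -/

section PartialMatching

/-- A partial matching: a bijection between two subsets of `I`. -/
abbrev PartialMatching (I : Type*) : Type _ := Σ ρ : Finset I × Finset I, (ρ.1 ≃ ρ.2)

variable {I : Type u}

/-- The successor of an edge; the edge `inl i` is followed by `inr i`, and then by `inl (c i)`. -/
def nextEdge (c : Equiv.Perm I) : Equiv.Perm (I ⊕ I) where
  toFun := Sum.elim Sum.inr fun i => Sum.inl (c i)
  invFun := Sum.elim (fun i => Sum.inr (c.symm i)) Sum.inl
  left_inv := by rintro (i | i) <;> simp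
  right_inv := by rintro (i | i) <;> simp

@[simp] theorem nextEdge_inl (c : Equiv.Perm I) (i : I) : nextEdge c (Sum.inl i) = Sum.inr i := rfl

@[simp] theorem nextEdge_inr (c : Equiv.Perm I) (i : I) :
    nextEdge c (Sum.inr i) = Sum.inl (c i) := rfl

theorem isRight_nextEdge (c : Equiv.Perm I) (e : I ⊕ I) :
    (nextEdge c e).isRight = !e.isRight := by
  cases e <;> rfl

variable [DecidableEq I]

/-- The partner of an edge. -/
def partner (π : PartialMatching I) : I ⊕ I → I ⊕ I
  | Sum.inl j => if h : j ∈ π.1.2 then Sum.inr (π.2.symm ⟨j, h⟩ : I) else Sum.inl j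
  | Sum.inr i => if h : i ∈ π.1.1 then Sum.inl (π.2 ⟨i, h⟩ : I) else Sum.inr i

theorem partner_involutive (π : PartialMatching I) : Function.Involutive (partner π) := by
  rintro (j | i)
  · by_cases h : j ∈ π.1.2
    · simp [partner, h]
    · simp [partner, h]
  · by_cases h : i ∈ π.1.1
    · simp [partner, h]
    · simp [partner, h]

/-- The involution that exchanges the identified edges. -/
def gluePerm (π : PartialMatching I) : Equiv.Perm (I ⊕ I) := (partner_involutive π).toPerm

theorem gluePerm_inl_mem {π : PartialMatching I} {j : I} (h : j ∈ π.1.2) :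
    gluePerm π (Sum.inl j) = Sum.inr (π.2.symm ⟨j, h⟩ : I) := by
  show partner π (Sum.inl j) = _
  simp [partner, h]

theorem gluePerm_inl_notMem {π : PartialMatching I} {j : I} (h : j ∉ π.1.2) :
    gluePerm π (Sum.inl j) = Sum.inl j := by
  show partner π (Sum.inl j) = _
  simp [partner, h]

theorem gluePerm_inr_mem {π : PartialMatching I} {i : I} (h : i ∈ π.1.1) :
    gluePerm π (Sum.inr i) = Sum.inl (π.2 ⟨i, h⟩ : I) := by
  show partner π (Sum.inr i) = _
  simp [partner, h]

theorem gluePerm_inr_notMem {π : PartialMatching I} {i : I} (h : i ∉ π.1.1) :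
    gluePerm π (Sum.inr i) = Sum.inr i := by
  show partner π (Sum.inr i) = _
  simp [partner, h]

theorem gluePerm_inl_eq_iff {π : PartialMatching I} {j : I} :
    gluePerm π (Sum.inl j) = Sum.inl j ↔ j ∉ π.1.2 := by
  by_cases h : j ∈ π.1.2
  · simp [gluePerm_inl_mem h, h]
  · simp [gluePerm_inl_notMem h, h]

theorem gluePerm_inr_eq_iff {π : PartialMatching I} {i : I} :
    gluePerm π (Sum.inr i) = Sum.inr i ↔ i ∉ π.1.1 := by
  by_cases h : i ∈ π.1.1
  · simp [gluePerm_inr_mem h, h]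
  · simp [gluePerm_inr_notMem h, h]

theorem isGluing_gluePerm (π : PartialMatching I) : IsGluing Sum.isRight (gluePerm π) where
  invol := partner_involutive π
  type := by
    rintro (j | i) he
    · rw [Ne, gluePerm_inl_eq_iff, not_not] at he
      rw [gluePerm_inl_mem he]; rfl
    · rw [Ne, gluePerm_inr_eq_iff, not_not] at he
      rw [gluePerm_inr_mem he]; rfl

theorem prod_split {M : Type*} [CommMonoid M] [Fintype I] (s : Finset I) (F : I → M) :
    ∏ i, F i = (∏ i : s, F i) * ∏ i ∈ sᶜ, F i := by
  rw [← Finset.prod_mul_prod_compl s, Finset.prod_coe_sort]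

variable [Fintype I] {ι κ : Type*} [Fintype ι] [Fintype κ] [DecidableEq ι] [DecidableEq κ]

/-- The sum over all row and column indices in which the matched entries of a cyclic product are
contracted. -/
theorem index_sum_eq_glueWeight (c : Equiv.Perm I) (π : PartialMatching I) (Y : Matrix ι κ ℂ) :
    ∑ r : I → ι, ∑ k : I → κ,
      (∏ i : π.1.1, if r (c i) = r (π.2 i) ∧ k i = k (π.2 i) then (1 : ℂ) else 0) *
      (∏ i ∈ π.1.1ᶜ, star (Y (r (c i)) (k i))) * ∏ j ∈ π.1.2ᶜ, Y (r j) (k j) =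
    glueWeight Sum.isRight (nextEdge c) (gluePerm π) (Fintype.card ι : ℂ) (Fintype.card κ)
      fun l => ((Y * Yᴴ) ^ l).trace := by
  rw [← sum_kernel_eq_glueWeight (isRight_nextEdge c) (isGluing_gluePerm π) Y,
    ← Fintype.sum_prod_type' (f := fun (r : I → ι) (k : I → κ) =>
      (∏ i : π.1.1, if r (c i) = r (π.2 i) ∧ k i = k (π.2 i) then (1 : ℂ) else 0) *
      (∏ i ∈ π.1.1ᶜ, star (Y (r (c i)) (k i))) * ∏ j ∈ π.1.2ᶜ, Y (r j) (k j))]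
  refine Finset.sum_of_injOn
    (fun q : (I → ι) × (I → κ) => (Sum.elim (Sum.inl ∘ q.1) (Sum.inr ∘ q.2) : I ⊕ I → ι ⊕ κ))
    ?_ (fun _ _ => Finset.mem_coe.2 (Finset.mem_univ _)) ?_ ?_
  · rintro ⟨r, k⟩ _ ⟨r', k'⟩ _ h
    ext i
    · have := congrFun h (Sum.inl i)
      simpa using this
    · have := congrFun h (Sum.inr i)
      simpa using this
  -- Labellings outside the image give a column index to an odd edge or a row index to an even one;
  -- the projection in the kernel of that edge then annihilates the product.
  · intro l _ hl
    by_contra hne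
    rw [← ne_eq, Finset.prod_ne_zero_iff] at hne
    have hleft : ∀ i, (l (Sum.inl i)).isRight = false := by
      intro i
      have := hne (Sum.inl i) (Finset.mem_univ _)
      cases h : l (Sum.inl i) with
      | inl => rfl
      | inr x =>
        refine absurd ?_ this
        rw [edgeKernel, Matrix.mul_apply]
        refine Finset.sum_eq_zero fun y _ => ?_
        rw [h]
        cases y <;> simp [kindProj]
    have hright : ∀ i, (l (Sum.inr i)).isRight = true := by
      intro i
      have := hne (Sum.inr i) (Finset.mem_univ _)
      cases h : l (Sum.inr i) with
      | inr => rfl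
      | inl x =>
        refine absurd ?_ this
        rw [edgeKernel, Matrix.mul_apply]
        refine Finset.sum_eq_zero fun y _ => ?_
        rw [h]
        cases y <;> simp [kindProj]
    apply hl
    have h1 : ∀ i, ∃ x, l (Sum.inl i) = Sum.inl x := by
      intro i
      have := hleft i
      cases h : l (Sum.inl i) with
      | inl x => exact ⟨x, rfl⟩
      | inr x => rw [h] at this; cases this
    have h2 : ∀ i, ∃ x, l (Sum.inr i) = Sum.inr x := by
      intro i
      have := hright i
      cases h : l (Sum.inr i) with
      | inr x => exact ⟨x, rfl⟩
      | inl x => rw [h] at this; cases this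
    choose r hr using h1
    choose k hk using h2
    refine ⟨(r, k), Finset.mem_coe.2 (Finset.mem_univ _), ?_⟩
    funext e
    cases e
    · simp [hr]
    · simp [hk]
  · rintro ⟨r, k⟩ -
    rw [Fintype.prod_sum_type, prod_split π.1.2, prod_split π.1.1 (fun i =>
      edgeKernel Sum.isRight (gluePerm π) Y (Sum.inr i) _ _)]
    -- An identified odd edge yields the delta of the row indices, and its even partner (`e3`) that
    -- of the column indices; together they form the contraction of the pair.
    have e1 : ∀ j : π.1.2, edgeKernel Sum.isRight (gluePerm π) Y (Sum.inl (j : I))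
        ((Sum.elim (Sum.inl ∘ r) (Sum.inr ∘ k) : I ⊕ I → ι ⊕ κ) (Sum.inl j))
        ((Sum.elim (Sum.inl ∘ r) (Sum.inr ∘ k) : I ⊕ I → ι ⊕ κ)
          ((nextEdge c * gluePerm π) (Sum.inl j))) =
        if r (c (π.2.symm j)) = r j then 1 else 0 := by
      intro j
      rw [edgeKernel, freeEdge_neg (by rw [Ne, gluePerm_inl_eq_iff, not_not]; exact j.2), Equiv.Perm.mul_apply,
        gluePerm_inl_mem j.2]
      simp [kindProj, Matrix.one_apply, eq_comm]
    have e2 : ∀ j ∈ π.1.2ᶜ, edgeKernel Sum.isRight (gluePerm π) Y (Sum.inl (j : I))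
        ((Sum.elim (Sum.inl ∘ r) (Sum.inr ∘ k) : I ⊕ I → ι ⊕ κ) (Sum.inl j))
        ((Sum.elim (Sum.inl ∘ r) (Sum.inr ∘ k) : I ⊕ I → ι ⊕ κ)
          ((nextEdge c * gluePerm π) (Sum.inl j))) = Y (r j) (k j) := by
      intro j hj
      rw [Finset.mem_compl] at hj
      rw [edgeKernel, freeEdge_pos (by rwa [gluePerm_inl_eq_iff]), Equiv.Perm.mul_apply, gluePerm_inl_notMem hj]
      simp [kindProj, hermBlock, Matrix.fromBlocks_multiply]
    have e3 : ∀ i : π.1.1, edgeKernel Sum.isRight (gluePerm π) Y (Sum.inr (i : I))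
        ((Sum.elim (Sum.inl ∘ r) (Sum.inr ∘ k) : I ⊕ I → ι ⊕ κ) (Sum.inr i))
        ((Sum.elim (Sum.inl ∘ r) (Sum.inr ∘ k) : I ⊕ I → ι ⊕ κ)
          ((nextEdge c * gluePerm π) (Sum.inr i))) =
        if k i = k (π.2 i) then 1 else 0 := by
      intro j
      rw [edgeKernel, freeEdge_neg (by rw [Ne, gluePerm_inr_eq_iff, not_not]; exact j.2), Equiv.Perm.mul_apply,
        gluePerm_inr_mem j.2]
      simp [kindProj, Matrix.one_apply]
    have e4 : ∀ j ∈ π.1.1ᶜ, edgeKernel Sum.isRight (gluePerm π) Y (Sum.inr (j : I))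
        ((Sum.elim (Sum.inl ∘ r) (Sum.inr ∘ k) : I ⊕ I → ι ⊕ κ) (Sum.inr j))
        ((Sum.elim (Sum.inl ∘ r) (Sum.inr ∘ k) : I ⊕ I → ι ⊕ κ)
          ((nextEdge c * gluePerm π) (Sum.inr j))) = star (Y (r (c j)) (k j)) := by
      intro j hj
      rw [Finset.mem_compl] at hj
      rw [edgeKernel, freeEdge_pos (by rwa [gluePerm_inr_eq_iff]), Equiv.Perm.mul_apply, gluePerm_inr_notMem hj]
      simp [kindProj, hermBlock, Matrix.fromBlocks_multiply]
    rw [Finset.prod_congr rfl fun j _ => e1 j, Finset.prod_congr rfl e2,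
      Finset.prod_congr rfl fun j _ => e3 j, Finset.prod_congr rfl e4]
    have e5 : (∏ j : π.1.2, if r (c (π.2.symm j)) = r j then (1 : ℂ) else 0) =
        ∏ i : π.1.1, if r (c i) = r (π.2 i) then (1 : ℂ) else 0 := by
      refine (Fintype.prod_equiv π.2 _ _ fun i => ?_).symm
      simp
    have e6 : (∏ i : π.1.1, if r (c i) = r (π.2 i) ∧ k i = k (π.2 i) then (1 : ℂ) else 0) =
        (∏ i : π.1.1, if r (c i) = r (π.2 i) then (1 : ℂ) else 0) *
        ∏ i : π.1.1, if k i = k (π.2 i) then (1 : ℂ) else 0 := by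
      rw [← Finset.prod_mul_distrib]
      refine Finset.prod_congr rfl fun i _ => ?_
      by_cases h1 : r (c i) = r (π.2 i) <;> by_cases h2 : k i = k (π.2 i) <;> simp [h1, h2]
    rw [e5, e6]
    ring

end PartialMatching

end Stacking

namespace Stacking

/-! ### Splitting a gluing weight into free cycles and blocks. -/

section Weights

open scoped Classical

variable {E : Type*} [Fintype E]

/-- The number of cycles without unidentified edges and with edges of type `b`. -/
noncomputable def numFree (τ : E → Bool) (φ g : Equiv.Perm E) (b : Bool) : ℕ :=
  (Finset.univ.filter fun o : Orb (φ * g) => orbWeight φ g o = 0 ∧ τ o.out = b).card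

theorem glueWeight_eq {R : Type*} [CommMonoid R] (τ : E → Bool) (φ g : Equiv.Perm E)
    (x y : R) (θ : ℕ → R) :
    glueWeight τ φ g x y θ = x ^ numFree τ φ g false * y ^ numFree τ φ g true *
      ∏ o : Orb (φ * g) with orbWeight φ g o ≠ 0, θ (orbWeight φ g o / 2) := by
  rw [glueWeight, ← Finset.prod_filter_not_mul_prod_filter _ (fun o => orbWeight φ g o ≠ 0)]
  congr 1
  · simp only [not_not]
    rw [← Finset.prod_filter_not_mul_prod_filter _ (fun o => τ o.out = true)]
    congr 1
    · rw [numFree, ← Finset.prod_const, Finset.filter_filter]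
      refine Finset.prod_congr (by ext o; simp) fun o ho => ?_
      simp only [Finset.mem_filter] at ho
      rw [orbFactor, if_pos ho.2.1, ho.2.2]
      rfl
    · rw [numFree, ← Finset.prod_const, Finset.filter_filter]
      refine Finset.prod_congr rfl fun o ho => ?_
      simp only [Finset.mem_filter] at ho
      rw [orbFactor, if_pos ho.2.1, ho.2.2]
      rfl
  · refine Finset.prod_congr rfl fun o ho => ?_
    rw [orbFactor, if_neg (Finset.mem_filter.1 ho).2]

theorem orbWeight_eq_zero_iff {φ g : Equiv.Perm E} {o : Orb (φ * g)} :
    orbWeight φ g o = 0 ↔ ∀ e, orb (φ * g) e = o → g e ≠ e := by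
  rw [orbWeight, Finset.card_eq_zero, Finset.filter_eq_empty_iff]
  simp

theorem sum_orbWeight (φ g : Equiv.Perm E) :
    ∑ o : Orb (φ * g), orbWeight φ g o = (Finset.univ.filter fun e => g e = e).card := by
  rw [Finset.card_eq_sum_card_fiberwise (f := orb (φ * g)) (t := Finset.univ) (by simp)]
  refine Finset.sum_congr rfl fun o _ => ?_
  rw [orbWeight, Finset.filter_filter]
  congr 1
  ext e
  simp [and_comm]

end Weights

/-! ### Vertex classes and edge blocks as cycles of `turn π`. -/

section FrozenGluing

variable {p : ℕ}

/-- An edge and its starting vertex carry the same label, so a cycle of edges can also be read as a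
cycle of vertices. -/
theorem edgeStart_eq (e : Edge p) : edgeStart e = e := by cases e <;> rfl

theorem edgeEnd_eq (e : Edge p) : edgeEnd e = nextEdge (finRotate p) e := by cases e <;> rfl

theorem isDeterministic_iff (π : PartialPerm p) (e : Edge p) :
    IsDeterministic π e ↔ gluePerm π e = e := by
  cases e with
  | inl j => exact gluePerm_inl_eq_iff.symm
  | inr i => exact gluePerm_inr_eq_iff.symm

/-- The permutation that moves an edge to the next edge after the identification. -/
abbrev turn (π : PartialPerm p) : Equiv.Perm (Edge p) := nextEdge (finRotate p) * gluePerm π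

theorem turn_of_isDeterministic {π : PartialPerm p} {e : Edge p} (h : IsDeterministic π e) :
    turn π e = edgeEnd e := by
  rw [isDeterministic_iff] at h
  rw [edgeEnd_eq, Equiv.Perm.mul_apply, h]

/-- `turn π` sends an identified edge to the end of its partner, and the orientation-reversing
identification glues that end to the start of the edge. -/
theorem vertexClass_turn {π : PartialPerm p} {e : Edge p} (h : ¬ IsDeterministic π e) :
    vertexClass π (turn π e) = vertexClass π e := by
  refine Quotient.sound (s := vertexSetoid π) ?_
  cases e with
  | inl j =>
    have hj : j ∈ π.1.2 := not_not.1 h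
    rw [Equiv.Perm.mul_apply, gluePerm_inl_mem hj]
    have := VertexGlue.end_start (π := π) (π.2.symm ⟨j, hj⟩)
    rw [Equiv.apply_symm_apply] at this
    exact Relation.EqvGen.rel _ _ this
  | inr i =>
    have hi : i ∈ π.1.1 := not_not.1 h
    rw [Equiv.Perm.mul_apply, gluePerm_inr_mem hi]
    exact Relation.EqvGen.symm _ _ (Relation.EqvGen.rel _ _ (VertexGlue.start_end ⟨i, hi⟩))

theorem orb_turn_of_vertexGlue {π : PartialPerm p} {v w : Vertex p} (h : VertexGlue π v w) :
    orb (turn π) v = orb (turn π) w := by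
  cases h with
  | start_end i =>
    rw [← orb_apply]
    congr 1
    rw [edgeStart_eq, edgeEnd_eq, Equiv.Perm.mul_apply, gluePerm_inr_mem i.2]
  | end_start i =>
    rw [← orb_apply (turn π) (edgeStart _)]
    congr 1
    rw [edgeStart_eq, edgeEnd_eq, Equiv.Perm.mul_apply, gluePerm_inl_mem (π.2 i).2]
    simp

/-- The cycle that contains a vertex class. -/
def classOrb (π : PartialPerm p) : VertexClass π → Orb (turn π) :=
  Quotient.lift (orb (turn π)) (by
    intro a b h
    induction h with
    | rel _ _ h => exact orb_turn_of_vertexGlue h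
    | refl => rfl
    | symm _ _ _ ih => exact ih.symm
    | trans _ _ _ _ _ ih1 ih2 => exact ih1.trans ih2)

theorem classOrb_mk (π : PartialPerm p) (v : Vertex p) :
    classOrb π (vertexClass π v) = orb (turn π) v := rfl

theorem orb_of_borders {π : PartialPerm p} {e : Edge p} {c : VertexClass π}
    (he : IsDeterministic π e) (h : Borders π e c) : orb (turn π) e = classOrb π c := by
  rcases h with h | h
  · rw [← h, edgeStart_eq, classOrb_mk]
  · rw [← h, classOrb_mk, ← turn_of_isDeterministic he, orb_apply]

/-- The cycle that contains a block of deterministic edges. -/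
def blockOrb (π : PartialPerm p) : EdgeBlock π → Orb (turn π) :=
  Quotient.lift (fun e => orb (turn π) e.1) (by
    intro a b h
    induction h with
    | rel e f h =>
      obtain ⟨c, hc⟩ := h
      exact (orb_of_borders e.2 hc.1).trans (orb_of_borders f.2 hc.2).symm
    | refl => rfl
    | symm _ _ _ ih => exact ih.symm
    | trans _ _ _ _ _ ih1 ih2 => exact ih1.trans ih2)

theorem blockOrb_mk (π : PartialPerm p) (e : {e : Edge p // IsDeterministic π e}) :
    blockOrb π (Quotient.mk (edgeSetoid π) e) = orb (turn π) e.1 := rfl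

/-- Deterministic edges on a common cycle are connected through the vertices between them. The
property `near`, to border a deterministic edge of the given block, propagates along the cycle: the
vertex class does not change at identified edges, and a deterministic edge borders both of its ends.
-/
theorem blockOrb_injective (π : PartialPerm p) : Function.Injective (blockOrb π) := by
  rintro ⟨e⟩ ⟨f⟩ h
  change orb (turn π) e.1 = orb (turn π) f.1 at h
  change Quotient.mk (edgeSetoid π) e = Quotient.mk (edgeSetoid π) f
  let B := Quotient.mk (edgeSetoid π) e
  have hrel : ∀ (a b : {e : Edge p // IsDeterministic π e}) (c : VertexClass π),
      Borders π a.1 c → Borders π b.1 c →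
        Quotient.mk (edgeSetoid π) a = Quotient.mk (edgeSetoid π) b := fun a b c ha hb =>
    Quotient.sound (s := edgeSetoid π) (Relation.EqvGen.rel _ _ ⟨c, ha, hb⟩)
  let near : Edge p → Prop := fun x => ∃ a, Quotient.mk (edgeSetoid π) a = B ∧
    Borders π a.1 (vertexClass π x)
  have hnear : ∀ x, near (turn π x) = near x := by
    intro x
    by_cases hx : IsDeterministic π x
    · have h1 : Borders π x (vertexClass π (turn π x)) := by
        rw [turn_of_isDeterministic hx]; exact Or.inr rfl
      have h2 : Borders π x (vertexClass π x) := Or.inl (by rw [edgeStart_eq])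
      apply propext
      constructor
      · rintro ⟨a, ha, hb⟩
        exact ⟨⟨x, hx⟩, (hrel _ a _ h1 hb).trans ha, h2⟩
      · rintro ⟨a, ha, hb⟩
        exact ⟨⟨x, hx⟩, (hrel _ a _ h2 hb).trans ha, h1⟩
    · simp only [near, vertexClass_turn hx]
  have he : near e.1 := ⟨e, rfl, Or.inl (by rw [edgeStart_eq])⟩
  rw [eq_of_sameCycle hnear (orb_eq_iff.1 h)] at he
  obtain ⟨a, ha, hb⟩ := he
  exact ha.symm.trans (hrel a f _ hb (Or.inl (by rw [edgeStart_eq])))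

theorem orbWeight_eq_natCard {E : Type*} [Fintype E] (φ g : Equiv.Perm E) (o : Orb (φ * g)) :
    orbWeight φ g o = Nat.card {e // orb (φ * g) e = o ∧ g e = e} := by
  rw [orbWeight, Nat.subtype_card]
  simp

theorem numFree_eq_natCard {E : Type*} [Fintype E] (τ : E → Bool) (φ g : Equiv.Perm E) (b : Bool) :
    numFree τ φ g b = Nat.card {o : Orb (φ * g) // orbWeight φ g o = 0 ∧ τ o.out = b} := by
  rw [numFree, Nat.subtype_card]
  simp

theorem blockCard_eq (π : PartialPerm p) (b : EdgeBlock π) :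
    blockCard π b = orbWeight (nextEdge (finRotate p)) (gluePerm π) (blockOrb π b) := by
  rw [blockCard, orbWeight_eq_natCard]
  refine Nat.card_congr
    ⟨fun e => ⟨e.1.1, ?_, (isDeterministic_iff π _).1 e.1.2⟩,
      fun e => ⟨⟨e.1, (isDeterministic_iff π _).2 e.2.2⟩, blockOrb_injective π e.2.1⟩,
      fun e => rfl, fun e => rfl⟩
  exact (blockOrb_mk π e.1).symm.trans (congrArg (blockOrb π) e.2)

theorem exists_blockOrb_eq {π : PartialPerm p} {o : Orb (turn π)}
    (h : orbWeight (nextEdge (finRotate p)) (gluePerm π) o ≠ 0) : ∃ b, blockOrb π b = o := by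
  rw [orbWeight, Finset.card_ne_zero] at h
  obtain ⟨e, he⟩ := h
  simp only [Finset.mem_filter, Finset.mem_univ, true_and] at he
  exact ⟨Quotient.mk _ ⟨e, (isDeterministic_iff π e).2 he.2⟩, he.1⟩

theorem orbWeight_blockOrb_ne_zero (π : PartialPerm p) (b : EdgeBlock π) :
    orbWeight (nextEdge (finRotate p)) (gluePerm π) (blockOrb π b) ≠ 0 := by
  obtain ⟨e, rfl⟩ := Quotient.exists_rep b
  rw [orbWeight, Finset.card_ne_zero]
  exact ⟨e.1, by simp only [Finset.mem_filter, Finset.mem_univ, true_and]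
                 exact ⟨rfl, (isDeterministic_iff π _).1 e.2⟩⟩

/-- Along `turn π` the vertex class can change only at deterministic edges, and a class that borders
none of them is never left. -/
theorem vertexClass_eq_of_free {π : PartialPerm p} {c : VertexClass π}
    (hc : ∀ e, IsDeterministic π e → ¬ Borders π e c) {v w : Vertex p}
    (s : (turn π).SameCycle v w) (hv : vertexClass π v = c) : vertexClass π w = c := by
  have := eq_of_sameCycle (γ := turn π) (h := fun x => vertexClass π x = c) (by
    intro x
    by_cases hx : IsDeterministic π x
    · refine propext ⟨fun h => absurd ?_ (hc x hx), fun h => absurd ?_ (hc x hx)⟩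
      · exact Or.inr (by rw [← turn_of_isDeterministic hx, h])
      · exact Or.inl (by rw [edgeStart_eq, h])
    · rw [vertexClass_turn hx]) s
  exact this.mp hv

/-- `classOrb` restricts to a bijection between the classes and the cycles without deterministic
edges. Since the type is constant on such a cycle, the parity of the class can be read off at one
representative. -/
theorem natCard_free_eq (π : PartialPerm p) (b : Bool) :
    Nat.card {c : VertexClass π // (∀ v, vertexClass π v = c → v.isRight = b) ∧
      ∀ e, IsDeterministic π e → ¬ Borders π e c} =
    numFree Sum.isRight (nextEdge (finRotate p)) (gluePerm π) b := by
  rw [numFree_eq_natCard]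
  have hfree : ∀ c : VertexClass π, (∀ e, IsDeterministic π e → ¬ Borders π e c) →
      ∀ w, orb (turn π) w = classOrb π c → vertexClass π w = c := by
    rintro ⟨v⟩ hc w hw
    exact vertexClass_eq_of_free hc (orb_eq_iff.1 hw).symm rfl
  refine Nat.card_congr (Equiv.ofBijective (fun c => ⟨classOrb π c.1, ?_, ?_⟩) ⟨?_, ?_⟩)
  · rw [orbWeight_eq_zero_iff]
    intro e h1 h2
    refine c.2.2 e ((isDeterministic_iff π e).2 h2) (Or.inl ?_)
    rw [edgeStart_eq]
    exact hfree _ c.2.2 e h1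
  · exact c.2.1 _ (hfree _ c.2.2 _ (orb_out _))
  · rintro ⟨⟨v⟩, hc⟩ ⟨d, hd⟩ h
    rw [Subtype.mk.injEq] at h
    exact Subtype.ext (hfree _ hd.2 v h)
  · rintro ⟨o, ho, hb⟩
    have hdet : ∀ e, IsDeterministic π e → orb (turn π) e ≠ o := by
      rintro e he rfl
      exact gluing_of_orbWeight_eq_zero ho ((isDeterministic_iff π e).1 he)
    refine ⟨⟨vertexClass π o.out, ?_, ?_⟩, ?_⟩
    · intro v hv
      rw [← hb]
      refine type_eq_of_orbWeight_eq_zero (isRight_nextEdge _) (isGluing_gluePerm π) ho ?_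
      have := congrArg (classOrb π) hv
      rw [classOrb_mk, classOrb_mk, orb_out] at this
      exact this
    · intro e he hbe
      refine hdet e he ?_
      rw [orb_of_borders he hbe, classOrb_mk, orb_out]
    · refine Subtype.ext ?_
      change classOrb π (vertexClass π o.out) = o
      rw [classOrb_mk, orb_out]

theorem freeEven_eq (π : PartialPerm p) :
    freeEven π = numFree Sum.isRight (nextEdge (finRotate p)) (gluePerm π) true :=
  natCard_free_eq π true

theorem freeOdd_eq (π : PartialPerm p) :
    freeOdd π = numFree Sum.isRight (nextEdge (finRotate p)) (gluePerm π) false := by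
  rw [← natCard_free_eq, freeOdd]
  refine Nat.card_congr (Equiv.subtypeEquivRight fun c => and_congr_left' ?_)
  refine forall₂_congr fun v _ => ?_
  cases v <;> simp

open scoped Classical in
theorem prod_edgeBlock {R : Type*} [CommMonoid R] (π : PartialPerm p) (θ : ℕ → R) :
    ∏ o : Orb (turn π) with orbWeight (nextEdge (finRotate p)) (gluePerm π) o ≠ 0,
      θ (orbWeight (nextEdge (finRotate p)) (gluePerm π) o / 2) =
    ∏ b : EdgeBlock π, θ (blockCard π b / 2) := by
  refine (Finset.prod_bij (fun b _ => blockOrb π b) ?_ ?_ ?_ ?_).symm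
  · intro b _
    simp [orbWeight_blockOrb_ne_zero]
  · intro a _ b _ h
    exact blockOrb_injective π h
  · intro o ho
    obtain ⟨b, hb⟩ := exists_blockOrb_eq (Finset.mem_filter.1 ho).2
    exact ⟨b, Finset.mem_univ _, hb⟩
  · intro b _
    rw [blockCard_eq]

theorem card_fixed_gluePerm {I : Type*} [Fintype I] [DecidableEq I] (π : PartialMatching I) :
    (Finset.univ.filter fun e => gluePerm π e = e).card + 2 * π.1.1.card = 2 * Fintype.card I := by
  have h1 : (Finset.univ.filter fun e => gluePerm π e = e) = (π.1.2ᶜ).disjSum (π.1.1ᶜ) := by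
    ext e
    cases e with
    | inl j => simp [gluePerm_inl_eq_iff]
    | inr i => simp [gluePerm_inr_eq_iff]
  have h2 : π.1.2.card = π.1.1.card := by
    have := Fintype.card_congr π.2
    simpa using this.symm
  have h3 := Finset.card_le_univ π.1.1
  rw [h1, Finset.card_disjSum, Finset.card_compl, Finset.card_compl, h2]
  omega

open scoped Classical in
theorem sum_blockCard (π : PartialPerm p) :
    ∑ b : EdgeBlock π, blockCard π b / 2 + π.1.1.card = p := by
  have h1 : ∑ b : EdgeBlock π, blockCard π b =
      (Finset.univ.filter fun e => gluePerm π e = e).card := by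
    rw [show (Finset.univ.filter fun e => gluePerm π e = e).card = _ from
      (by congr! : _ = _).trans (sum_orbWeight (nextEdge (finRotate p)) (gluePerm π)).symm]
    rw [← Finset.sum_filter_add_sum_filter_not _
        (fun o => orbWeight (nextEdge (finRotate p)) (gluePerm π) o ≠ 0)]
    have h0 : ∑ o : Orb (turn π) with ¬ (orbWeight (nextEdge (finRotate p)) (gluePerm π) o ≠ 0),
        orbWeight (nextEdge (finRotate p)) (gluePerm π) o = 0 := by
      refine Finset.sum_eq_zero fun o ho => ?_
      simpa using ho
    rw [h0, add_zero]
    refine (Finset.sum_bij (fun b _ => blockOrb π b) ?_ ?_ ?_ ?_)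
    · intro b _
      simp [orbWeight_blockOrb_ne_zero]
    · intro a _ b _ h
      exact blockOrb_injective π h
    · intro o ho
      obtain ⟨b, hb⟩ := exists_blockOrb_eq (Finset.mem_filter.1 ho).2
      exact ⟨b, Finset.mem_univ _, hb⟩
    · intro b _
      rw [blockCard_eq]
  have h2 : ∑ b : EdgeBlock π, blockCard π b = 2 * ∑ b : EdgeBlock π, blockCard π b / 2 := by
    rw [Finset.mul_sum]
    refine Finset.sum_congr rfl fun b _ => ?_
    rw [blockCard_eq, Nat.mul_div_cancel' (even_iff_two_dvd.1
      (even_orbWeight (isRight_nextEdge _) (isGluing_gluePerm π) _))]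
  have h3 := card_fixed_gluePerm π
  rw [Fintype.card_fin] at h3
  omega

end FrozenGluing

/-! ### The estimator as a signed sum of gluing weights. -/

section Estimator

variable {ι κ : Type*} [Fintype ι] [DecidableEq ι] [Fintype κ]

theorem ofReal_matMoment (Y : Matrix ι κ ℂ) (p : ℕ) :
    ((matMoment Y p : ℝ) : ℂ) =
      (Fintype.card ι : ℂ)⁻¹ * (((Fintype.card κ : ℂ)⁻¹ • (Y * Yᴴ)) ^ p).trace := by
  apply Complex.ext
  · rfl
  · rw [matMoment_im, Complex.ofReal_im]

theorem trace_pow_eq_matMoment [Nonempty ι] [Nonempty κ] (Y : Matrix ι κ ℂ) (l : ℕ) :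
    ((Y * Yᴴ) ^ l).trace = (Fintype.card ι : ℂ) * (Fintype.card κ : ℂ) ^ l * (matMoment Y l : ℝ) := by
  have h1 : (Fintype.card ι : ℂ) ≠ 0 := by simp
  have h2 : (Fintype.card κ : ℂ) ≠ 0 := by simp
  rw [ofReal_matMoment, smul_pow, Matrix.trace_smul, smul_eq_mul, inv_pow]
  field_simp

/-- A block trace is `n * N ^ l` times a normalised moment. The powers of n count the blocks, and
those of N combine to `N ^ p` because the half sizes of the blocks and the identified pairs add up
to p (`sum_blockCard`). -/
theorem ofReal_estimator [DecidableEq κ] [Nonempty ι] [Nonempty κ] (p : ℕ) (Y : Matrix ι κ ℂ) :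
    (Fintype.card ι : ℂ) * (Fintype.card κ : ℂ) ^ p * ((estimator p Y : ℝ) : ℂ) =
      ∑ π : PartialMatching (Fin p), (-1) ^ π.1.1.card *
        glueWeight Sum.isRight (nextEdge (finRotate p)) (gluePerm π) (Fintype.card ι : ℂ)
          (Fintype.card κ) fun l => ((Y * Yᴴ) ^ l).trace := by
  classical
  have h1 : (Fintype.card ι : ℂ) ≠ 0 := by simp
  have h2 : (Fintype.card κ : ℂ) ≠ 0 := by simp
  rw [estimator, Complex.ofReal_sum, Finset.mul_sum]
  refine Finset.sum_congr (by ext; simp) fun π _ => ?_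
  rw [glueWeight_eq, prod_edgeBlock π (fun l => ((Y * Yᴴ) ^ l).trace)]
  simp_rw [trace_pow_eq_matMoment]
  rw [Finset.prod_mul_distrib, Finset.prod_mul_distrib, Finset.prod_const,
    Finset.prod_pow_eq_pow_sum, ← freeOdd_eq, ← freeEven_eq, Finset.card_univ,
    ← Nat.card_eq_fintype_card (α := EdgeBlock π)]
  push_cast
  rw [zpow_sub_one₀ h1, zpow_natCast]
  have h3 := sum_blockCard π
  have h4 : (Fintype.card κ : ℂ) ^ p = (Fintype.card κ : ℂ) ^ (∑ b : EdgeBlock π, blockCard π b / 2) *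
      (Fintype.card κ : ℂ) ^ π.1.1.card := by
    rw [← pow_add]
    congr 1
    refine h3.symm.trans ?_
    congr!
  rw [h4]
  field_simp

end Estimator

end Stacking

namespace Stacking

/-! ### Functions with moments of all orders -/

/-- All absolute moments are finite. -/
def AllMoments {Ω : Type*} [MeasurableSpace Ω] (f : Ω → ℂ) (μ : Measure Ω) : Prop :=
  ∀ q : NNReal, MemLp f q μ

section AllMoments

variable {Ω : Type*} [MeasurableSpace Ω] {μ : Measure Ω} {f g : Ω → ℂ}

theorem AllMoments.add (hf : AllMoments f μ) (hg : AllMoments g μ) :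
    AllMoments (fun ω => f ω + g ω) μ := fun q => (hf q).add (hg q)

/-- Hölder's inequality with both factors in L^(2q). -/
theorem AllMoments.mul (hf : AllMoments f μ) (hg : AllMoments g μ) :
    AllMoments (fun ω => f ω * g ω) μ := by
  intro q
  have h : ENNReal.HolderTriple ((2 * q : NNReal) : ENNReal) ((2 * q : NNReal) : ENNReal) q := by
    constructor
    by_cases hq : q = 0
    · simp [hq]
    · rw [← ENNReal.coe_inv (by simpa using hq), ← ENNReal.coe_inv hq, ← ENNReal.coe_add]
      congr 1
      have : (q : ℝ) ≠ 0 := by exact_mod_cast hq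
      apply NNReal.coe_injective
      push_cast
      field_simp
      norm_num
  exact (hg (2 * q)).mul' (hf (2 * q))

theorem AllMoments.star (hf : AllMoments f μ) : AllMoments (fun ω => star (f ω)) μ :=
  fun q => (hf q).star

theorem AllMoments.const [IsFiniteMeasure μ] (c : ℂ) : AllMoments (fun _ => c) μ :=
  fun _ => memLp_const c

theorem AllMoments.sum {ι : Type*} {s : Finset ι} {F : ι → Ω → ℂ}
    (h : ∀ i ∈ s, AllMoments (F i) μ) : AllMoments (fun ω => ∑ i ∈ s, F i ω) μ :=
  fun q => memLp_finsetSum s fun i hi => h i hi q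

theorem AllMoments.prod [IsFiniteMeasure μ] {ι : Type*} {s : Finset ι} {F : ι → Ω → ℂ}
    (h : ∀ i ∈ s, AllMoments (F i) μ) : AllMoments (fun ω => ∏ i ∈ s, F i ω) μ := by
  classical
  induction s using Finset.induction_on with
  | empty => simpa using AllMoments.const 1
  | insert a s ha ih =>
    simp_rw [Finset.prod_insert ha]
    exact (h a (Finset.mem_insert_self _ _)).mul
      (ih fun i hi => h i (Finset.mem_insert_of_mem hi))

theorem AllMoments.integrable (hf : AllMoments f μ) : Integrable f μ :=
  memLp_one_iff_integrable.1 (hf 1)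

theorem AllMoments.memLp_re (hf : AllMoments f μ) : MemLp (fun ω => (f ω).re) 2 μ :=
  (hf 2).re

theorem AllMoments.comp_map {Ω' : Type*} [MeasurableSpace Ω'] {ν : Measure Ω'} {T : Ω → Ω'}
    {f : Ω' → ℂ} (hT : AEMeasurable T μ) (h : μ.map T = ν) (hf : AllMoments f ν) :
    AllMoments (fun ω => f (T ω)) μ := by
  intro q
  have := hf q
  rw [← h] at this
  exact this.comp_of_map hT

end AllMoments

/-! ### Moments of the standard complex Gaussian distribution -/

theorem measurable_complexMk : Measurable fun z : ℝ × ℝ => (⟨z.1, z.2⟩ : ℂ) :=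
  Complex.measurableEquivRealProd.symm.measurable

instance : IsProbabilityMeasure stdComplexGaussian :=
  Measure.isProbabilityMeasure_map measurable_complexMk.aemeasurable

theorem allMoments_stdComplexGaussian : AllMoments (fun z : ℂ => z) stdComplexGaussian := by
  intro q
  rw [stdComplexGaussian, memLp_map_measure_iff (by fun_prop) measurable_complexMk.aemeasurable]
  have h1 : MemLp (fun z : ℝ × ℝ => z.1) q
      ((gaussianReal 0 (1 / 2)).prod (gaussianReal 0 (1 / 2))) :=
    (memLp_id_gaussianReal q).comp_fst _
  have h2 : MemLp (fun z : ℝ × ℝ => z.2) q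
      ((gaussianReal 0 (1 / 2)).prod (gaussianReal 0 (1 / 2))) :=
    (memLp_id_gaussianReal q).comp_snd _
  have h := h1.ofReal (K := ℂ) |>.add (h2.ofReal (K := ℂ) |>.const_mul Complex.I)
  convert h using 1
  funext z
  apply Complex.ext <;> simp

/-- The product of two real Gaussian densities of variance 1/2 is radial, which gives access to
polar integrals and to rotation invariance. -/
theorem integral_stdComplexGaussian (f : ℂ → ℂ) :
    ∫ z, f z ∂stdComplexGaussian = ∫ z : ℂ, (Real.pi⁻¹ * Real.exp (-‖z‖ ^ (2 : ℝ))) • f z := by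
  have hv : (1 / 2 : NNReal) ≠ 0 := by norm_num
  have hm := Complex.measurableEquivRealProd.symm.measurableEmbedding
  have he : (fun z : ℝ × ℝ => (⟨z.1, z.2⟩ : ℂ)) = Complex.measurableEquivRealProd.symm := by
    funext z; rfl
  rw [stdComplexGaussian, he, hm.integral_map, gaussianReal_of_var_ne_zero _ hv,
    prod_withDensity (measurable_gaussianPDF _ _) (measurable_gaussianPDF _ _),
    integral_withDensity_eq_integral_toReal_smul (by fun_prop)
      (Filter.Eventually.of_forall fun z => ENNReal.mul_lt_top
        (by simp [gaussianPDF_def]) (by simp [gaussianPDF_def])),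
    ← Complex.volume_preserving_equiv_real_prod.symm.integral_comp hm]
  refine integral_congr_ae (Filter.Eventually.of_forall fun z => ?_)
  simp only
  congr 1
  rw [ENNReal.toReal_mul, toReal_gaussianPDF, toReal_gaussianPDF, gaussianPDFReal, gaussianPDFReal]
  have hn : ‖Complex.measurableEquivRealProd.symm z‖ ^ (2 : ℝ) = z.1 ^ 2 + z.2 ^ 2 := by
    rw [Real.rpow_two, ← Complex.normSq_eq_norm_sq, Complex.normSq_apply]
    simp [Complex.measurableEquivRealProd_symm_apply]
    ring
  rw [hn, neg_add, Real.exp_add]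
  have hs : (√(2 * Real.pi * ((1 / 2 : NNReal) : ℝ)))⁻¹ * (√(2 * Real.pi * ((1 / 2 : NNReal) : ℝ)))⁻¹
      = Real.pi⁻¹ := by
    rw [← mul_inv, Real.mul_self_sqrt (by positivity)]
    congr 1
    push_cast
    ring
  rw [← hs]
  push_cast
  ring_nf

theorem integral_norm_pow_stdComplexGaussian (a : ℕ) :
    ∫ z, ((‖z‖ ^ (2 * a) : ℝ) : ℂ) ∂stdComplexGaussian = a.factorial := by
  rw [integral_stdComplexGaussian]
  have h := Complex.integral_rpow_mul_exp_neg_rpow (p := 2) (q := 2 * a) (by norm_num)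
    (by have : (0 : ℝ) ≤ a := by positivity
        linarith)
  have hG : Real.Gamma ((2 * (a : ℝ) + 2) / 2) = a.factorial := by
    rw [← Real.Gamma_nat_eq_factorial]
    congr 1
    ring
  rw [hG] at h
  have h2 : ∀ z : ℂ, (Real.pi⁻¹ * Real.exp (-‖z‖ ^ (2 : ℝ))) • ((‖z‖ ^ (2 * a) : ℝ) : ℂ) =
      ((Real.pi⁻¹ * (‖z‖ ^ (2 * (a : ℝ)) * Real.exp (-‖z‖ ^ (2 : ℝ))) : ℝ) : ℂ) := by
    intro z
    rw [show (2 * (a : ℝ)) = ((2 * a : ℕ) : ℝ) by push_cast; ring, Real.rpow_natCast,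
      Complex.real_smul]
    push_cast
    ring
  simp_rw [h2]
  rw [integral_complex_ofReal, integral_const_mul, h]
  push_cast
  have : (Real.pi : ℂ) ≠ 0 := by exact_mod_cast Real.pi_ne_zero
  field_simp

theorem integral_pow_mul_star_pow (a b : ℕ) :
    ∫ z, star z ^ a * z ^ b ∂stdComplexGaussian = if a = b then (a.factorial : ℂ) else 0 := by
  split_ifs with hab
  · subst hab
    rw [← integral_norm_pow_stdComplexGaussian]
    congr 1
    funext z
    rw [← mul_pow, pow_mul, Complex.star_def, Complex.conj_mul']
    push_cast
    rfl
  · rw [integral_stdComplexGaussian]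
    -- The angle is chosen so that the rotation multiplies the integrand by -1; the integral then
    -- equals its own negative.
    let ω : Circle := Circle.exp (Real.pi / ((b : ℝ) - a))
    have hne : ((b : ℝ) - a) ≠ 0 := by
      rw [sub_ne_zero]
      exact_mod_cast Ne.symm hab
    have hω : star (ω : ℂ) ^ a * (ω : ℂ) ^ b = -1 := by
      rw [Circle.coe_exp, Complex.star_def, ← Complex.exp_conj, ← Complex.exp_nat_mul,
        ← Complex.exp_nat_mul, ← Complex.exp_add, ← Complex.exp_pi_mul_I]
      congr 1
      rw [map_mul, Complex.conj_ofReal, Complex.conj_I]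
      push_cast
      have : ((b : ℂ) - a) ≠ 0 := by exact_mod_cast hne
      field_simp
      ring
    have h := (rotation ω).measurePreserving.integral_comp (rotation ω).toMeasurableEquiv.measurableEmbedding
      (fun z : ℂ => (Real.pi⁻¹ * Real.exp (-‖z‖ ^ (2 : ℝ))) • (star z ^ a * z ^ b))
    have h2 : ∀ z : ℂ, (Real.pi⁻¹ * Real.exp (-‖rotation ω z‖ ^ (2 : ℝ))) •
        (star (rotation ω z) ^ a * (rotation ω z) ^ b) =
        - ((Real.pi⁻¹ * Real.exp (-‖z‖ ^ (2 : ℝ))) • (star z ^ a * z ^ b)) := by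
      intro z
      rw [LinearIsometryEquiv.norm_map, rotation_apply, star_mul', mul_pow, mul_pow, ← smul_neg]
      congr 1
      linear_combination (star z ^ a * z ^ b) * hω
    simp_rw [h2] at h
    rw [integral_neg] at h
    linear_combination (-1 / 2 : ℂ) * h

/-! ### Standard complex Gaussian vectors -/

/-- The distribution of a vector with independent standard complex Gaussian entries. -/
noncomputable def stdGaussianVec (K : Type*) [Fintype K] : Measure (K → ℂ) :=
  Measure.pi fun _ => stdComplexGaussian

instance (K : Type*) [Fintype K] : IsProbabilityMeasure (stdGaussianVec K) := by
  unfold stdGaussianVec; infer_instance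

/-! ### Wick's formula for complex Gaussian vectors. -/

section Isserlis

variable {K : Type*} [Fintype K]

theorem allMoments_eval (k : K) : AllMoments (fun z : K → ℂ => z k) (stdGaussianVec K) :=
  AllMoments.comp_map (T := fun z : K → ℂ => z k) (measurable_pi_apply k).aemeasurable
    (MeasureTheory.measurePreserving_eval (fun _ : K => stdComplexGaussian) k).map_eq
    allMoments_stdComplexGaussian

variable [DecidableEq K] {A B : Type*} [Fintype A] [Fintype B]

theorem prod_comp_eq_prod_pow {R : Type*} [CommMonoid R] (t : A → K) (F : K → R) :
    ∏ a, F (t a) = ∏ k, F k ^ Fintype.card {a // t a = k} := by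
  rw [← Finset.prod_fiberwise Finset.univ t]
  refine Finset.prod_congr rfl fun k _ => ?_
  rw [Fintype.card_subtype, ← Finset.prod_const]
  refine Finset.prod_congr rfl fun a ha => ?_
  rw [(Finset.mem_filter.1 ha).2]

variable [DecidableEq A] [DecidableEq B]

/-- A label-preserving bijection is the same as a family of bijections between the fibres of the
labels. -/
theorem card_equiv_fiberwise (t : A → K) (s : B → K) :
    Fintype.card {σ : A ≃ B // ∀ a, s (σ a) = t a} =
      ∏ k, if Fintype.card {a // t a = k} = Fintype.card {b // s b = k} then
        (Fintype.card {a // t a = k}).factorial else 0 := by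
  have e : {σ : A ≃ B // ∀ a, s (σ a) = t a} ≃ ∀ k, ({a // t a = k} ≃ {b // s b = k}) :=
    { toFun := fun σ k => σ.1.subtypeEquiv fun a => by rw [σ.2]
      invFun := fun F => ⟨Equiv.ofFiberEquiv F, fun a => Equiv.ofFiberEquiv_map F a⟩
      left_inv := by
        rintro ⟨σ, hσ⟩
        apply Subtype.ext
        ext a
        rfl
      right_inv := by
        intro F
        funext k
        ext ⟨a, rfl⟩
        rfl }
  rw [Fintype.card_congr e, Fintype.card_pi]
  refine Finset.prod_congr rfl fun k _ => ?_
  split_ifs with h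
  · exact Fintype.card_equiv (Fintype.equivOfCardEq h)
  · rw [Fintype.card_eq_zero_iff]
    exact ⟨fun σ => h (Fintype.card_congr σ)⟩

/-- By independence the integral factors over the coordinates into factorials or zeros, and their
product counts the label-preserving bijections. -/
theorem integral_prod_entries (t : A → K) (s : B → K) :
    ∫ z : K → ℂ, (∏ a, star (z (t a))) * ∏ b, z (s b) ∂stdGaussianVec K =
      ∑ σ : A ≃ B, ∏ a, if s (σ a) = t a then (1 : ℂ) else 0 := by
  have h1 : ∀ z : K → ℂ, (∏ a, star (z (t a))) * ∏ b, z (s b) =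
      ∏ k, (star (z k) ^ Fintype.card {a // t a = k} * z k ^ Fintype.card {b // s b = k}) := by
    intro z
    rw [prod_comp_eq_prod_pow t fun k => star (z k), prod_comp_eq_prod_pow s,
      Finset.prod_mul_distrib]
  simp_rw [h1]
  rw [stdGaussianVec, integral_fintype_prod_eq_prod (fun (k : K) (x : ℂ) =>
    star x ^ Fintype.card {a // t a = k} * x ^ Fintype.card {b // s b = k})]
  simp_rw [integral_pow_mul_star_pow]
  have h2 := card_equiv_fiberwise t s
  have h3 : ∀ σ : A ≃ B, (∏ a, if s (σ a) = t a then (1 : ℂ) else 0) =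
      if ∀ a, s (σ a) = t a then 1 else 0 := by
    intro σ
    split_ifs with h
    · exact Finset.prod_eq_one fun a _ => if_pos (h a)
    · rw [not_forall] at h
      obtain ⟨a, ha⟩ := h
      exact Finset.prod_eq_zero (Finset.mem_univ a) (if_neg ha)
  simp_rw [h3]
  rw [Finset.sum_boole, ← Fintype.card_subtype, h2]
  push_cast
  refine Finset.prod_congr rfl fun k _ => ?_
  split_ifs <;> simp

/-- Wick's formula for linear combinations of the entries of a standard complex Gaussian vector. -/
theorem integral_prod_linear (α : B → K → ℂ) (β : A → K → ℂ) :
    ∫ z : K → ℂ, (∏ a, ∑ k, β a k * star (z k)) * ∏ b, ∑ k, α b k * z k ∂stdGaussianVec K =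
      ∑ σ : A ≃ B, ∏ a, ∑ k, β a k * α (σ a) k := by
  have h1 : ∀ z : K → ℂ, (∏ a, ∑ k, β a k * star (z k)) * ∏ b, ∑ k, α b k * z k =
      ∑ t : A → K, ∑ s : B → K, ((∏ a, β a (t a)) * ∏ b, α b (s b)) *
        ((∏ a, star (z (t a))) * ∏ b, z (s b)) := by
    intro z
    rw [Finset.prod_univ_sum, Finset.prod_univ_sum, Fintype.piFinset_univ, Fintype.piFinset_univ,
      Finset.sum_mul_sum]
    refine Finset.sum_congr rfl fun t _ => Finset.sum_congr rfl fun s _ => ?_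
    rw [Finset.prod_mul_distrib, Finset.prod_mul_distrib]
    ring
  have hint : ∀ (t : A → K) (s : B → K), AllMoments (fun z : K → ℂ =>
      ((∏ a, β a (t a)) * ∏ b, α b (s b)) * ((∏ a, star (z (t a))) * ∏ b, z (s b)))
        (stdGaussianVec K) := fun t s =>
    (AllMoments.const _).mul ((AllMoments.prod fun a _ => (allMoments_eval (t a)).star).mul
      (AllMoments.prod fun b _ => allMoments_eval (s b)))
  simp_rw [h1]
  rw [integral_finsetSum _ fun t _ => (AllMoments.sum fun s _ => hint t s).integrable]
  simp_rw [integral_finsetSum Finset.univ fun s _ => (hint _ s).integrable, integral_const_mul,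
    integral_prod_entries, Finset.mul_sum]
  have h4 : ∀ σ : A ≃ B, ∏ a, ∑ k, β a k * α (σ a) k =
      ∑ t : A → K, ∑ s : B → K, (((∏ a, β a (t a)) * ∏ b, α b (s b)) *
        ∏ a, if s (σ a) = t a then (1 : ℂ) else 0) := by
    intro σ
    rw [Finset.prod_univ_sum, Fintype.piFinset_univ]
    refine Finset.sum_congr rfl fun t _ => ?_
    -- For given `t` and `σ`, the deltas force `s` to be `t ∘ σ.symm`.
    rw [Fintype.sum_eq_single (t ∘ σ.symm)]
    · simp only [Function.comp, Equiv.symm_apply_apply, if_true, Finset.prod_const_one, mul_one]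
      rw [Finset.prod_mul_distrib]
      congr 1
      exact Fintype.prod_equiv σ _ _ fun a => by simp
    · intro s hs
      have : ∃ a, s (σ a) ≠ t a := by
        by_contra hcon
        push Not at hcon
        apply hs
        funext b
        simp [← hcon]
      obtain ⟨a, ha⟩ := this
      have h0 : (∏ a, if s (σ a) = t a then (1 : ℂ) else 0) = 0 :=
        Finset.prod_eq_zero (Finset.mem_univ a) (if_neg ha)
      rw [h0, mul_zero]
  simp_rw [h4]
  symm
  rw [Finset.sum_comm]
  exact Finset.sum_congr rfl fun t _ => Finset.sum_comm

end Isserlis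

end Stacking

namespace Stacking

/-! ### Sums over partial matchings as Gaussian integrals -/

theorem integral_stdGaussianVec_sum {K I : Type*} [Fintype K] [Fintype I] {F : (K ⊕ I → ℂ) → ℂ}
    (hF : Integrable F (stdGaussianVec (K ⊕ I))) :
    ∫ z, F z ∂stdGaussianVec (K ⊕ I) =
      ∫ x, ∫ y, F (Sum.elim x y) ∂stdGaussianVec I ∂stdGaussianVec K := by
  have hp := measurePreserving_sumPiEquivProdPi (fun _ : K ⊕ I => stdComplexGaussian)
  have hs := hp.symm
  have he := (MeasurableEquiv.sumPiEquivProdPi fun _ : K ⊕ I => ℂ).symm.measurableEmbedding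
  have h1 := hs.integral_comp he F
  have h2 := (hs.integrable_comp_emb he).2 hF
  unfold stdGaussianVec
  refine (h1.symm.trans (integral_prod _ h2)).trans ?_
  refine integral_congr_ae (Filter.Eventually.of_forall fun x => ?_)
  refine integral_congr_ae (Filter.Eventually.of_forall fun y => ?_)
  refine congrArg F ?_
  funext e
  cases e <;> rfl

section WickSum

variable {K : Type*} [Fintype K]

theorem allMoments_linear (u : ℂ) (α : K → ℂ) :
    AllMoments (fun z : K → ℂ => u + ∑ k, α k * z k) (stdGaussianVec K) :=
  (AllMoments.const _).add (AllMoments.sum fun k _ => (AllMoments.const _).mul (allMoments_eval k))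

theorem allMoments_linear_star (u : ℂ) (α : K → ℂ) :
    AllMoments (fun z : K → ℂ => u + ∑ k, α k * star (z k)) (stdGaussianVec K) :=
  (AllMoments.const _).add
    (AllMoments.sum fun k _ => (AllMoments.const _).mul (allMoments_eval k).star)

theorem allMoments_prod_affine {J : Type*} [Fintype J] (v u : J → ℂ) (α β : J → K → ℂ) :
    AllMoments (fun z : K → ℂ => (∏ i, (v i + ∑ k, β i k * star (z k))) *
      ∏ j, (u j + ∑ k, α j k * z k)) (stdGaussianVec K) :=
  (AllMoments.prod fun _ _ => allMoments_linear_star _ _).mul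
    (AllMoments.prod fun _ _ => allMoments_linear _ _)

variable {I : Type*} [Fintype I] [DecidableEq I]

/-- The sum over all partial matchings, with weights `w i j` for the matched pairs and weights
`v i` and `u j` for the elements that are not matched. -/
noncomputable def wickSum (w : I → I → ℂ) (v u : I → ℂ) : ℂ :=
  ∑ π : PartialMatching I, (∏ i : π.1.1, w i (π.2 i)) * (∏ i ∈ π.1.1ᶜ, v i) * ∏ j ∈ π.1.2ᶜ, u j

/-- Expanding the products selects the subsets of factors replaced by their Gaussian parts, and
Wick's formula sums over the bijections between the two selected subsets. -/
theorem integral_prod_affine [DecidableEq K] (v u : I → ℂ) (α β : I → K → ℂ) :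
    ∫ z : K → ℂ, (∏ i, (v i + ∑ k, β i k * star (z k))) * ∏ j, (u j + ∑ k, α j k * z k)
      ∂stdGaussianVec K = wickSum (fun i j => ∑ k, β i k * α j k) v u := by
  have h1 : ∀ z : K → ℂ,
      (∏ i, (v i + ∑ k, β i k * star (z k))) * ∏ j, (u j + ∑ k, α j k * z k) =
      ∑ ρ₁ : Finset I, ∑ ρ₂ : Finset I, ((∏ i ∈ ρ₁ᶜ, v i) * ∏ j ∈ ρ₂ᶜ, u j) *
        ((∏ i : ρ₁, ∑ k, β i k * star (z k)) * ∏ j : ρ₂, ∑ k, α j k * z k) := by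
    intro z
    simp_rw [add_comm (v _), add_comm (u _)]
    rw [Finset.prod_add, Finset.prod_add, Finset.powerset_univ, Finset.sum_mul_sum]
    refine Finset.sum_congr rfl fun ρ₁ _ => Finset.sum_congr rfl fun ρ₂ _ => ?_
    rw [← Finset.compl_eq_univ_sdiff, ← Finset.compl_eq_univ_sdiff,
      Finset.prod_coe_sort ρ₁ (fun i => ∑ k, β i k * star (z k)),
      Finset.prod_coe_sort ρ₂ (fun j => ∑ k, α j k * z k)]
    ring
  have hint : ∀ ρ₁ ρ₂ : Finset I, AllMoments (fun z : K → ℂ =>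
      ((∏ i ∈ ρ₁ᶜ, v i) * ∏ j ∈ ρ₂ᶜ, u j) *
        ((∏ i : ρ₁, ∑ k, β i k * star (z k)) * ∏ j : ρ₂, ∑ k, α j k * z k))
      (stdGaussianVec K) := by
    intro ρ₁ ρ₂
    refine (AllMoments.const _).mul (AllMoments.mul ?_ ?_)
    · exact AllMoments.prod fun i _ => AllMoments.sum fun k _ =>
        (AllMoments.const _).mul (allMoments_eval k).star
    · exact AllMoments.prod fun i _ => AllMoments.sum fun k _ =>
        (AllMoments.const _).mul (allMoments_eval k)
  simp_rw [h1]
  rw [integral_finsetSum _ fun t _ => (AllMoments.sum fun s _ => hint t s).integrable]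
  simp_rw [integral_finsetSum Finset.univ fun s _ => (hint _ s).integrable, integral_const_mul]
  rw [wickSum, Fintype.sum_sigma, Fintype.sum_prod_type]
  refine Finset.sum_congr rfl fun ρ₁ _ => Finset.sum_congr rfl fun ρ₂ _ => ?_
  rw [integral_prod_linear (fun j : ρ₂ => α j) (fun i : ρ₁ => β i), Finset.mul_sum]
  refine Finset.sum_congr rfl fun σ _ => ?_
  ring

theorem sum_mul_ite_eq (f : I → ℂ) (j : I) : ∑ k, f k * (if k = j then 1 else 0) = f j := by
  simp

/-- The coefficients of the variables and of their conjugates are independent of each other, so any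
complex matrix `w`, even the "negative variance" -1, occurs as a covariance. -/
theorem wickSum_eq_integral (w : I → I → ℂ) (v u : I → ℂ) :
    wickSum w v u = ∫ z : I → ℂ, (∏ i, (v i + ∑ k, w i k * star (z k))) *
      ∏ j, (u j + ∑ k, (if k = j then 1 else 0) * z k) ∂stdGaussianVec I := by
  rw [integral_prod_affine]
  simp_rw [sum_mul_ite_eq]

/-- Adding Gaussian variables to the unmatched weights adds their covariances to the weights of the
matched pairs. -/
theorem integral_wickSum [DecidableEq K] (w : I → I → ℂ) (v u : I → ℂ) (α β : I → K → ℂ) :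
    ∫ x : K → ℂ, wickSum w (fun i => v i + ∑ k, β i k * star (x k))
      (fun j => u j + ∑ k, α j k * x k) ∂stdGaussianVec K =
    wickSum (fun i j => w i j + ∑ k, β i k * α j k) v u := by
  -- The outer noise and the noise that represents `w` form one Gaussian vector on `K ⊕ I`, in which
  -- their covariances add.
  have h := integral_prod_affine (K := K ⊕ I) v u
    (fun j => Sum.elim (α j) fun k => if k = j then 1 else 0) (fun i => Sum.elim (β i) (w i))
  rw [integral_stdGaussianVec_sum (allMoments_prod_affine _ _ _ _).integrable] at h
  simp only [Fintype.sum_sum_type, Sum.elim_inl, Sum.elim_inr, sum_mul_ite_eq] at h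
  simp_rw [wickSum_eq_integral w]
  simp_rw [add_comm (w _ _)]
  rw [← h]
  simp only [add_assoc]

/-- Representing the factors by independent Gaussian vectors makes the product a single integral
over `I ⊕ I'` with no covariance between the two parts. -/
theorem wickSum_mul {I' : Type*} [Fintype I'] [DecidableEq I'] (w : I → I → ℂ) (v u : I → ℂ)
    (w' : I' → I' → ℂ) (v' u' : I' → ℂ) :
    wickSum w v u * wickSum w' v' u' =
      wickSum (Sum.elim (fun i => Sum.elim (w i) 0) (fun i => Sum.elim 0 (w' i)))
        (Sum.elim v v') (Sum.elim u u') := by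
  rw [wickSum_eq_integral (Sum.elim (fun i => Sum.elim (w i) 0) (fun i => Sum.elim 0 (w' i))),
    integral_stdGaussianVec_sum (allMoments_prod_affine _ _ _ _).integrable]
  simp only [Fintype.prod_sum_type, Fintype.sum_sum_type, Sum.elim_inl, Sum.elim_inr, Pi.zero_apply,
    zero_mul, Finset.sum_const_zero, add_zero, zero_add, Sum.inl.injEq, Sum.inr.injEq, reduceCtorEq,
    if_false]
  rw [wickSum_eq_integral w, wickSum_eq_integral w', ← integral_mul_const]
  congr 1
  funext x
  rw [← integral_const_mul]
  congr 1
  funext y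
  ring

theorem allMoments_wickSum {Ω : Type*} [MeasurableSpace Ω] {μ : Measure Ω} [IsFiniteMeasure μ]
    (w : I → I → ℂ) {v u : Ω → I → ℂ} (hv : ∀ i, AllMoments (fun ω => v ω i) μ)
    (hu : ∀ i, AllMoments (fun ω => u ω i) μ) :
    AllMoments (fun ω => wickSum w (v ω) (u ω)) μ := by
  unfold wickSum
  exact AllMoments.sum fun π _ => ((AllMoments.const _).mul
    (AllMoments.prod fun i _ => hv i)).mul (AllMoments.prod fun i _ => hu i)

end WickSum

end Stacking

namespace Stacking

/-! ### The moments of the estimators -/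

section NoiseMatrix

variable {ι κ : Type*}

/-- The matrix with the given entries. -/
def noiseMatrix (z : ι × κ → ℂ) : Matrix ι κ ℂ := Matrix.of fun i j => z (i, j)

theorem allMoments_entry [Fintype ι] [Fintype κ] (D : Matrix ι κ ℂ) (i : ι) (k : κ) :
    AllMoments (fun z : ι × κ → ℂ => (D + noiseMatrix z) i k) (stdGaussianVec (ι × κ)) :=
  (AllMoments.const _).add (allMoments_eval (i, k))

end NoiseMatrix

section ContractionSum

variable {I : Type u} [Fintype I] [DecidableEq I]
  {ι κ : Type*} [Fintype ι] [Fintype κ] [DecidableEq ι] [DecidableEq κ]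

/-- The sum over all indices of the contractions of the entries in a product of traces, where a
contraction of the entries `i` and `j` has the weight `ε i j`. -/
noncomputable def contractionSum (c : Equiv.Perm I) (ε : I → I → ℂ) (Y : Matrix ι κ ℂ) : ℂ :=
  ∑ r : I → ι, ∑ k : I → κ,
    wickSum (fun i j => ε i j * if r (c i) = r j ∧ k i = k j then 1 else 0)
      (fun i => star (Y (r (c i)) (k i))) fun j => Y (r j) (k j)

theorem contractionSum_eq (c : Equiv.Perm I) (ε : I → I → ℂ) (Y : Matrix ι κ ℂ) :
    contractionSum c ε Y = ∑ π : PartialMatching I, (∏ i : π.1.1, ε i (π.2 i)) *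
      glueWeight Sum.isRight (nextEdge c) (gluePerm π) (Fintype.card ι : ℂ) (Fintype.card κ)
        fun l => ((Y * Yᴴ) ^ l).trace := by
  simp_rw [← index_sum_eq_glueWeight, contractionSum, wickSum, Finset.mul_sum]
  rw [Finset.sum_congr rfl fun r _ => Finset.sum_comm, Finset.sum_comm]
  refine Finset.sum_congr rfl fun π _ => Finset.sum_congr rfl fun r _ =>
    Finset.sum_congr rfl fun k _ => ?_
  rw [Finset.prod_mul_distrib]
  ring

theorem sum_sumElim {I I' M R : Type*} [Fintype I] [Fintype I'] [DecidableEq I] [DecidableEq I']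
    [Fintype M] [AddCommMonoid R] (F : (I ⊕ I' → M) → R) :
    ∑ f, F f = ∑ a : I → M, ∑ b : I' → M, F (Sum.elim a b) := by
  rw [← Fintype.sum_prod_type' (f := fun (a : I → M) (b : I' → M) => F (Sum.elim a b))]
  refine Fintype.sum_equiv (Equiv.sumArrowEquivProdArrow I I' M) _ _ fun f => ?_
  congr 1
  funext e
  cases e <;> rfl

theorem contractionSum_mul {I' : Type u} [Fintype I'] [DecidableEq I'] (c : Equiv.Perm I)
    (c' : Equiv.Perm I') (ε : I → I → ℂ) (ε' : I' → I' → ℂ) (Y : Matrix ι κ ℂ) :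
    contractionSum c ε Y * contractionSum c' ε' Y =
      contractionSum (Equiv.sumCongr c c')
        (Sum.elim (fun i => Sum.elim (ε i) 0) (fun i => Sum.elim 0 (ε' i))) Y := by
  rw [contractionSum, contractionSum, contractionSum, sum_sumElim, Finset.sum_mul_sum]
  refine Finset.sum_congr rfl fun r _ => Finset.sum_congr rfl fun r' _ => ?_
  rw [sum_sumElim, Finset.sum_mul_sum]
  refine Finset.sum_congr rfl fun k _ => Finset.sum_congr rfl fun k' _ => ?_
  rw [wickSum_mul]
  congr 1
  · funext i j
    rcases i with i | i <;> rcases j with j | j <;> simp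
  · funext i
    rcases i with i | i <;> simp
  · funext i
    rcases i with i | i <;> simp

theorem allMoments_contractionSum (c : Equiv.Perm I) (ε : I → I → ℂ) (D : Matrix ι κ ℂ) :
    AllMoments (fun z => contractionSum c ε (D + noiseMatrix z)) (stdGaussianVec (ι × κ)) :=
  AllMoments.sum fun _ _ => AllMoments.sum fun _ _ =>
    allMoments_wickSum _ (fun _ => (allMoments_entry D _ _).star) fun _ => allMoments_entry D _ _

/-- The covariance of two noise entries is the very delta that `ε` multiplies in the pair weight, so
each weight grows by one. -/
theorem integral_contractionSum (c : Equiv.Perm I) (ε : I → I → ℂ) (D : Matrix ι κ ℂ) :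
    ∫ z, contractionSum c ε (D + noiseMatrix z) ∂stdGaussianVec (ι × κ) =
      contractionSum c (fun i j => ε i j + 1) D := by
  have hm : ∀ (r : I → ι) (k : I → κ), AllMoments (fun z : ι × κ → ℂ =>
      wickSum (fun i j => ε i j * if r (c i) = r j ∧ k i = k j then 1 else 0)
        (fun i => star ((D + noiseMatrix z) (r (c i)) (k i)))
        fun j => (D + noiseMatrix z) (r j) (k j)) (stdGaussianVec (ι × κ)) := fun r k =>
    allMoments_wickSum _ (fun i => (allMoments_entry D _ _).star) fun j => allMoments_entry D _ _
  simp_rw [contractionSum]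
  rw [integral_finsetSum _ fun t _ => (AllMoments.sum fun s _ => hm t s).integrable]
  simp_rw [integral_finsetSum Finset.univ fun s _ => (hm _ s).integrable]
  refine Finset.sum_congr rfl fun r _ => Finset.sum_congr rfl fun k _ => ?_
  have h := integral_wickSum (fun i j => ε i j * if r (c i) = r j ∧ k i = k j then 1 else 0)
    (fun i => star (D (r (c i)) (k i))) (fun j => D (r j) (k j))
    (fun j (m : ι × κ) => if m = (r j, k j) then 1 else 0)
    (fun i (m : ι × κ) => if m = (r (c i), k i) then 1 else 0)
  convert h using 2
  · funext z
    congr 1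
    · funext i
      simp [noiseMatrix]
    · funext j
      simp [noiseMatrix]
  · funext i j
    rw [add_mul, one_mul]
    rw [sum_mul_ite_eq (fun m : ι × κ => if m = (r (c i), k i) then (1 : ℂ) else 0)]
    simp only [Prod.mk.injEq, eq_comm]

end ContractionSum

end Stacking

namespace Stacking

/-! ### Gluings of two circles -/

theorem gluePerm_injective {I : Type*} [DecidableEq I] :
    Function.Injective (gluePerm : PartialMatching I → Equiv.Perm (I ⊕ I)) := by
  rintro ⟨⟨a, b⟩, q⟩ ⟨⟨a', b'⟩, q'⟩ h
  have ha : a = a' := by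
    ext i
    have h1 := gluePerm_inr_eq_iff (π := ⟨(a, b), q⟩) (i := i)
    have h2 := gluePerm_inr_eq_iff (π := ⟨(a', b'), q'⟩) (i := i)
    rw [h] at h1
    exact not_iff_not.1 (h1.symm.trans h2)
  have hb : b = b' := by
    ext i
    have h1 := gluePerm_inl_eq_iff (π := ⟨(a, b), q⟩) (j := i)
    have h2 := gluePerm_inl_eq_iff (π := ⟨(a', b'), q'⟩) (j := i)
    rw [h] at h1
    exact not_iff_not.1 (h1.symm.trans h2)
  subst ha hb
  congr 1
  ext ⟨i, hi⟩
  have h1 := gluePerm_inr_mem (π := ⟨(a, b), q⟩) hi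
  have h2 := gluePerm_inr_mem (π := ⟨(a, b), q'⟩) hi
  rw [h, h2] at h1
  exact (Sum.inl_injective h1).symm

theorem exists_gluePerm_eq {I : Type*} [Fintype I] [DecidableEq I] {g : Equiv.Perm (I ⊕ I)}
    (hg : IsGluing Sum.isRight g) : ∃ π : PartialMatching I, gluePerm π = g := by
  have h1 : ∀ i, g (Sum.inr i) ≠ Sum.inr i → ∃ j, g (Sum.inr i) = Sum.inl j := by
    intro i hi
    have := hg.type _ hi
    cases h : g (Sum.inr i) with
    | inl j => exact ⟨j, rfl⟩
    | inr j => rw [h] at this; cases this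
  have h2 : ∀ i, g (Sum.inl i) ≠ Sum.inl i → ∃ j, g (Sum.inl i) = Sum.inr j := by
    intro i hi
    have := hg.type _ hi
    cases h : g (Sum.inl i) with
    | inr j => exact ⟨j, rfl⟩
    | inl j => rw [h] at this; cases this
  choose f hf using h1
  choose f' hf' using h2
  let a : Finset I := Finset.univ.filter fun i => g (Sum.inr i) ≠ Sum.inr i
  let b : Finset I := Finset.univ.filter fun i => g (Sum.inl i) ≠ Sum.inl i
  have ha : ∀ i, i ∈ a ↔ g (Sum.inr i) ≠ Sum.inr i := by simp [a]
  have hb : ∀ i, i ∈ b ↔ g (Sum.inl i) ≠ Sum.inl i := by simp [b]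
  have hfb : ∀ i (hi : g (Sum.inr i) ≠ Sum.inr i), g (Sum.inl (f i hi)) = Sum.inr i := by
    intro i hi
    rw [← hf, hg.invol]
  have hfa : ∀ i (hi : g (Sum.inl i) ≠ Sum.inl i), g (Sum.inr (f' i hi)) = Sum.inl i := by
    intro i hi
    rw [← hf', hg.invol]
  let q : a ≃ b :=
    { toFun := fun i => ⟨f i ((ha _).1 i.2), by rw [hb, hfb]; simp⟩
      invFun := fun j => ⟨f' j ((hb _).1 j.2), by rw [ha, hfa]; simp⟩
      left_inv := by
        rintro ⟨i, hi⟩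
        apply Subtype.ext
        apply Sum.inr_injective (α := I)
        rw [← hf']
        exact hfb _ _
      right_inv := by
        rintro ⟨i, hi⟩
        apply Subtype.ext
        apply Sum.inl_injective (β := I)
        rw [← hf]
        exact hfa _ _ }
  refine ⟨⟨(a, b), q⟩, ?_⟩
  ext e
  rcases e with j | i
  · by_cases hj : j ∈ b
    · rw [gluePerm_inl_mem (π := ⟨(a, b), q⟩) hj]
      exact (hf' _ ((hb _).1 hj)).symm
    · rw [gluePerm_inl_notMem (π := ⟨(a, b), q⟩) hj]
      rw [hb, not_not] at hj
      exact hj.symm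
  · by_cases hi : i ∈ a
    · rw [gluePerm_inr_mem (π := ⟨(a, b), q⟩) hi]
      exact (hf _ ((ha _).1 hi)).symm
    · rw [gluePerm_inr_notMem (π := ⟨(a, b), q⟩) hi]
      rw [ha, not_not] at hi
      exact hi.symm

/-- `g` identifies some pairs of edges of opposite type on opposite sides. -/
structure IsCrossGluing {E : Type*} (τ σ : E → Bool) (g : Equiv.Perm E) : Prop
    extends IsGluing τ g where
  side : ∀ e, g e ≠ e → σ (g e) = !σ e

open scoped Classical in
/-- The nontrivial ways to identify edges of opposite type on opposite sides. -/
noncomputable def crossGluings {E : Type*} [Fintype E] (τ σ : E → Bool) : Finset (Equiv.Perm E) :=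
  Finset.univ.filter fun g => IsCrossGluing τ σ g ∧ g ≠ 1

theorem mem_crossGluings {E : Type*} [Fintype E] {τ σ : E → Bool} {g : Equiv.Perm E} :
    g ∈ crossGluings τ σ ↔ IsCrossGluing τ σ g ∧ g ≠ 1 := by
  simp [crossGluings]

/-! ### The square of an estimator on two circles. -/

section TwoCircles

variable {I : Type u}

/-- The side of an edge of two circles. -/
def side (e : (I ⊕ I) ⊕ (I ⊕ I)) : Bool := Sum.elim Sum.isRight Sum.isRight e

variable [DecidableEq I]

theorem gluePerm_eq_one_iff (π : PartialMatching I) : gluePerm π = 1 ↔ π.1.1 = ∅ := by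
  constructor
  · intro h
    ext i
    have := gluePerm_inr_eq_iff (π := π) (i := i)
    rw [h] at this
    simpa using this
  · intro h
    have h2 : π.1.2 = ∅ := by
      rw [← Finset.card_eq_zero]
      have := Fintype.card_congr π.2
      simp only [Fintype.card_coe] at this
      rw [← this, h, Finset.card_empty]
    ext e
    rcases e with j | i
    · rw [gluePerm_inl_notMem (by rw [h2]; simp)]; rfl
    · rw [gluePerm_inr_notMem (by rw [h]; simp)]; rfl

theorem isCrossGluing_gluePerm_iff (π : PartialMatching (I ⊕ I)) :
    IsCrossGluing Sum.isRight side (gluePerm π) ↔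
      ∀ i : π.1.1, (π.2 i : I ⊕ I).isRight = !(i : I ⊕ I).isRight := by
  constructor
  · intro h i
    have h1 := h.side (Sum.inr i) (by rw [Ne, gluePerm_inr_eq_iff, not_not]; exact i.2)
    rwa [gluePerm_inr_mem i.2] at h1
  · intro h
    refine ⟨isGluing_gluePerm π, ?_⟩
    rintro (j | i) he
    · rw [Ne, gluePerm_inl_eq_iff, not_not] at he
      rw [gluePerm_inl_mem he]
      have := h (π.2.symm ⟨j, he⟩)
      rw [Equiv.apply_symm_apply] at this
      simp only [side, Sum.elim_inr, Sum.elim_inl]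
      rw [this, Bool.not_not]
    · rw [Ne, gluePerm_inr_eq_iff, not_not] at he
      rw [gluePerm_inr_mem he]
      exact h ⟨i, he⟩

variable [Fintype I]

/-- Changes the summation variable from partial matchings to involutions, which makes conjugation
and products with transpositions available for counting. -/
theorem sum_gluePerm {R : Type*} [AddCommMonoid R] (π₀ : PartialMatching I → R)
    (F : Equiv.Perm (I ⊕ I) → R) (s : Finset (Equiv.Perm (I ⊕ I)))
    (hs : ∀ g ∈ s, IsGluing Sum.isRight g) (h0 : ∀ π, gluePerm π ∉ s → π₀ π = 0)
    (h1 : ∀ π, gluePerm π ∈ s → π₀ π = F (gluePerm π)) :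
    ∑ π, π₀ π = ∑ g ∈ s, F g := by
  classical
  rw [← Finset.sum_filter_of_ne (p := fun π => gluePerm π ∈ s)
    (fun π _ hne => by by_contra hcon; exact hne (h0 π hcon))]
  refine Finset.sum_bij (fun π _ => gluePerm π) (fun π hπ => (Finset.mem_filter.1 hπ).2)
    (fun π _ π' _ h => gluePerm_injective h) ?_ (fun π hπ => h1 π (Finset.mem_filter.1 hπ).2)
  intro g hg
  obtain ⟨π, hπ⟩ := exists_gluePerm_eq (hs g hg)
  exact ⟨π, by simp [hπ, hg], hπ⟩

variable {ι κ : Type*} [Fintype ι] [Fintype κ] [DecidableEq ι] [DecidableEq κ]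

/-- The square has pair weights -1 inside each circle and 0 across; noise turns them into 0 and 1.
Only matchings across the circles survive, and the subtracted product is the term of the empty one.
-/
theorem integral_contractionSum_sq_sub (c : Equiv.Perm I) (D : Matrix ι κ ℂ) :
    ∫ z, contractionSum c (fun _ _ => -1) (D + noiseMatrix z) *
        contractionSum c (fun _ _ => -1) (D + noiseMatrix z) ∂stdGaussianVec (ι × κ) -
      contractionSum c 0 D * contractionSum c 0 D =
    ∑ g ∈ crossGluings Sum.isRight side,
      glueWeight Sum.isRight (nextEdge (Equiv.sumCongr c c)) g (Fintype.card ι : ℂ)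
        (Fintype.card κ) fun l => ((D * Dᴴ) ^ l).trace := by
  have hw : (fun a b : I ⊕ I => Sum.elim (fun _ : I => Sum.elim (fun _ : I => (-1 : ℂ)) 0)
      (fun _ : I => Sum.elim 0 (fun _ : I => (-1 : ℂ))) a b + 1) =
      fun a b => if b.isRight = !a.isRight then 1 else 0 := by
    funext a b
    rcases a with a | a <;> rcases b with b | b <;> simp
  have h0 : (Sum.elim (fun i : I => Sum.elim ((0 : I → I → ℂ) i) 0)
      (fun i : I => Sum.elim 0 ((0 : I → I → ℂ) i))) = (0 : I ⊕ I → I ⊕ I → ℂ) := by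
    funext a b
    rcases a with a | a <;> rcases b with b | b <;> simp
  simp_rw [contractionSum_mul]
  rw [integral_contractionSum, hw, h0, contractionSum_eq, contractionSum_eq,
    ← Finset.sum_sub_distrib]
  refine sum_gluePerm _ _ _ (fun g hg => (mem_crossGluings.1 hg).1.toIsGluing) ?_ ?_
  · intro π hπ
    rw [mem_crossGluings, not_and_or, not_not, gluePerm_eq_one_iff] at hπ
    rw [← sub_mul]
    refine mul_eq_zero_of_left ?_ _
    rw [sub_eq_zero]
    -- The empty matching contributes equally to both sums; a matching with a pair inside one circle
    -- contributes to neither.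
    by_cases h : π.1.1 = ∅
    · have : IsEmpty π.1.1 := by rw [h]; infer_instance
      simp
    · have hcr := hπ.resolve_right h
      rw [isCrossGluing_gluePerm_iff, not_forall] at hcr
      obtain ⟨i, hi⟩ := hcr
      rw [Finset.prod_eq_zero (Finset.mem_univ i) (if_neg hi),
        Finset.prod_eq_zero (Finset.mem_univ i) rfl]
  · intro π hπ
    rw [mem_crossGluings, Ne, gluePerm_eq_one_iff, isCrossGluing_gluePerm_iff] at hπ
    obtain ⟨i, hi⟩ := Finset.nonempty_iff_ne_empty.2 hπ.2
    rw [Finset.prod_eq_one fun i _ => if_pos (hπ.1 i),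
      Finset.prod_eq_zero (Finset.mem_univ (⟨i, hi⟩ : π.1.1)) rfl, zero_mul, sub_zero, one_mul]

end TwoCircles

end Stacking

namespace Stacking

/-! ### The estimators under the Gaussian distribution -/

theorem sameCycle_nextEdge {p : ℕ} (e f : Fin p ⊕ Fin p) :
    (nextEdge (finRotate p)).SameCycle e f := by
  cases p with
  | zero => rcases e with e | e <;> exact e.elim0
  | succ m =>
    have h1 : ∀ i, (nextEdge (finRotate (m + 1))).SameCycle (Sum.inl i) (Sum.inr i) := fun i =>
      sameCycle_apply_self _ (Sum.inl i)
    have h2 : ∀ i, (nextEdge (finRotate (m + 1))).SameCycle (Sum.inl i) (Sum.inl (i + 1)) := by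
      intro i
      refine (h1 i).trans ?_
      have := sameCycle_apply_self (nextEdge (finRotate (m + 1))) (Sum.inr i)
      rwa [nextEdge_inr, finRotate_apply] at this
    have h3 : ∀ i, (nextEdge (finRotate (m + 1))).SameCycle (Sum.inl 0) (Sum.inl i) := by
      intro i
      induction i using Fin.induction with
      | zero => rfl
      | succ i ih =>
        refine ih.trans ?_
        have := h2 i.castSucc
        rwa [Fin.coeSucc_eq_succ] at this
    have h4 : ∀ e, (nextEdge (finRotate (m + 1))).SameCycle (Sum.inl 0) e := by
      rintro (i | i)
      · exact h3 i
      · exact (h3 i).trans (h1 i)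
    exact (h4 e).symm.trans (h4 f)

/-- Without identifications the whole circle is one cycle with `2 * p` free edges. -/
theorem glueWeight_one {p : ℕ} (hp : 1 ≤ p) {R : Type*} [CommMonoid R] (x y : R) (θ : ℕ → R) :
    glueWeight Sum.isRight (nextEdge (finRotate p)) 1 x y θ = θ p := by
  classical
  let o : Orb (nextEdge (finRotate p) * 1) := orb _ (Sum.inl ⟨0, hp⟩)
  have ho : ∀ e, orb (nextEdge (finRotate p) * 1) e = o := by
    intro e
    rw [orb_eq_iff, mul_one]
    exact sameCycle_nextEdge _ _
  have hw : orbWeight (nextEdge (finRotate p)) 1 o = 2 * p := by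
    rw [orbWeight_eq_natCard, Nat.card_congr (Equiv.subtypeUnivEquiv fun e => ⟨ho e, rfl⟩)]
    simp [two_mul]
  rw [glueWeight, Fintype.prod_eq_single o]
  · rw [orbFactor, hw, if_neg (by omega), Nat.mul_div_cancel_left _ two_pos]
  · intro o' h
    refine absurd ?_ h
    rw [← orb_out o', ho]

theorem contractionSum_zero {I : Type u} [Fintype I] [DecidableEq I] {ι κ : Type*} [Fintype ι]
    [Fintype κ] [DecidableEq ι] [DecidableEq κ] (c : Equiv.Perm I) (Y : Matrix ι κ ℂ) :
    contractionSum c 0 Y = glueWeight Sum.isRight (nextEdge c) 1 (Fintype.card ι : ℂ)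
      (Fintype.card κ) fun l => ((Y * Yᴴ) ^ l).trace := by
  rw [contractionSum_eq]
  rw [sum_gluePerm _ (fun g => glueWeight Sum.isRight (nextEdge c) g (Fintype.card ι : ℂ)
      (Fintype.card κ) fun l => ((Y * Yᴴ) ^ l).trace) {1}]
  · simp
  · intro g hg
    rw [Finset.mem_singleton] at hg
    subst hg
    exact ⟨fun _ => rfl, fun e he => absurd rfl he⟩
  · intro π hπ
    rw [Finset.mem_singleton, gluePerm_eq_one_iff] at hπ
    obtain ⟨i, hi⟩ := Finset.nonempty_iff_ne_empty.2 hπ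
    rw [Finset.prod_eq_zero (Finset.mem_univ (⟨i, hi⟩ : π.1.1)) rfl, zero_mul]
  · intro π hπ
    rw [Finset.mem_singleton] at hπ
    have h := (gluePerm_eq_one_iff π).1 hπ
    have : IsEmpty π.1.1 := by rw [h]; infer_instance
    simp

theorem ofReal_glueWeight {E : Type*} [Fintype E] (τ : E → Bool) (φ g : Equiv.Perm E) (x y : ℝ)
    (θ : ℕ → ℝ) : ((glueWeight τ φ g x y θ : ℝ) : ℂ) = glueWeight τ φ g (x : ℂ) y fun l => θ l := by
  rw [glueWeight_eq, glueWeight_eq]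
  push_cast
  rfl

/-! ### Mean and variance of the estimator of a noisy matrix. -/

section GaussianEstimator

variable {ι κ : Type*} [Fintype ι] [Fintype κ] [DecidableEq ι] [DecidableEq κ] [Nonempty ι]
  [Nonempty κ]

theorem ofReal_estimator_eq_contractionSum (p : ℕ) (Y : Matrix ι κ ℂ) :
    ((estimator p Y : ℝ) : ℂ) = ((Fintype.card ι : ℂ) * (Fintype.card κ : ℂ) ^ p)⁻¹ *
      contractionSum (finRotate p) (fun _ _ => -1) Y := by
  have h1 : (Fintype.card ι : ℂ) ≠ 0 := by simp
  have h2 : (Fintype.card κ : ℂ) ≠ 0 := by simp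
  rw [eq_inv_mul_iff_mul_eq₀ (mul_ne_zero h1 (pow_ne_zero _ h2)), ofReal_estimator, contractionSum_eq]
  refine Finset.sum_congr rfl fun π _ => ?_
  simp

theorem allMoments_estimator (p : ℕ) (D : Matrix ι κ ℂ) :
    AllMoments (fun z => ((estimator p (D + noiseMatrix z) : ℝ) : ℂ)) (stdGaussianVec (ι × κ)) := by
  simp_rw [ofReal_estimator_eq_contractionSum]
  exact (AllMoments.const _).mul (allMoments_contractionSum _ _ _)

theorem memLp_estimator (p : ℕ) (D : Matrix ι κ ℂ) :
    MemLp (fun z => estimator p (D + noiseMatrix z)) 2 (stdGaussianVec (ι × κ)) :=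
  (allMoments_estimator p D).memLp_re

theorem contractionSum_zero_finRotate {p : ℕ} (hp : 1 ≤ p) (D : Matrix ι κ ℂ) :
    contractionSum (finRotate p) 0 D =
      (Fintype.card ι : ℂ) * (Fintype.card κ : ℂ) ^ p * (matMoment D p : ℝ) := by
  rw [contractionSum_zero, glueWeight_one hp, trace_pow_eq_matMoment]

theorem integral_estimator {p : ℕ} (hp : 1 ≤ p) (D : Matrix ι κ ℂ) :
    ∫ z, estimator p (D + noiseMatrix z) ∂stdGaussianVec (ι × κ) = matMoment D p := by
  have h1 : (Fintype.card ι : ℂ) ≠ 0 := by simp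
  have h2 : (Fintype.card κ : ℂ) ≠ 0 := by simp
  apply Complex.ofReal_injective
  rw [← integral_complex_ofReal]
  simp_rw [ofReal_estimator_eq_contractionSum]
  rw [integral_const_mul, integral_contractionSum]
  have : (fun _ _ => -1 + 1 : Fin p → Fin p → ℂ) = 0 := by funext i j; simp
  rw [this, contractionSum_zero_finRotate hp]
  field_simp

theorem variance_estimator {p : ℕ} (hp : 1 ≤ p) (D : Matrix ι κ ℂ) :
    Var[fun z => estimator p (D + noiseMatrix z); stdGaussianVec (ι × κ)] =
      (((Fintype.card ι : ℝ) * (Fintype.card κ : ℝ) ^ p) ^ 2)⁻¹ *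
        ∑ g ∈ crossGluings Sum.isRight side,
          glueWeight Sum.isRight (nextEdge (Equiv.sumCongr (finRotate p) (finRotate p))) g
            (Fintype.card ι : ℝ) (Fintype.card κ)
            fun l => (Fintype.card ι : ℝ) * (Fintype.card κ : ℝ) ^ l * matMoment D l := by
  have h1 : (Fintype.card ι : ℂ) ≠ 0 := by simp
  have h2 : (Fintype.card κ : ℂ) ≠ 0 := by simp
  rw [variance_eq_sub (memLp_estimator p D), integral_estimator hp]
  apply Complex.ofReal_injective
  have key := integral_contractionSum_sq_sub (finRotate p) D
  rw [contractionSum_zero_finRotate hp] at key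
  push_cast
  simp_rw [ofReal_glueWeight]
  push_cast
  simp_rw [← trace_pow_eq_matMoment, ← key]
  rw [← integral_complex_ofReal]
  have h3 : ∀ z, ((((fun z => estimator p (D + noiseMatrix z)) ^ 2) z : ℝ) : ℂ) =
      ((((Fintype.card ι : ℂ) * (Fintype.card κ : ℂ) ^ p)) ^ 2)⁻¹ *
        (contractionSum (finRotate p) (fun _ _ => -1) (D + noiseMatrix z) *
        contractionSum (finRotate p) (fun _ _ => -1) (D + noiseMatrix z)) := by
    intro z
    rw [Pi.pow_apply, Complex.ofReal_pow, ofReal_estimator_eq_contractionSum]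
    ring
  simp_rw [h3]
  rw [integral_const_mul]
  field_simp

end GaussianEstimator

end Stacking

namespace Stacking

/-! ### The variances of the estimators in the additive model -/

/-! ### Identified pairs and rescaling of gluing weights. -/

section Weights

open scoped Classical

variable {E : Type*} [Fintype E] {τ : E → Bool} {φ g : Equiv.Perm E}

/-- The number of pairs of identified edges. -/
noncomputable def numPairs (g : Equiv.Perm E) : ℕ :=
  (Finset.univ.filter fun e => g e ≠ e).card / 2

theorem card_type_eq (hg : IsGluing τ g) (b : Bool) :
    (Finset.univ.filter fun e => g e ≠ e ∧ τ e = b).card = numPairs g := by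
  have h1 : (Finset.univ.filter fun e => g e ≠ e).card =
      (Finset.univ.filter fun e => g e ≠ e ∧ τ e = true).card +
      (Finset.univ.filter fun e => g e ≠ e ∧ τ e = false).card := by
    rw [← Finset.card_filter_add_card_filter_not (fun e => τ e = true), Finset.filter_filter,
      Finset.filter_filter]
    simp
  have h2 : (Finset.univ.filter fun e => g e ≠ e ∧ τ e = true).card =
      (Finset.univ.filter fun e => g e ≠ e ∧ τ e = false).card := by
    refine Finset.card_bij (fun e _ => g e) ?_ (fun a _ b _ h => g.injective h) ?_
    · intro e he
      simp only [Finset.mem_filter, Finset.mem_univ, true_and] at he ⊢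
      exact ⟨fun h => he.1 (g.injective h), by rw [hg.type e he.1, he.2]; rfl⟩
    · intro e he
      simp only [Finset.mem_filter, Finset.mem_univ, true_and] at he
      refine ⟨g e, ?_, hg.invol e⟩
      simp only [Finset.mem_filter, Finset.mem_univ, true_and]
      exact ⟨fun h => he.1 (g.injective h), by rw [hg.type e he.1, he.2]; rfl⟩
  rw [numPairs]
  cases b <;> omega

theorem two_mul_numPairs (hg : IsGluing τ g) :
    2 * numPairs g = (Finset.univ.filter fun e => g e ≠ e).card := by
  have h1 : (Finset.univ.filter fun e => g e ≠ e).card =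
      (Finset.univ.filter fun e => g e ≠ e ∧ τ e = true).card +
      (Finset.univ.filter fun e => g e ≠ e ∧ τ e = false).card := by
    rw [← Finset.card_filter_add_card_filter_not (fun e => τ e = true), Finset.filter_filter,
      Finset.filter_filter]
    simp
  rw [h1, card_type_eq hg, card_type_eq hg, two_mul]

theorem sum_half_orbWeight (hφ : ∀ e, τ (φ e) = !τ e) (hg : IsGluing τ g) :
    2 * (∑ o : Orb (φ * g) with orbWeight φ g o ≠ 0, orbWeight φ g o / 2 + numPairs g) =
      Fintype.card E := by
  have h1 := sum_orbWeight φ g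
  have h2 : (Finset.univ.filter fun e => g e = e).card +
      (Finset.univ.filter fun e => g e ≠ e).card = Fintype.card E :=
    Finset.card_filter_add_card_filter_not _
  have h3 : 2 * ∑ o : Orb (φ * g) with orbWeight φ g o ≠ 0, orbWeight φ g o / 2 =
      ∑ o : Orb (φ * g), orbWeight φ g o := by
    rw [Finset.mul_sum, Finset.sum_filter]
    refine Finset.sum_congr rfl fun o _ => ?_
    split_ifs with h
    · exact Nat.mul_div_cancel' (even_iff_two_dvd.1 (even_orbWeight hφ hg o))
    · exact (not_not.1 h).symm
  have h4 := two_mul_numPairs hg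
  omega

theorem glueWeight_congr {R : Type*} [CommMonoid R] (hφ : ∀ e, τ (φ e) = !τ e)
    (hg : IsGluing τ g) (x y : R) {θ θ' : ℕ → R}
    (h : ∀ l, l ≠ 0 → θ l = θ' l) : glueWeight τ φ g x y θ = glueWeight τ φ g x y θ' := by
  rw [glueWeight_eq, glueWeight_eq]
  congr 1
  refine Finset.prod_congr rfl fun o ho => h _ ?_
  obtain ⟨l, hl⟩ := even_orbWeight hφ hg o
  have := (Finset.mem_filter.1 ho).2
  omega

/-- The half sizes of the blocks and the number of pairs add up to `m`, so scaling the traces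
contributes `(a * b) ^ (m - numPairs g)`; the free cycles contribute the other powers of `a` and
`b`. -/
theorem glueWeight_scale {m : ℕ} (hE : Fintype.card E = 2 * m) (hφ : ∀ e, τ (φ e) = !τ e)
    (hg : IsGluing τ g) (x y a b : ℝ) (ha : a ≠ 0) (hb : b ≠ 0) (θ : ℕ → ℝ) :
    glueWeight τ φ g (x * a) (y * b) (fun l => (a * b) ^ l * θ l) =
      (a * b) ^ m * (glueWeight τ φ g x y θ *
        (a ^ numFree τ φ g false * b ^ numFree τ φ g true / (a * b) ^ numPairs g)) := by
  have h := sum_half_orbWeight hφ hg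
  rw [glueWeight_eq, glueWeight_eq, Finset.prod_mul_distrib, Finset.prod_pow_eq_pow_sum]
  have h2 : m = ∑ o : Orb (φ * g) with orbWeight φ g o ≠ 0, orbWeight φ g o / 2 + numPairs g := by
    omega
  rw [h2, pow_add, mul_pow, mul_pow]
  have : (a * b) ^ numPairs g ≠ 0 := pow_ne_zero _ (mul_ne_zero ha hb)
  field_simp

end Weights

/-- The edges of two circles. -/
abbrev TwoCircleEdge (p : ℕ) : Type := (Fin p ⊕ Fin p) ⊕ (Fin p ⊕ Fin p)

/-- The successor of an edge of two circles. -/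
abbrev nextTwo (p : ℕ) : Equiv.Perm (TwoCircleEdge p) :=
  nextEdge (Equiv.sumCongr (finRotate p) (finRotate p))

/-! ### Moments of the compound of equal matrices. -/

section Compound

variable {n N L₁ L₂ : ℕ}

theorem compound_const_mul_pow (e : Fin L₁ × Fin L₂ ≃ Fin (L₁ * L₂))
    (D : Matrix (Fin n) (Fin N) ℂ) (l : ℕ) (a b : Fin L₁ × Fin n) :
    ((compound e (fun _ => D) * (compound e (fun _ => D))ᴴ) ^ (l + 1)) a b =
      (L₂ : ℂ) ^ (l + 1) * (L₁ : ℂ) ^ l * ((D * Dᴴ) ^ (l + 1)) a.2 b.2 := by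
  have h1 : ∀ a b, (compound e (fun _ => D) * (compound e (fun _ => D))ᴴ) a b =
      (L₂ : ℂ) * (D * Dᴴ) a.2 b.2 := by
    intro a b
    rw [Matrix.mul_apply, Matrix.mul_apply, Fintype.sum_prod_type]
    simp [compound]
  induction l generalizing a b with
  | zero => simp [h1]
  | succ l ih =>
    rw [pow_succ, Matrix.mul_apply, Fintype.sum_prod_type]
    simp_rw [ih, h1]
    rw [Finset.sum_const, Finset.card_univ, Fintype.card_fin, pow_succ (D * Dᴴ) (l + 1),
      Matrix.mul_apply (M := (D * Dᴴ) ^ (l + 1)), nsmul_eq_mul, Finset.mul_sum, Finset.mul_sum]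
    refine Finset.sum_congr rfl fun k _ => ?_
    ring

/-- The compound is the Kronecker product of D with an all-ones L₁ × L₂ matrix J, and the trace of
`(J Jᵀ) ^ l` is (L₁ L₂)^l for l ≥ 1; at l = 0 it would be L₁. -/
theorem trace_compound_const (e : Fin L₁ × Fin L₂ ≃ Fin (L₁ * L₂))
    (D : Matrix (Fin n) (Fin N) ℂ) {l : ℕ} (hl : l ≠ 0) :
    ((compound e (fun _ => D) * (compound e (fun _ => D))ᴴ) ^ l).trace =
      ((L₁ : ℂ) * L₂) ^ l * ((D * Dᴴ) ^ l).trace := by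
  obtain ⟨l, rfl⟩ := Nat.exists_eq_succ_of_ne_zero hl
  rw [Matrix.trace, Fintype.sum_prod_type]
  simp only [Matrix.diag, Nat.succ_eq_add_one, compound_const_mul_pow]
  rw [Finset.sum_const, Finset.card_univ, Fintype.card_fin, nsmul_eq_mul, ← Finset.mul_sum,
    Matrix.trace]
  simp only [Matrix.diag]
  ring

theorem matMoment_compound_const (hn : 0 < n) (hN : 0 < N) (h₁ : 0 < L₁) (h₂ : 0 < L₂)
    (e : Fin L₁ × Fin L₂ ≃ Fin (L₁ * L₂)) (D : Matrix (Fin n) (Fin N) ℂ) {l : ℕ} (hl : l ≠ 0) :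
    ((n : ℝ) * L₁) * ((N : ℝ) * L₂) ^ l * matMoment (compound e (fun _ => D)) l =
      ((L₁ : ℝ) * L₂) ^ l * ((n : ℝ) * (N : ℝ) ^ l * matMoment D l) := by
  have : NeZero n := ⟨hn.ne'⟩
  have : NeZero N := ⟨hN.ne'⟩
  have : NeZero L₁ := ⟨h₁.ne'⟩
  have : NeZero L₂ := ⟨h₂.ne'⟩
  apply Complex.ofReal_injective
  have ha := trace_pow_eq_matMoment (compound e (fun _ => D)) l
  have hb := trace_pow_eq_matMoment D l
  rw [trace_compound_const e D hl, hb] at ha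
  simp only [Fintype.card_prod, Fintype.card_fin] at ha
  push_cast at ha ⊢
  rw [ha]
  ring

end Compound

/-! ### Observations as a mean plus a standard Gaussian vector. -/

section Model

variable {n N : ℕ} {Ω : Type*} [MeasurableSpace Ω] {μ : Measure Ω} [IsProbabilityMeasure μ]
  {D : Matrix (Fin n) (Fin N) ℂ} {Y : ℕ → Ω → Matrix (Fin n) (Fin N) ℂ}

theorem hasLaw_entries {X : ℕ → Ω → Matrix (Fin n) (Fin N) ℂ}
    (hX : ∀ k i j, HasLaw (fun ω => X k ω i j) stdComplexGaussian μ)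
    (hI : iIndepFun (fun (t : ℕ × Fin n × Fin N) ω => X t.1 ω t.2.1 t.2.2) μ)
    {J : Type*} [Fintype J] {ψ : J → ℕ × Fin n × Fin N} (hψ : Function.Injective ψ) :
    HasLaw (fun ω j => X (ψ j).1 ω (ψ j).2.1 (ψ j).2.2) (stdGaussianVec J) μ := by
  have hm : ∀ j, AEMeasurable (fun ω => X (ψ j).1 ω (ψ j).2.1 (ψ j).2.2) μ :=
    fun j => (hX _ _ _).aemeasurable
  refine ⟨aemeasurable_pi_lambda _ hm, ?_⟩
  have h := (iIndepFun_iff_map_fun_eq_pi_map hm).1 (hI.precomp hψ)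
  rw [h, stdGaussianVec]
  congr 1
  funext j
  exact (hX _ _ _).map_eq

/-- The compound matrix of the observations is the compound matrix of the mean plus noise. -/
theorem exists_compound_eq (hY : IsAdditiveModel μ D Y) {L₁ L₂ : ℕ}
    (e : Fin L₁ × Fin L₂ ≃ Fin (L₁ * L₂)) :
    ∃ T : Ω → ((Fin L₁ × Fin n) × (Fin L₂ × Fin N) → ℂ),
      HasLaw T (stdGaussianVec _) μ ∧
      ∀ ω, compound e (fun k => Y k ω) = compound e (fun _ => D) + noiseMatrix (T ω) := by
  obtain ⟨X, hYX, hX, hI⟩ := hY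
  refine ⟨_, hasLaw_entries hX hI
    (ψ := fun q => ((e (q.1.1, q.2.1) : ℕ), q.1.2, q.2.2)) ?_, ?_⟩
  · rintro ⟨⟨a, i⟩, ⟨b, j⟩⟩ ⟨⟨a', i'⟩, ⟨b', j'⟩⟩ h
    simp only [Prod.mk.injEq] at h
    have h1 := e.injective (Fin.ext h.1)
    simp only [Prod.mk.injEq] at h1
    simp [h1, h.2]
  · intro ω
    ext a b
    simp [compound, noiseMatrix, hYX]

theorem exists_single_eq (hY : IsAdditiveModel μ D Y) (k : ℕ) :
    ∃ T : Ω → (Fin n × Fin N → ℂ), HasLaw T (stdGaussianVec _) μ ∧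
      ∀ ω, Y k ω = D + noiseMatrix (T ω) := by
  obtain ⟨X, hYX, hX, hI⟩ := hY
  refine ⟨_, hasLaw_entries hX hI (ψ := fun q => (k, q.1, q.2)) ?_, ?_⟩
  · rintro ⟨i, j⟩ ⟨i', j'⟩ h
    simpa using h
  · intro ω
    ext a b
    simp [noiseMatrix, hYX]

end Model

end Stacking

namespace Stacking

/-! ### Unbiasedness and exact variances in the additive model. -/

section Model

variable {n N : ℕ} {Ω : Type*} [MeasurableSpace Ω] {μ : Measure Ω}
  {D : Matrix (Fin n) (Fin N) ℂ} {Y : ℕ → Ω → Matrix (Fin n) (Fin N) ℂ}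

theorem isUnbiased_estimator {ι κ : Type*} [Fintype ι] [Fintype κ] [DecidableEq ι]
    [DecidableEq κ] [Nonempty ι] [Nonempty κ] {p : ℕ} (hp : 1 ≤ p) {M : Matrix ι κ ℂ}
    {Z : Ω → Matrix ι κ ℂ} {T : Ω → ι × κ → ℂ} (hT : HasLaw T (stdGaussianVec (ι × κ)) μ)
    (hZ : ∀ ω, Z ω = M + noiseMatrix (T ω)) :
    IsUnbiased μ (fun ω => estimator p (Z ω)) (matMoment M p) := by
  simp_rw [hZ]
  have h := memLp_estimator p M
  refine ⟨?_, ?_⟩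
  · rw [← hT.map_eq] at h
    exact h.comp_of_map hT.aemeasurable
  rw [← integral_estimator hp M]
  exact hT.integral_comp h.1

theorem variance_estimator_of_hasLaw {ι κ : Type*} [Fintype ι] [Fintype κ] [DecidableEq ι]
    [DecidableEq κ] [Nonempty ι] [Nonempty κ] (p : ℕ) {M : Matrix ι κ ℂ}
    {Z : Ω → Matrix ι κ ℂ} {T : Ω → ι × κ → ℂ} (hT : HasLaw T (stdGaussianVec (ι × κ)) μ)
    (hZ : ∀ ω, Z ω = M + noiseMatrix (T ω)) :
    Var[fun ω => estimator p (Z ω); μ] =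
      Var[fun z => estimator p (M + noiseMatrix z); stdGaussianVec (ι × κ)] := by
  simp_rw [hZ]
  have h := (memLp_estimator p M).1.aemeasurable
  rw [← hT.map_eq] at h ⊢
  exact (variance_map h hT.aemeasurable).symm

theorem isUnbiased_const_mul {T : Ω → ℝ} {θ : ℝ} (h : IsUnbiased μ T θ) (c : ℝ) :
    IsUnbiased μ (fun ω => c * T ω) (c * θ) :=
  ⟨h.1.const_mul c, by rw [integral_const_mul, h.2]⟩

variable [IsProbabilityMeasure μ]

theorem isUnbiased_single (hn : 0 < n) (hN : 0 < N) {p : ℕ} (hp : 1 ≤ p)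
    (hY : IsAdditiveModel μ D Y) (k : ℕ) :
    IsUnbiased μ (fun ω => estimator p (Y k ω)) (matMoment D p) := by
  have : NeZero n := ⟨hn.ne'⟩
  have : NeZero N := ⟨hN.ne'⟩
  obtain ⟨T, hT, hZ⟩ := exists_single_eq hY k
  exact isUnbiased_estimator hp hT hZ

/-- The compound of the means has p-th moment L₁^(p-1) D_p, and the prefactor of the estimator
undoes this power. -/
theorem isUnbiased_stack (hn : 0 < n) (hN : 0 < N) {p : ℕ} (hp : 1 ≤ p)
    (hY : IsAdditiveModel μ D Y) {L₁ L₂ : ℕ} (h₁ : 0 < L₁) (h₂ : 0 < L₂)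
    (e : Fin L₁ × Fin L₂ ≃ Fin (L₁ * L₂)) :
    IsUnbiased μ (fun ω => stackEstimator p e (fun k => Y k ω)) (matMoment D p) := by
  have : NeZero n := ⟨hn.ne'⟩
  have : NeZero N := ⟨hN.ne'⟩
  have : NeZero L₁ := ⟨h₁.ne'⟩
  have : NeZero L₂ := ⟨h₂.ne'⟩
  obtain ⟨T, hT, hZ⟩ := exists_compound_eq hY e
  have h := isUnbiased_const_mul (isUnbiased_estimator hp hT hZ) ((L₁ : ℝ) ^ (1 - (p : ℤ)))
  have hm := matMoment_compound_const hn hN h₁ h₂ e D (l := p) (by omega)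
  have a1 : (L₁ : ℝ) ≠ 0 := by exact_mod_cast h₁.ne'
  have a2 : (L₂ : ℝ) ≠ 0 := by exact_mod_cast h₂.ne'
  have a3 : (n : ℝ) ≠ 0 := by exact_mod_cast hn.ne'
  have a4 : (N : ℝ) ≠ 0 := by exact_mod_cast hN.ne'
  have hz : (L₁ : ℝ) ^ (1 - (p : ℤ)) * (L₁ : ℝ) ^ p = L₁ := by
    rw [← zpow_natCast, ← zpow_add₀ a1]; simp
  have hc : (n : ℝ) * N ^ p * L₂ ^ p * L₁ ≠ 0 := by positivity
  have hv : matMoment D p = (L₁ : ℝ) ^ (1 - (p : ℤ)) * matMoment (compound e fun _ => D) p := by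
    apply mul_left_cancel₀ hc
    calc (n : ℝ) * N ^ p * L₂ ^ p * L₁ * matMoment D p
        = ((L₁ : ℝ) ^ (1 - (p : ℤ)) * (L₁ : ℝ) ^ p) * (n * N ^ p * L₂ ^ p) * matMoment D p := by
          rw [hz]; ring
      _ = (L₁ : ℝ) ^ (1 - (p : ℤ)) * (((L₁ : ℝ) * L₂) ^ p * ((n : ℝ) * (N : ℝ) ^ p * matMoment D p)) := by
          rw [mul_pow]; ring
      _ = _ := by rw [← hm, mul_pow]; ring
  rw [hv]
  exact h

theorem isUnbiased_avg (hn : 0 < n) (hN : 0 < N) {p : ℕ} (hp : 1 ≤ p)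
    (hY : IsAdditiveModel μ D Y) {L : ℕ} (hL : 0 < L) :
    IsUnbiased μ (fun ω => avgEstimator p L (fun k => Y k ω)) (matMoment D p) := by
  have h := fun k => isUnbiased_single hn hN hp hY k
  have h2 : IsUnbiased μ (fun ω => ∑ k ∈ Finset.range L, estimator p (Y k ω))
      (L * matMoment D p) := by
    refine ⟨memLp_finsetSum _ fun k _ => (h k).1, ?_⟩
    rw [integral_finsetSum _ fun k _ => (h k).1.integrable one_le_two]
    simp [(h _).2]
  have hL' : (L : ℝ) ≠ 0 := by exact_mod_cast hL.ne'
  have h3 := isUnbiased_const_mul h2 ((L : ℝ)⁻¹)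
  rwa [inv_mul_cancel_left₀ hL'] at h3

/-- The contribution of a gluing of two circles to the variance. -/
noncomputable def varTerm (p : ℕ) (D : Matrix (Fin n) (Fin N) ℂ)
    (g : Equiv.Perm (TwoCircleEdge p)) : ℝ :=
  glueWeight Sum.isRight (nextTwo p) g (n : ℝ) N fun l => (n : ℝ) * (N : ℝ) ^ l * matMoment D l

/-- The gluings that contribute to the variance. -/
noncomputable abbrev varGluings (p : ℕ) : Finset (Equiv.Perm (TwoCircleEdge p)) :=
  crossGluings Sum.isRight side

/-- `glueWeight_scale` with the factors L₁ and L₂. Its common power (L₁ L₂)^(2p) cancels against the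
normalisation of the compound matrix and the squared prefactor. -/
theorem stackVar_eq (hn : 0 < n) (hN : 0 < N) {p : ℕ} (hp : 1 ≤ p)
    (hY : IsAdditiveModel μ D Y) {L₁ L₂ : ℕ} (h₁ : 0 < L₁) (h₂ : 0 < L₂)
    (e : Fin L₁ × Fin L₂ ≃ Fin (L₁ * L₂)) :
    stackVar μ Y p e = (((n : ℝ) * (N : ℝ) ^ p) ^ 2)⁻¹ * ∑ g ∈ varGluings p, varTerm p D g *
      ((L₁ : ℝ) ^ numFree Sum.isRight (nextTwo p) g false *
        (L₂ : ℝ) ^ numFree Sum.isRight (nextTwo p) g true / ((L₁ : ℝ) * L₂) ^ numPairs g) := by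
  have : NeZero n := ⟨hn.ne'⟩
  have : NeZero N := ⟨hN.ne'⟩
  have : NeZero L₁ := ⟨h₁.ne'⟩
  have : NeZero L₂ := ⟨h₂.ne'⟩
  have a1 : (L₁ : ℝ) ≠ 0 := by exact_mod_cast h₁.ne'
  have a2 : (L₂ : ℝ) ≠ 0 := by exact_mod_cast h₂.ne'
  have a3 : (n : ℝ) ≠ 0 := by exact_mod_cast hn.ne'
  have a4 : (N : ℝ) ≠ 0 := by exact_mod_cast hN.ne'
  obtain ⟨T, hT, hZ⟩ := exists_compound_eq hY e
  unfold stackVar stackEstimator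
  rw [variance_const_mul, variance_estimator_of_hasLaw p hT hZ, variance_estimator hp]
  simp only [Fintype.card_prod, Fintype.card_fin]
  have hz : ((L₁ : ℝ) ^ (1 - (p : ℤ))) * (L₁ : ℝ) ^ p = L₁ := by
    rw [← zpow_natCast, ← zpow_add₀ a1]; simp
  have hterm : ∀ g ∈ varGluings p,
      glueWeight Sum.isRight (nextTwo p) g ((L₁ * n : ℕ) : ℝ) ((L₂ * N : ℕ) : ℝ)
        (fun l => ((L₁ * n : ℕ) : ℝ) * ((L₂ * N : ℕ) : ℝ) ^ l *
          matMoment (compound e fun _ => D) l) =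
      ((L₁ : ℝ) * L₂) ^ (2 * p) * (varTerm p D g *
      ((L₁ : ℝ) ^ numFree Sum.isRight (nextTwo p) g false *
        (L₂ : ℝ) ^ numFree Sum.isRight (nextTwo p) g true / ((L₁ : ℝ) * L₂) ^ numPairs g)) := by
    intro g hg
    have hg' := (mem_crossGluings.1 hg).1.toIsGluing
    rw [varTerm, ← glueWeight_scale (by simp; ring) (isRight_nextEdge _) hg' _ _ _ _ a1 a2]
    push_cast
    rw [mul_comm (L₁ : ℝ) (n : ℝ), mul_comm (L₂ : ℝ) (N : ℝ)]
    refine glueWeight_congr (isRight_nextEdge _) hg' _ _ fun l hl => ?_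
    exact matMoment_compound_const hn hN h₁ h₂ e D hl
  rw [Finset.sum_congr rfl hterm, ← Finset.mul_sum, ← mul_assoc, ← mul_assoc]
  congr 1
  push_cast
  have h3 : (L₁ : ℝ) ^ (1 - (p : ℤ)) = L₁ / (L₁ : ℝ) ^ p := by
    rw [eq_div_iff (pow_ne_zero _ a1), hz]
  rw [h3]
  field_simp
  ring

/-- Different observations involve disjoint families of independent entries, so the variances of
their estimators add. -/
theorem avgVar_eq (hn : 0 < n) (hN : 0 < N) {p : ℕ} (hp : 1 ≤ p)
    (hY : IsAdditiveModel μ D Y) {L : ℕ} (hL : 0 < L) :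
    avgVar μ Y p L = (((n : ℝ) * (N : ℝ) ^ p) ^ 2)⁻¹ *
      ∑ g ∈ varGluings p, varTerm p D g * (L : ℝ)⁻¹ := by
  have : NeZero n := ⟨hn.ne'⟩
  have : NeZero N := ⟨hN.ne'⟩
  have hL' : (L : ℝ) ≠ 0 := by exact_mod_cast hL.ne'
  obtain ⟨X, hYX, hX, hI⟩ := id hY
  have hT : ∀ k : ℕ, HasLaw (fun ω (q : Fin n × Fin N) => X k ω q.1 q.2) (stdGaussianVec _) μ :=
    fun k => hasLaw_entries hX hI (ψ := fun q : Fin n × Fin N => (k, q.1, q.2)) (by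
      rintro ⟨i, j⟩ ⟨i', j'⟩ h; simpa using h)
  have hZ : ∀ k ω, Y k ω = D + noiseMatrix (fun q : Fin n × Fin N => X k ω q.1 q.2) := by
    intro k ω
    ext a b
    simp [noiseMatrix, hYX]
  have hmem := fun k => (isUnbiased_single hn hN hp hY k).1
  have hpair : Set.Pairwise (↑(Finset.range L) : Set ℕ) fun k l =>
      IndepFun (fun ω => estimator p (Y k ω)) (fun ω => estimator p (Y l ω)) μ := by
    intro k _ l _ hkl
    have hm : ∀ t : ℕ × Fin n × Fin N, AEMeasurable (fun ω => X t.1 ω t.2.1 t.2.2) μ :=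
      fun t => (hX _ _ _).aemeasurable
    have h1 : IndepFun (fun ω (q : Fin n × Fin N) => X k ω q.1 q.2)
        (fun ω (q : Fin n × Fin N) => X l ω q.1 q.2) μ := by
      have h0 := hI.indepFun_finset₀ (({k} : Finset ℕ) ×ˢ (Finset.univ : Finset (Fin n × Fin N)))
        (({l} : Finset ℕ) ×ˢ (Finset.univ : Finset (Fin n × Fin N)))
        (Finset.disjoint_product.2 (Or.inl (by simpa using hkl))) hm
      have hproj : ∀ m : ℕ, Measurable
          (fun (v : (({m} : Finset ℕ) ×ˢ (Finset.univ : Finset (Fin n × Fin N)) :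
            Finset (ℕ × Fin n × Fin N)) → ℂ) (q : Fin n × Fin N) => v ⟨(m, q), by simp⟩) :=
        fun m => measurable_pi_lambda _ fun q => measurable_pi_apply _
      exact h0.comp (hproj k) (hproj l)
    have hest := (memLp_estimator p D).1.aemeasurable
    have h2 := h1.comp₀ (φ := fun z => estimator p (D + noiseMatrix z))
      (ψ := fun z => estimator p (D + noiseMatrix z)) (hT k).aemeasurable (hT l).aemeasurable
      (by rw [(hT k).map_eq]; exact hest) (by rw [(hT l).map_eq]; exact hest)
    simp_rw [hZ]
    exact h2
  have hsum := IndepFun.variance_sum (s := Finset.range L) (fun k _ => hmem k) hpair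
  unfold avgVar avgEstimator
  rw [variance_const_mul]
  have h2 : (fun ω => ∑ k ∈ Finset.range L, estimator p (Y k ω)) =
      ∑ k ∈ Finset.range L, fun ω => estimator p (Y k ω) := by
    funext ω; simp
  rw [h2, hsum]
  simp_rw [fun k => variance_estimator_of_hasLaw p (hT k) (hZ k)]
  rw [variance_estimator hp, Finset.sum_const, Finset.card_range, nsmul_eq_mul, ← Finset.sum_mul]
  simp only [Fintype.card_fin]
  change _ * (_ * (_ * ∑ g ∈ varGluings p, varTerm p D g)) = _
  field_simp

end Model

end Stacking

namespace Stacking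

/-! ### Cycles created by gluing two circles -/

section Cycles

open scoped Classical

variable {E : Type*}

/-- Since the two permutations agree on the `γ'`-cycle of `e`, this set is closed under `γ` in both
directions and contains the `γ`-cycle. -/
theorem sameCycle_of_eqOn {γ γ' : Equiv.Perm E} {e f : E}
    (h : ∀ x, γ'.SameCycle e x → γ x = γ' x) (s : γ.SameCycle e f) : γ'.SameCycle e f := by
  have key : ∀ x, γ'.SameCycle e (γ x) = γ'.SameCycle e x := by
    intro x
    apply propext
    constructor
    · intro hx
      have h1 : γ'.SameCycle e (γ'.symm (γ x)) :=
        hx.trans (by simpa using (sameCycle_apply_self γ' (γ'.symm (γ x))).symm)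
      have h2 := h _ h1
      rw [Equiv.apply_symm_apply] at h2
      rwa [γ.injective h2] at h1
    · intro hx
      rw [h x hx]
      exact hx.trans (sameCycle_apply_self _ _)
  have h3 := eq_of_sameCycle (h := fun x => γ'.SameCycle e x) key s
  exact h3.mp (Equiv.Perm.SameCycle.refl _ _)

theorem IsCrossGluing.mul_swap_self_apply {τ σ : E → Bool} {g : Equiv.Perm E}
    (hg : IsCrossGluing τ σ g) (a : E) (x : E) :
    (g * Equiv.swap a (g a)) x = if x = a ∨ x = g a then x else g x := by
  rw [Equiv.Perm.mul_apply]
  split_ifs with h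
  · rcases h with rfl | rfl
    · rw [Equiv.swap_apply_left, hg.invol]
    · rw [Equiv.swap_apply_right]
  · rw [not_or] at h
    rw [Equiv.swap_apply_of_ne_of_ne h.1 h.2]

/-- Dissolving one identified pair leaves a gluing; the bounds on the number of cycles are obtained
by induction along this operation. -/
theorem IsCrossGluing.mul_swap_self {τ σ : E → Bool} {g : Equiv.Perm E}
    (hg : IsCrossGluing τ σ g) (a : E) : IsCrossGluing τ σ (g * Equiv.swap a (g a)) := by
  have h := hg.mul_swap_self_apply a
  refine ⟨⟨?_, ?_⟩, ?_⟩
  · intro e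
    rw [h e]
    split_ifs with h1
    · rw [h e, if_pos h1]
    · rw [h (g e), if_neg, hg.invol]
      rintro (h2 | h2)
      · exact h1 (Or.inr (by rw [← h2, hg.invol]))
      · exact h1 (Or.inl (g.injective h2))
  · intro e
    rw [h e]
    split_ifs with h1
    · exact fun h2 => absurd rfl h2
    · exact hg.type e
  · intro e
    rw [h e]
    split_ifs with h1
    · exact fun h2 => absurd rfl h2
    · exact hg.side e

variable [Fintype E]

/-- A transposition affects only the cycles through `a` and `b`. In the surjection `F` the extra
element `none` covers the new cycle of `a`, and the old cycle of `b` covers the new one of `b`. -/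
theorem card_orb_mul_swap_le (γ : Equiv.Perm E) (a b : E) :
    Fintype.card (Orb (γ * Equiv.swap a b)) ≤ Fintype.card (Orb γ) + 1 := by
  set γ' := γ * Equiv.swap a b with hγ'
  let F : Option (Orb γ) → Orb γ' := fun t =>
    t.elim (orb γ' a) fun o => if o = orb γ b then orb γ' b else orb γ' o.out
  have hF : Function.Surjective F := by
    intro o
    by_cases ha : o = orb γ' a
    · exact ⟨none, ha.symm⟩
    by_cases hb : o = orb γ' b
    · exact ⟨some (orb γ b), by simp [F, hb]⟩
    obtain ⟨e, rfl⟩ := orb_surjective γ' o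
    have hagree : ∀ x, γ'.SameCycle e x → γ x = γ' x := by
      intro x hx
      have h1 : x ≠ a := by rintro rfl; exact ha (orb_eq_iff.2 hx)
      have h2 : x ≠ b := by rintro rfl; exact hb (orb_eq_iff.2 hx)
      rw [hγ', Equiv.Perm.mul_apply, Equiv.swap_apply_of_ne_of_ne h1 h2]
    refine ⟨some (orb γ e), ?_⟩
    have h1 : orb γ e ≠ orb γ b := fun h =>
      hb (orb_eq_iff.2 (sameCycle_of_eqOn hagree (orb_eq_iff.1 h)))
    simp only [F, Option.elim_some, if_neg h1]
    refine (orb_eq_iff.2 (sameCycle_of_eqOn hagree (orb_eq_iff.1 ?_))).symm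
    rw [orb_out]
  calc Fintype.card (Orb γ') ≤ Fintype.card (Option (Orb γ)) := Fintype.card_le_of_surjective F hF
    _ = _ := Fintype.card_option

theorem sign_eq_of_sameCycle {γ : Equiv.Perm E} (hE : 1 < Fintype.card E)
    (h : ∀ e f, γ.SameCycle e f) : Equiv.Perm.sign γ = -(-1) ^ Fintype.card E := by
  have hne : ∀ e, γ e ≠ e := by
    intro e he
    obtain ⟨f, hf⟩ := Fintype.exists_ne_of_one_lt_card hE e
    exact hf ((Equiv.Perm.SameCycle.eq_of_left (h e f) he).symm)
  have hc : γ.IsCycle := by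
    have : Nonempty E := Fintype.card_pos_iff.1 (by omega)
    obtain ⟨e⟩ := this
    exact ⟨e, hne e, fun y _ => h e y⟩
  have hsupp : γ.support = Finset.univ := by
    ext e; simp [hne e]
  rw [hc.sign, hsupp, Finset.card_univ]

/-- The sign of a single cycle through all elements depends only on their number, whereas a
transposition reverses the sign. -/
theorem not_sameCycle_mul_swap {γ : Equiv.Perm E} (h : ∀ e f, γ.SameCycle e f) {a b : E}
    (hab : a ≠ b) : ¬ ∀ e f, (γ * Equiv.swap a b).SameCycle e f := by
  intro h'
  have hE : 1 < Fintype.card E := Fintype.one_lt_card_iff.2 ⟨a, b, hab⟩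
  have h1 := sign_eq_of_sameCycle hE h
  have h2 := sign_eq_of_sameCycle hE h'
  rw [Equiv.Perm.sign_mul, h1, Equiv.Perm.sign_swap hab] at h2
  rcases neg_one_pow_eq_or ℤˣ (Fintype.card E) with h3 | h3 <;> rw [h3] at h2 <;> simp at h2

/-- Gluing one edge of a cycle to an edge of another cycle merges the two cycles. -/
theorem sameCycle_mul_swap {σ : E → Bool} {φ : Equiv.Perm E} (hs : ∀ e, σ (φ e) = σ e)
    (ht : ∀ e f, σ e = σ f → φ.SameCycle e f) {a b : E} (hab : σ b = !σ a) (e f : E) :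
    (φ * Equiv.swap a b).SameCycle e f := by
  let h : E → ℤ := fun x => if (φ * Equiv.swap a b).SameCycle e x then 1 else 0
  have hinv : ∀ x, h (φ (Equiv.swap a b x)) = h x := by
    intro x
    have : (φ * Equiv.swap a b).SameCycle e (φ (Equiv.swap a b x)) ↔
        (φ * Equiv.swap a b).SameCycle e x :=
      ⟨fun hx => hx.trans (sameCycle_apply_self _ _).symm,
        fun hx => hx.trans (sameCycle_apply_self _ _)⟩
    simp only [h, this]
  have hne : b ≠ a := by rintro rfl; simp at hab
  -- `φ` permutes the side of `a`, and on it the invariance of `h` under `φ` is in doubt only at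
  -- `a`. Comparing the two sums gives `h (φ a) = h a`; as the swap gives `h (φ a) = h b`, the
  -- indicator takes the same value at `a` and `b`.
  have hsum : ∑ x with σ x = σ a, h (φ x) = ∑ x with σ x = σ a, h x := by
    refine Finset.sum_bij (fun x _ => φ x) ?_ (fun _ _ _ _ hxy => φ.injective hxy) ?_
      fun _ _ => rfl
    · intro x hx
      simpa [hs] using hx
    · intro x hx
      refine ⟨φ.symm x, ?_, by simp⟩
      have := hs (φ.symm x)
      rw [Equiv.apply_symm_apply] at this
      simpa [← this] using hx
  have hother : ∀ x, x ≠ a → x ≠ b → h (φ x) = h x := by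
    intro x h1 h2
    have := hinv x
    rwa [Equiv.swap_apply_of_ne_of_ne h1 h2] at this
  have ha : a ∈ Finset.univ.filter fun x => σ x = σ a := by simp
  have hfa : h (φ a) = h b := by simpa using hinv b
  have hfb : h (φ b) = h a := by simpa using hinv a
  rw [← Finset.add_sum_erase _ _ ha, ← Finset.add_sum_erase _ _ ha] at hsum
  have hrest : ∑ x ∈ (Finset.univ.filter fun x => σ x = σ a).erase a, h (φ x) =
      ∑ x ∈ (Finset.univ.filter fun x => σ x = σ a).erase a, h x := by
    refine Finset.sum_congr rfl fun x hx => ?_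
    rw [Finset.mem_erase, Finset.mem_filter] at hx
    refine hother x hx.1 ?_
    rintro rfl
    rw [hab] at hx
    simp at hx
  have hab' : h a = h b := by
    rw [hrest, hfa] at hsum
    exact (add_right_cancel hsum).symm
  have hφ : ∀ x, h (φ x) = h x := by
    intro x
    by_cases h1 : x = a
    · rw [h1, hfa, hab']
    by_cases h2 : x = b
    · rw [h2, hfb, hab']
    exact hother x h1 h2
  have hconst : ∀ x, h x = h a := by
    intro x
    by_cases hx : σ x = σ a
    · exact eq_of_sameCycle hφ (ht _ _ hx)
    · rw [hab']
      refine eq_of_sameCycle hφ (ht _ _ ?_)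
      rw [hab]
      exact Bool.eq_not.2 hx
  have h1 : h e = 1 := if_pos (Equiv.Perm.SameCycle.refl _ _)
  have h2 : h f = 1 := by rw [hconst, ← hconst e, h1]
  by_contra h3
  simp [h, h3] at h2

variable {τ σ : E → Bool} {φ g : Equiv.Perm E}

theorem numPairs_eq_zero_iff (hg : IsGluing τ g) : numPairs g = 0 ↔ g = 1 := by
  have h := two_mul_numPairs hg
  constructor
  · intro h0
    rw [h0, mul_zero] at h
    have h1 := Finset.card_eq_zero.1 h.symm
    ext e
    by_contra he
    have : e ∈ Finset.univ.filter fun e => g e ≠ e := by simpa using he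
    rw [h1] at this
    simp at this
  · rintro rfl
    simp [numPairs]

theorem IsCrossGluing.numPairs_mul_swap_self (hg : IsCrossGluing τ σ g) {a : E} (ha : g a ≠ a) :
    numPairs g = numPairs (g * Equiv.swap a (g a)) + 1 := by
  have h1 := two_mul_numPairs hg.toIsGluing
  have h2 := two_mul_numPairs (hg.mul_swap_self a).toIsGluing
  have h3 : (Finset.univ.filter fun e => g e ≠ e) =
      insert a (insert (g a) (Finset.univ.filter fun e => (g * Equiv.swap a (g a)) e ≠ e)) := by
    ext e
    simp only [Finset.mem_filter, Finset.mem_univ, true_and, Finset.mem_insert,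
      hg.mul_swap_self_apply a e]
    by_cases h : e = a ∨ e = g a
    · rw [if_pos h]
      rcases h with rfl | rfl
      · simpa using ha
      · simpa [hg.invol] using ha.symm
    · rw [if_neg h]
      tauto
  rw [h3, Finset.card_insert_of_notMem, Finset.card_insert_of_notMem] at h1
  · omega
  · simp [hg.mul_swap_self_apply]
  · simp only [Finset.mem_insert, not_or]
    exact ⟨ha.symm, by simp [hg.mul_swap_self_apply]⟩

theorem one_le_numPairs (hg : g ∈ crossGluings τ σ) : 1 ≤ numPairs g := by
  rw [mem_crossGluings] at hg
  rw [Nat.one_le_iff_ne_zero, Ne, numPairs_eq_zero_iff hg.1.toIsGluing]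
  exact hg.2

theorem exists_apply_ne (hg : g ≠ 1) : ∃ a, g a ≠ a := by
  by_contra! h
  exact hg (Equiv.ext h)

theorem IsCrossGluing.eq_swap (hg : IsCrossGluing τ σ g) {a : E} (ha : g a ≠ a)
    (hk : numPairs g = 1) : g = Equiv.swap a (g a) := by
  have h1 := hg.numPairs_mul_swap_self ha
  have h2 := (numPairs_eq_zero_iff (hg.mul_swap_self a).toIsGluing).1 (by omega)
  rw [mul_eq_one_iff_eq_inv, Equiv.swap_inv] at h2
  exact h2

theorem sameCycle_of_numPairs_eq_one (hs : ∀ e, σ (φ e) = σ e)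
    (ht : ∀ e f, σ e = σ f → φ.SameCycle e f) (hg : IsCrossGluing τ σ g)
    (hk : numPairs g = 1) (e f : E) : (φ * g).SameCycle e f := by
  have hg1 : g ≠ 1 := by
    rw [Ne, ← numPairs_eq_zero_iff hg.toIsGluing]
    omega
  obtain ⟨a, ha⟩ := exists_apply_ne hg1
  rw [hg.eq_swap ha hk]
  exact sameCycle_mul_swap hs ht (hg.side a ha) e f

/-- The first pair merges the two circles into one cycle, and each further pair creates at most one
more. -/
theorem card_orb_le_numPairs (hs : ∀ e, σ (φ e) = σ e)
    (ht : ∀ e f, σ e = σ f → φ.SameCycle e f) (hg : IsCrossGluing τ σ g) (hg1 : g ≠ 1) :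
    Fintype.card (Orb (φ * g)) ≤ numPairs g := by
  obtain ⟨k, hk⟩ : ∃ k, numPairs g = k + 1 :=
    Nat.exists_eq_succ_of_ne_zero (by rwa [Ne, numPairs_eq_zero_iff hg.toIsGluing])
  induction k generalizing g with
  | zero =>
    rw [hk, Fintype.card_le_one_iff]
    intro o o'
    obtain ⟨e, rfl⟩ := orb_surjective _ o
    obtain ⟨f, rfl⟩ := orb_surjective _ o'
    exact orb_eq_iff.2 (sameCycle_of_numPairs_eq_one hs ht hg hk e f)
  | succ k ih =>
    obtain ⟨a, ha⟩ := exists_apply_ne hg1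
    have h1 := hg.numPairs_mul_swap_self ha
    have h2 : g * Equiv.swap a (g a) ≠ 1 := by
      rw [Ne, ← numPairs_eq_zero_iff (hg.mul_swap_self a).toIsGluing]
      omega
    have h3 := ih (hg.mul_swap_self a) h2 (by omega)
    have h4 : φ * g = φ * (g * Equiv.swap a (g a)) * Equiv.swap a (g a) := by
      rw [mul_assoc, mul_assoc, Equiv.swap_mul_self, mul_one]
    have h5 := card_orb_mul_swap_le (φ * (g * Equiv.swap a (g a))) a (g a)
    rw [← h4] at h5
    omega

/-- Two is the general upper bound. Dissolving one pair leaves a single cycle, so parity excludes a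
single cycle for the full gluing. -/
theorem card_orb_eq_two (hs : ∀ e, σ (φ e) = σ e)
    (ht : ∀ e f, σ e = σ f → φ.SameCycle e f) (hg : IsCrossGluing τ σ g) (hk : numPairs g = 2) :
    Fintype.card (Orb (φ * g)) = 2 := by
  have hg1 : g ≠ 1 := by
    rw [Ne, ← numPairs_eq_zero_iff hg.toIsGluing]
    omega
  refine le_antisymm (hk ▸ card_orb_le_numPairs hs ht hg hg1) ?_
  by_contra! h
  obtain ⟨a, ha⟩ := exists_apply_ne hg1
  have h1 := hg.numPairs_mul_swap_self ha
  have h2 := sameCycle_of_numPairs_eq_one hs ht (hg.mul_swap_self a) (by omega)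
  refine not_sameCycle_mul_swap h2 ha.symm fun e f => ?_
  rw [mul_assoc, mul_assoc, Equiv.swap_mul_self, mul_one, ← orb_eq_iff]
  exact Fintype.card_le_one_iff.1 (by omega) _ _

end Cycles

end Stacking

namespace Stacking

/-! ### Counting gluings of two circles -/

section Counting

open scoped Classical

variable {E : Type*} {τ σ : E → Bool} {φ g : Equiv.Perm E}

theorem side_turn (hs : ∀ e, σ (φ e) = σ e) (hg : IsCrossGluing τ σ g) {e : E} (he : g e ≠ e) :
    σ ((φ * g) e) = !σ e := by
  rw [Equiv.Perm.mul_apply, hs, hg.side e he]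

/-- This is the permutation `g` for which `φ * g` exchanges `u` and `v`. The four edges involved are
distinct by their types, by their sides or by injectivity of `φ`. -/
theorem glueAt_apply {u v : E} (hφ : ∀ e, τ (φ e) = !τ e)
    (hs : ∀ e, σ (φ e) = σ e) (hus : σ u = false) (hvs : σ v = true) (x : E) :
    (Equiv.swap u (φ.symm v) * Equiv.swap v (φ.symm u)) x =
      if x = u then φ.symm v else if x = v then φ.symm u else if x = φ.symm v then u else
        if x = φ.symm u then v else x := by
  have hφ' : ∀ e, τ (φ.symm e) = !τ e := fun e => by
    rw [← Bool.not_not (τ (φ.symm e)), ← hφ, Equiv.apply_symm_apply]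
  have hs' : ∀ e, σ (φ.symm e) = σ e := fun e => by
    rw [← hs, Equiv.apply_symm_apply]
  have key : ∀ {e f : E}, (τ e ≠ τ f ∨ σ e ≠ σ f) → e ≠ f := by
    rintro e f h rfl; simp at h
  have n1 : u ≠ v := key (by simp [hus, hvs])
  have n2 : u ≠ φ.symm v := key (by simp [hus, hvs, hs'])
  have n3 : u ≠ φ.symm u := key (by simp [hφ'])
  have n4 : v ≠ φ.symm v := key (by simp [hφ'])
  have n5 : v ≠ φ.symm u := key (by simp [hus, hvs, hs'])
  have n6 : φ.symm v ≠ φ.symm u := fun h => n1 (φ.symm.injective h).symm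
  rw [Equiv.Perm.mul_apply]
  split_ifs with h1 h2 h3 h4
  · rw [h1, Equiv.swap_apply_of_ne_of_ne n1 n3, Equiv.swap_apply_left]
  · rw [h2, Equiv.swap_apply_left, Equiv.swap_apply_of_ne_of_ne n3.symm n6.symm]
  · rw [h3, Equiv.swap_apply_of_ne_of_ne n4.symm n6, Equiv.swap_apply_right]
  · rw [h4, Equiv.swap_apply_right, Equiv.swap_apply_of_ne_of_ne n1.symm n4]
  · rw [Equiv.swap_apply_of_ne_of_ne h2 h4, Equiv.swap_apply_of_ne_of_ne h1 h3]

variable [Fintype E]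

theorem mem_free {b : Bool} (hφ : ∀ e, τ (φ e) = !τ e) (hg : IsGluing τ g) {o : Orb (φ * g)}
    (h0 : orbWeight φ g o = 0) (hb : τ o.out = b) {e : E} (he : orb (φ * g) e = o) :
    g e ≠ e ∧ τ e = b :=
  ⟨orbWeight_eq_zero_iff.1 h0 e he, by rw [type_eq_of_orbWeight_eq_zero hφ hg h0 he, hb]⟩

/-- A cycle without free edges changes the circle at every step, so it contains identified edges of
its type on both sides; there are `numPairs g` identified edges of each type. -/
theorem two_mul_numFree_le (hφ : ∀ e, τ (φ e) = !τ e) (hs : ∀ e, σ (φ e) = σ e)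
    (hg : IsCrossGluing τ σ g) (b : Bool) : 2 * numFree τ φ g b ≤ numPairs g := by
  rw [← card_type_eq hg.toIsGluing b, numFree, mul_comm]
  have h2 : (2 : ℕ) = (Finset.univ : Finset Bool).card := by simp
  rw [h2, ← Finset.card_product]
  have hmem : ∀ o : Orb (φ * g), orbWeight φ g o = 0 → τ o.out = b → ∀ s : Bool,
      orb (φ * g) (bif s then (φ * g) o.out else o.out) = o := by
    intro o _ _ s
    cases s
    · exact orb_out o
    · exact (orb_apply _ _).trans (orb_out o)
  refine Finset.card_le_card_of_injOn (fun t => bif t.2 then (φ * g) t.1.out else t.1.out) ?_ ?_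
  · rintro ⟨o, s⟩ ho
    simp only [Finset.coe_product, Set.mem_prod, Finset.mem_coe, Finset.mem_filter,
      Finset.mem_univ, true_and, and_true] at ho
    simp only [Finset.coe_filter, Finset.mem_univ, true_and]
    exact mem_free hφ hg.toIsGluing ho.1 ho.2 (hmem o ho.1 ho.2 s)
  · rintro ⟨o, s⟩ ho ⟨o', s'⟩ ho' h
    simp only [Finset.coe_product, Set.mem_prod, Finset.mem_coe, Finset.mem_filter,
      Finset.mem_univ, true_and, and_true] at ho ho'
    simp only at h
    have h1 : o = o' := by
      rw [← hmem o ho.1 ho.2 s, ← hmem o' ho'.1 ho'.2 s', h]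
    subst h1
    have h3 := side_turn hs hg (orbWeight_eq_zero_iff.1 ho.1 _ (orb_out o))
    cases s <;> cases s' <;> simp only [cond_true, cond_false] at h
    · rfl
    · rw [← h] at h3; simp at h3
    · rw [h] at h3; simp at h3
    · rfl

theorem numFree_add_numFree_add_card :
    numFree τ φ g false + numFree τ φ g true +
      (Finset.univ.filter fun o : Orb (φ * g) => orbWeight φ g o ≠ 0).card =
      Fintype.card (Orb (φ * g)) := by
  have h1 := Finset.card_filter_add_card_filter_not
    (s := Finset.univ.filter fun o : Orb (φ * g) => orbWeight φ g o = 0)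
    (fun o => τ o.out = false)
  have h2 := Finset.card_filter_add_card_filter_not (s := (Finset.univ : Finset (Orb (φ * g))))
    (fun o => orbWeight φ g o = 0)
  rw [Finset.card_univ] at h2
  rw [Finset.filter_filter, Finset.filter_filter] at h1
  simp only [Bool.not_eq_false] at h1
  have h3 : (Finset.univ.filter fun o : Orb (φ * g) => orbWeight φ g o ≠ 0).card =
      (Finset.univ.filter fun o : Orb (φ * g) => ¬ orbWeight φ g o = 0).card := by congr!
  rw [numFree, numFree, h3]
  omega

/-- The pairs of a gluing with one pair of identified edges. -/
theorem card_numPairs_eq_one :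
    ((crossGluings τ σ).filter fun g => numPairs g = 1).card =
      (Finset.univ.filter fun x : E × E =>
        σ x.1 = false ∧ σ x.2 = true ∧ τ x.2 = !τ x.1).card := by
  symm
  refine Finset.card_bij (fun x _ => Equiv.swap x.1 x.2) ?_ ?_ ?_
  · rintro ⟨a, b⟩ h
    simp only [Finset.mem_filter, Finset.mem_univ, true_and] at h
    obtain ⟨ha, hb, hab⟩ := h
    have hne : a ≠ b := by rintro rfl; simp [ha] at hb
    have hsw : ∀ e, Equiv.swap a b e ≠ e → e = a ∨ e = b := by
      intro e he
      by_contra! hn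
      exact he (Equiv.swap_apply_of_ne_of_ne hn.1 hn.2)
    have hg : IsCrossGluing τ σ (Equiv.swap a b) := by
      refine ⟨⟨fun e => by simp, ?_⟩, ?_⟩
      · intro e he
        rcases hsw e he with rfl | rfl
        · rw [Equiv.swap_apply_left, hab]
        · rw [Equiv.swap_apply_right, hab, Bool.not_not]
      · intro e he
        rcases hsw e he with rfl | rfl
        · rw [Equiv.swap_apply_left, ha, hb]; rfl
        · rw [Equiv.swap_apply_right, ha, hb]; rfl
    have ha' : Equiv.swap a b a ≠ a := by rw [Equiv.swap_apply_left]; exact hne.symm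
    refine Finset.mem_filter.2 ⟨mem_crossGluings.2 ⟨hg, fun h => ?_⟩, ?_⟩
    · rw [h] at ha'; exact ha' rfl
    · have h1 := hg.numPairs_mul_swap_self ha'
      rw [Equiv.swap_apply_left, Equiv.swap_mul_self,
        (numPairs_eq_zero_iff (τ := τ) ⟨fun _ => rfl, fun e he => absurd rfl he⟩).2 rfl] at h1
      exact h1
  · rintro ⟨a, b⟩ h ⟨a', b'⟩ h' heq
    simp only [Finset.mem_filter, Finset.mem_univ, true_and] at h h' heq
    have hne' : a' ≠ b' := by rintro rfl; simp [h'.1] at h'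
    have h1 : a' = a := by
      by_contra hn
      have h2 : a' ≠ b := by rintro rfl; rw [h'.1] at h; simp at h
      have h3 := Equiv.swap_apply_of_ne_of_ne hn h2
      rw [heq, Equiv.swap_apply_left] at h3
      exact hne' h3.symm
    subst h1
    have h3 : Equiv.swap a' b a' = Equiv.swap a' b' a' := by rw [heq]
    rw [Equiv.swap_apply_left, Equiv.swap_apply_left] at h3
    rw [h3]
  · intro g hg
    rw [Finset.mem_filter, mem_crossGluings] at hg
    obtain ⟨a, ha⟩ := exists_apply_ne hg.1.2
    have hsw := hg.1.1.eq_swap ha hg.2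
    have h1 := hg.1.1.side a ha
    have h2 := hg.1.1.type a ha
    cases hσ : σ a
    · exact ⟨(a, g a), by simp [hσ, h1, h2], hsw.symm⟩
    · exact ⟨(g a, a), by simp [hσ, h1, h2], by rw [Equiv.swap_comm]; exact hsw.symm⟩

/-- Two pairs leave only two identified edges of type `b`, and a free cycle of that type uses both,
say `u` on the first side and `v` on the second. Conversely, `u` and `v` determine the gluing by `g
u = φ.symm v` and `g v = φ.symm u`. -/
theorem card_numFree_eq_one (hφ : ∀ e, τ (φ e) = !τ e) (hs : ∀ e, σ (φ e) = σ e) (b : Bool) :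
    ((crossGluings τ σ).filter fun g => numPairs g = 2 ∧ numFree τ φ g b = 1).card =
      (Finset.univ.filter fun e => τ e = b ∧ σ e = false).card *
      (Finset.univ.filter fun e => τ e = b ∧ σ e = true).card := by
  have hφ' : ∀ e, τ (φ.symm e) = !τ e := fun e => by
    rw [← Bool.not_not (τ (φ.symm e)), ← hφ, Equiv.apply_symm_apply]
  have hs' : ∀ e, σ (φ.symm e) = σ e := fun e => by
    rw [← hs, Equiv.apply_symm_apply]
  rw [← Finset.card_product]
  symm
  refine Finset.card_bij (fun x _ => Equiv.swap x.1 (φ.symm x.2) * Equiv.swap x.2 (φ.symm x.1))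
    ?_ ?_ ?_
  · rintro ⟨u, v⟩ h
    simp only [Finset.mem_product, Finset.mem_filter, Finset.mem_univ, true_and] at h
    obtain ⟨⟨hu, hus⟩, hv, hvs⟩ := h
    have happ := glueAt_apply hφ hs hus hvs
    have n1 : u ≠ v := by rintro rfl; simp [hus] at hvs
    simp only at happ ⊢
    set g := Equiv.swap u (φ.symm v) * Equiv.swap v (φ.symm u) with hgdef
    have gu : g u = φ.symm v := by rw [happ, if_pos rfl]
    have gv : g v = φ.symm u := by rw [happ, if_neg n1.symm, if_pos rfl]
    have ne_of_type : ∀ {e f : E}, τ e = b → τ f = !b → e ≠ f := by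
      rintro e f h1 h2 rfl; rw [h1] at h2; simp at h2
    have tu' : τ (φ.symm u) = !b := by rw [hφ', hu]
    have tv' : τ (φ.symm v) = !b := by rw [hφ', hv]
    have gv' : g (φ.symm v) = u := by
      rw [happ, if_neg (ne_of_type hu tv').symm, if_neg (ne_of_type hv tv').symm, if_pos rfl]
    have gu' : g (φ.symm u) = v := by
      rw [happ, if_neg (ne_of_type hu tu').symm, if_neg (ne_of_type hv tu').symm, if_neg, if_pos rfl]
      intro h; exact n1 (φ.symm.injective h)
    have hcases : ∀ e, g e ≠ e → e = u ∨ e = v ∨ e = φ.symm u ∨ e = φ.symm v := by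
      intro e he
      by_contra! hn
      exact he (by rw [happ, if_neg hn.1, if_neg hn.2.1, if_neg hn.2.2.2, if_neg hn.2.2.1])
    have hg : IsCrossGluing τ σ g := by
      refine ⟨⟨fun e => ?_, fun e he => ?_⟩, fun e he => ?_⟩
      · by_cases he : g e = e
        · rw [he, he]
        · rcases hcases e he with rfl | rfl | rfl | rfl
          · rw [gu, gv']
          · rw [gv, gu']
          · rw [gu', gv]
          · rw [gv', gu]
      · rcases hcases e he with rfl | rfl | rfl | rfl
        · rw [gu, tv', hu]
        · rw [gv, tu', hv]
        · rw [gu', tu', hv, Bool.not_not]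
        · rw [gv', tv', hu, Bool.not_not]
      · rcases hcases e he with rfl | rfl | rfl | rfl
        · rw [gu, hs', hus, hvs]; rfl
        · rw [gv, hs', hus, hvs]; rfl
        · rw [gu', hs', hus, hvs]; rfl
        · rw [gv', hs', hus, hvs]; rfl
    have hgu : g u ≠ u := by rw [gu]; exact (ne_of_type hu tv').symm
    have hgv : g v ≠ v := by rw [gv]; exact (ne_of_type hv tu').symm
    have hk : numPairs g = 2 := by
      rw [← card_type_eq hg.toIsGluing b, ← Finset.card_pair n1]
      congr 1
      ext e
      simp only [Finset.mem_filter, Finset.mem_univ, true_and, Finset.mem_insert,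
        Finset.mem_singleton]
      constructor
      · rintro ⟨h1, h2⟩
        rcases hcases e h1 with rfl | rfl | rfl | rfl
        · exact Or.inl rfl
        · exact Or.inr rfl
        · exact absurd rfl (ne_of_type h2 tu')
        · exact absurd rfl (ne_of_type h2 tv')
      · rintro (rfl | rfl)
        · exact ⟨hgu, hu⟩
        · exact ⟨hgv, hv⟩
    refine Finset.mem_filter.2 ⟨mem_crossGluings.2 ⟨hg, fun h => ?_⟩, hk, ?_⟩
    · rw [h] at hgu; exact hgu rfl
    · have hle := two_mul_numFree_le hφ hs hg b
      have hpos : 0 < numFree τ φ g b := by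
        have hinv : ∀ e, ((φ * g) e = u ∨ (φ * g) e = v) = (e = u ∨ e = v) := by
          intro e
          have h1 : (φ * g) u = v := by rw [Equiv.Perm.mul_apply, gu, Equiv.apply_symm_apply]
          have h2 : (φ * g) v = u := by rw [Equiv.Perm.mul_apply, gv, Equiv.apply_symm_apply]
          apply propext
          constructor
          · rintro (h | h)
            · exact Or.inr ((φ * g).injective (h.trans h2.symm))
            · exact Or.inl ((φ * g).injective (h.trans h1.symm))
          · rintro (rfl | rfl)
            · exact Or.inr h1
            · exact Or.inl h2
        have horb : ∀ e, orb (φ * g) e = orb (φ * g) u → e = u ∨ e = v := by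
          intro e he
          have := eq_of_sameCycle (h := fun e => e = u ∨ e = v) hinv (orb_eq_iff.1 he)
          exact this.mpr (Or.inl rfl)
        refine Finset.card_pos.2 ⟨orb (φ * g) u, Finset.mem_filter.2 ⟨Finset.mem_univ _, ?_, ?_⟩⟩
        · rw [orbWeight_eq_zero_iff]
          intro e he
          rcases horb e he with rfl | rfl
          · exact hgu
          · exact hgv
        · rcases horb _ (orb_out _) with h | h <;> rw [h] <;> assumption
      omega
  · rintro ⟨u, v⟩ h ⟨u₁, v₁⟩ h₁ heq
    simp only [Finset.mem_product, Finset.mem_filter, Finset.mem_univ, true_and] at h h₁ heq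
    obtain ⟨⟨hu, hus⟩, hv, hvs⟩ := h
    obtain ⟨⟨hu₁, hus₁⟩, hv₁, hvs₁⟩ := h₁
    have happ := glueAt_apply hφ hs hus hvs
    have happ₁ := glueAt_apply hφ hs hus₁ hvs₁
    rw [heq] at happ
    have e1 : u₁ = u := by
      by_contra hn
      have h2 := (happ u₁).symm.trans (happ₁ u₁)
      rw [if_neg hn, if_neg, if_neg, if_neg, if_pos rfl] at h2
      · have := congrArg σ h2
        rw [hs', hus₁, hvs₁] at this; simp at this
      · intro h; have := congrArg τ h; rw [hφ', hu, hu₁] at this; simp at this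
      · intro h; have := congrArg τ h; rw [hφ', hv, hu₁] at this; simp at this
      · intro h; have := congrArg σ h; rw [hus₁, hvs] at this; simp at this
    subst e1
    have h2 := (happ u₁).symm.trans (happ₁ u₁)
    rw [if_pos rfl, if_pos rfl] at h2
    rw [φ.symm.injective h2]
  · intro g hg
    rw [Finset.mem_filter, mem_crossGluings] at hg
    obtain ⟨⟨hg, -⟩, hk, hf⟩ := hg
    have hpos : 0 < numFree τ φ g b := by omega
    obtain ⟨o, ho⟩ := Finset.card_pos.1 hpos
    simp only [Finset.mem_filter, Finset.mem_univ, true_and] at ho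
    have hfree : ∀ e, orb (φ * g) e = o → g e ≠ e ∧ τ e = b := fun e he =>
      mem_free hφ hg.toIsGluing ho.1 ho.2 he
    have hcard := card_type_eq hg.toIsGluing b
    rw [hk] at hcard
    have h1 : orb (φ * g) o.out = o := orb_out o
    have h2 : orb (φ * g) ((φ * g) o.out) = o := by rw [orb_apply, h1]
    have h3 : orb (φ * g) ((φ * g) ((φ * g) o.out)) = o := by rw [orb_apply, h2]
    have s1 := side_turn hs hg (hfree _ h1).1
    have s2 := side_turn hs hg (hfree _ h2).1
    have hne : o.out ≠ (φ * g) o.out := by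
      intro h; rw [← h] at s1; simp at s1
    have hS : Finset.univ.filter (fun e => g e ≠ e ∧ τ e = b) = {o.out, (φ * g) o.out} := by
      symm
      refine Finset.eq_of_subset_of_card_le ?_ (by rw [hcard, Finset.card_pair hne])
      intro e he
      simp only [Finset.mem_insert, Finset.mem_singleton] at he
      rcases he with rfl | rfl
      · exact Finset.mem_filter.2 ⟨Finset.mem_univ _, hfree _ h1⟩
      · exact Finset.mem_filter.2 ⟨Finset.mem_univ _, hfree _ h2⟩
    have hback : (φ * g) ((φ * g) o.out) = o.out := by
      have hm : (φ * g) ((φ * g) o.out) ∈ ({o.out, (φ * g) o.out} : Finset E) := by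
        rw [← hS]; exact Finset.mem_filter.2 ⟨Finset.mem_univ _, hfree _ h3⟩
      simp only [Finset.mem_insert, Finset.mem_singleton] at hm
      rcases hm with h | h
      · exact h
      · rw [h] at s2; simp at s2
    -- The two edges of the free cycle are named according to their sides, as the representative
    -- `o.out` may lie on either.
    obtain ⟨u, v, hu, hv, hus, hvs, huv, hvu, hS⟩ : ∃ u v, τ u = b ∧ τ v = b ∧ σ u = false ∧
        σ v = true ∧ φ (g u) = v ∧ φ (g v) = u ∧ ∀ e, g e ≠ e → τ e = b → e = u ∨ e = v := by
      have hS' : ∀ e, g e ≠ e → τ e = b → e = o.out ∨ e = (φ * g) o.out := by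
        intro e h4 h5
        have : e ∈ ({o.out, (φ * g) o.out} : Finset E) := by
          rw [← hS]; exact Finset.mem_filter.2 ⟨Finset.mem_univ _, h4, h5⟩
        simpa using this
      cases hσ : σ o.out
      · exact ⟨o.out, (φ * g) o.out, (hfree _ h1).2, (hfree _ h2).2, hσ, by rw [s1, hσ]; rfl, rfl,
          hback, hS'⟩
      · exact ⟨(φ * g) o.out, o.out, (hfree _ h2).2, (hfree _ h1).2, by rw [s1, hσ]; rfl, hσ,
          hback, rfl, fun e h4 h5 => (hS' e h4 h5).symm⟩
    have gu : g u = φ.symm v := by rw [← huv, Equiv.symm_apply_apply]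
    have gv : g v = φ.symm u := by rw [← hvu, Equiv.symm_apply_apply]
    refine ⟨(u, v), by simp [hu, hv, hus, hvs], ?_⟩
    ext x
    rw [glueAt_apply hφ hs hus hvs]
    split_ifs with h4 h5 h6 h7
    · rw [h4, gu]
    · rw [h5, gv]
    · rw [h6, ← gu, hg.invol]
    · rw [h7, ← gv, hg.invol]
    · by_contra hx
      have hx' : g x ≠ x := fun h => hx h.symm
      by_cases ht : τ x = b
      · rcases hS x hx' ht with h | h
        · exact h4 h
        · exact h5 h
      -- An identified edge of the other type is the partner of one of type `b`, that is, of `u` or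
      -- `v`.
      · have h8 : τ (g x) = b := by
          rw [hg.type x hx']
          cases b <;> simpa using ht
        rcases hS (g x) (fun h => hx' (g.injective h)) h8 with h | h
        · exact h6 (by rw [← gu, ← h, hg.invol])
        · exact h7 (by rw [← gv, ← h, hg.invol])

end Counting

end Stacking

namespace Stacking

/-! ### Exchanging the two types of edges -/

section Conjugation

open scoped Classical

variable {E : Type*} {τ σ : E → Bool} {φ g : Equiv.Perm E}

/-- `φ * (φ * g * φ⁻¹)` is the conjugate of `φ * g` by `φ`, so `φ` carries the cycles of one to
those of the other. -/
theorem orb_conj_iff (e f : E) :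
    orb (φ * (φ * g * φ⁻¹)) (φ e) = orb (φ * (φ * g * φ⁻¹)) (φ f) ↔ orb (φ * g) e = orb (φ * g) f := by
  have h : φ * (φ * g * φ⁻¹) = φ * (φ * g) * φ⁻¹ := by group
  rw [orb_eq_iff, orb_eq_iff, h, Equiv.Perm.sameCycle_conj]
  simp

theorem exists_orb_conj_eq (o : Orb (φ * (φ * g * φ⁻¹))) :
    ∃ e, orb (φ * (φ * g * φ⁻¹)) (φ e) = o := by
  obtain ⟨e, rfl⟩ := orb_surjective _ o
  exact ⟨φ.symm e, by simp⟩

theorem IsCrossGluing.conj (hφ : ∀ e, τ (φ e) = !τ e) (hs : ∀ e, σ (φ e) = σ e)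
    (hg : IsCrossGluing τ σ g) : IsCrossGluing τ σ (φ * g * φ⁻¹) := by
  have h : ∀ e, (φ * g * φ⁻¹) (φ e) = φ (g e) := fun e => by simp
  have hne : ∀ e, φ (g e) ≠ φ e → g e ≠ e := fun e he hge => he (by rw [hge])
  refine ⟨⟨fun e => ?_, fun e => ?_⟩, fun e => ?_⟩ <;> obtain ⟨e, rfl⟩ := φ.surjective e
  · rw [h, h, hg.invol]
  · rw [h]
    intro he
    rw [hφ, hφ, hg.type e (hne e he)]
  · rw [h]
    intro he
    rw [hs, hs, hg.side e (hne e he)]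

variable [Fintype E]

/-- The product of the factors of the cycles that contain an unidentified edge. -/
noncomputable def blockProd {R : Type*} [CommMonoid R] (φ g : Equiv.Perm E) (θ : ℕ → R) : R :=
  ∏ o : Orb (φ * g) with orbWeight φ g o ≠ 0, θ (orbWeight φ g o / 2)

theorem glueWeight_eq_blockProd {R : Type*} [CommMonoid R] (τ : E → Bool) (φ g : Equiv.Perm E)
    (x y : R) (θ : ℕ → R) : glueWeight τ φ g x y θ =
      x ^ numFree τ φ g false * y ^ numFree τ φ g true * blockProd φ g θ :=
  glueWeight_eq τ φ g x y θ

theorem orbWeight_conj (e : E) :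
    orbWeight φ (φ * g * φ⁻¹) (orb _ (φ e)) = orbWeight φ g (orb _ e) := by
  symm
  refine Finset.card_bij (fun f _ => φ f) ?_ (fun _ _ _ _ h => φ.injective h) ?_
  · intro f hf
    simp only [Finset.mem_filter, Finset.mem_univ, true_and] at hf ⊢
    exact ⟨(orb_conj_iff f e).2 hf.1, by simp [hf.2]⟩
  · intro f hf
    simp only [Finset.mem_filter, Finset.mem_univ, true_and] at hf
    refine ⟨φ.symm f, ?_, by simp⟩
    simp only [Finset.mem_filter, Finset.mem_univ, true_and]
    refine ⟨(orb_conj_iff _ _).1 (by simpa using hf.1), ?_⟩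
    have := hf.2
    rw [Equiv.Perm.mul_apply, Equiv.Perm.mul_apply] at this
    exact φ.injective (by simpa using this)

theorem conj_mem_crossGluings (hφ : ∀ e, τ (φ e) = !τ e) (hs : ∀ e, σ (φ e) = σ e)
    (hg : g ∈ crossGluings τ σ) : φ * g * φ⁻¹ ∈ crossGluings τ σ := by
  rw [mem_crossGluings] at hg ⊢
  refine ⟨hg.1.conj hφ hs, fun h => hg.2 ?_⟩
  rwa [conj_eq_one_iff] at h

theorem numPairs_conj : numPairs (φ * g * φ⁻¹) = numPairs g := by
  rw [numPairs, numPairs]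
  congr 1
  symm
  refine Finset.card_bij (fun f _ => φ f) ?_ (fun _ _ _ _ h => φ.injective h) ?_
  · intro f hf
    simp only [Finset.mem_filter, Finset.mem_univ, true_and] at hf ⊢
    simpa using hf
  · intro f hf
    refine ⟨φ.symm f, ?_, by simp⟩
    simp only [Finset.mem_filter, Finset.mem_univ, true_and] at hf ⊢
    intro h
    apply hf
    rw [Equiv.Perm.mul_apply, Equiv.Perm.mul_apply]
    change φ (g (φ.symm f)) = f
    rw [h, Equiv.apply_symm_apply]

/-- `φ` carries free cycles to free cycles but flips the type of their edges. -/
theorem numFree_conj (hφ : ∀ e, τ (φ e) = !τ e) (hs : ∀ e, σ (φ e) = σ e)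
    (hg : IsCrossGluing τ σ g) (b : Bool) :
    numFree τ φ (φ * g * φ⁻¹) b = numFree τ φ g (!b) := by
  have hg' := hg.conj hφ hs
  symm
  refine Finset.card_bij (fun o _ => orb _ (φ o.out)) ?_ ?_ ?_
  · intro o ho
    simp only [Finset.mem_filter, Finset.mem_univ, true_and] at ho ⊢
    have h0 : orbWeight φ (φ * g * φ⁻¹) (orb _ (φ o.out)) = 0 := by
      rw [orbWeight_conj, orb_out, ho.1]
    refine ⟨h0, ?_⟩
    rw [← type_eq_of_orbWeight_eq_zero hφ hg'.toIsGluing h0 rfl, hφ, ho.2, Bool.not_not]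
  · intro o _ o' _ h
    rw [← orb_out o, ← orb_out o']
    exact (orb_conj_iff _ _).1 h
  · intro o ho
    obtain ⟨e, rfl⟩ := exists_orb_conj_eq o
    simp only [Finset.mem_filter, Finset.mem_univ, true_and] at ho
    have h1 : orb (φ * (φ * g * φ⁻¹)) (φ (orb (φ * g) e).out) =
        orb (φ * (φ * g * φ⁻¹)) (φ e) := by
      rw [orb_conj_iff, orb_out]
    refine ⟨orb _ e, ?_, h1⟩
    simp only [Finset.mem_filter, Finset.mem_univ, true_and]
    refine ⟨by rw [← orbWeight_conj, ho.1], ?_⟩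
    have h2 := type_eq_of_orbWeight_eq_zero hφ hg'.toIsGluing ho.1 h1
    rw [hφ, ho.2] at h2
    rw [← h2, Bool.not_not]

theorem blockProd_conj {R : Type*} [CommMonoid R] (θ : ℕ → R) :
    blockProd φ (φ * g * φ⁻¹) θ = blockProd φ g θ := by
  symm
  refine Finset.prod_bij (fun o _ => orb _ (φ o.out)) ?_ ?_ ?_ ?_
  · intro o ho
    simp only [Finset.mem_filter, Finset.mem_univ, true_and] at ho ⊢
    rwa [orbWeight_conj, orb_out]
  · intro o _ o' _ h
    rw [← orb_out o, ← orb_out o']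
    exact (orb_conj_iff _ _).1 h
  · intro o ho
    obtain ⟨e, rfl⟩ := exists_orb_conj_eq o
    simp only [Finset.mem_filter, Finset.mem_univ, true_and] at ho
    refine ⟨orb _ e, ?_, ?_⟩
    · simp only [Finset.mem_filter, Finset.mem_univ, true_and]
      rwa [← orbWeight_conj]
    · rw [orb_conj_iff, orb_out]
  · intro o _
    rw [orbWeight_conj, orb_out]

/-- Sums over the gluings do not change if the roles of the two types of edges are exchanged. -/
theorem sum_crossGluings_comm {R M : Type*} [CommMonoid R] [AddCommMonoid M]
    (hφ : ∀ e, τ (φ e) = !τ e) (hs : ∀ e, σ (φ e) = σ e) (θ : ℕ → R) (F : ℕ → ℕ → ℕ → R → M) :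
    ∑ g ∈ crossGluings τ σ,
      F (numFree τ φ g false) (numFree τ φ g true) (numPairs g) (blockProd φ g θ) =
    ∑ g ∈ crossGluings τ σ,
      F (numFree τ φ g true) (numFree τ φ g false) (numPairs g) (blockProd φ g θ) := by
  symm
  refine Finset.sum_bij (fun g _ => φ * g * φ⁻¹) (fun g hg => conj_mem_crossGluings hφ hs hg)
    (fun g _ g' _ h => by simpa using h) ?_ ?_
  · intro g hg
    rw [mem_crossGluings] at hg
    -- Conjugation is an injective map of the finite set of gluings to itself, hence surjective.
    have hinj : Function.Injective
        (fun g : {g // g ∈ crossGluings τ σ} =>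
          (⟨φ * g.1 * φ⁻¹, conj_mem_crossGluings hφ hs g.2⟩ : {g // g ∈ crossGluings τ σ})) := by
      intro a b h
      have := congrArg Subtype.val h
      simp only [mul_left_inj, mul_right_inj] at this
      exact Subtype.ext this
    obtain ⟨a, ha⟩ := Finite.surjective_of_injective hinj ⟨g, mem_crossGluings.2 hg⟩
    exact ⟨a.1, a.2, congrArg Subtype.val ha⟩
  · intro g hg
    have hg' := (mem_crossGluings.1 hg).1
    rw [numFree_conj hφ hs hg', numFree_conj hφ hs hg', numPairs_conj, blockProd_conj]
    rfl

end Conjugation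

/-! ### Examples of gluings of two circles -/

section TwoCircles

open scoped Classical

variable {p : ℕ}

theorem side_nextTwo (e : TwoCircleEdge p) : side (nextTwo p e) = side e := by
  rcases e with (e | e) | (e | e) <;> rfl

theorem isRight_nextTwo (e : TwoCircleEdge p) : (nextTwo p e).isRight = !e.isRight :=
  isRight_nextEdge _ e

theorem sameCycle_nextTwo {e f : TwoCircleEdge p} (h : side e = side f) :
    (nextTwo p).SameCycle e f := by
  have key : ∀ (s : Fin p → Fin p ⊕ Fin p)
      (_ : ∀ i, Equiv.sumCongr (finRotate p) (finRotate p) (s i) = s (finRotate p i))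
      (e f : Fin p ⊕ Fin p), (nextTwo p).SameCycle (Sum.map s s e) (Sum.map s s f) := by
    intro s hs e f
    have h1 : ∀ x, orb (nextTwo p) (Sum.map s s (nextEdge (finRotate p) x)) =
        orb (nextTwo p) (Sum.map s s x) := by
      intro x
      have : Sum.map s s (nextEdge (finRotate p) x) = nextTwo p (Sum.map s s x) := by
        rcases x with x | x
        · rfl
        · simp [hs]
      rw [this]
      exact orb_apply _ _
    exact orb_eq_iff.1 (eq_of_sameCycle (h := fun x => orb (nextTwo p) (Sum.map s s x)) h1
      (sameCycle_nextEdge e f))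
  rcases e with (e | e) | (e | e) <;> rcases f with (f | f) | (f | f) <;>
    simp only [side, Sum.elim_inl, Sum.elim_inr, Sum.isRight_inl, Sum.isRight_inr,
      Bool.false_eq_true, Bool.true_eq_false] at h
  · exact key Sum.inl (fun _ => rfl) (Sum.inl e) (Sum.inl f)
  · exact key Sum.inl (fun _ => rfl) (Sum.inl e) (Sum.inr f)
  · exact key Sum.inr (fun _ => rfl) (Sum.inl e) (Sum.inl f)
  · exact key Sum.inr (fun _ => rfl) (Sum.inl e) (Sum.inr f)
  · exact key Sum.inl (fun _ => rfl) (Sum.inr e) (Sum.inl f)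
  · exact key Sum.inl (fun _ => rfl) (Sum.inr e) (Sum.inr f)
  · exact key Sum.inr (fun _ => rfl) (Sum.inr e) (Sum.inl f)
  · exact key Sum.inr (fun _ => rfl) (Sum.inr e) (Sum.inr f)

theorem card_type_side (b s : Bool) :
    (Finset.univ.filter fun e : TwoCircleEdge p => e.isRight = b ∧ side e = s).card = p := by
  rw [Finset.card_filter]
  simp only [Fintype.sum_sum_type, side, Sum.elim_inl, Sum.elim_inr, Sum.isRight_inl,
    Sum.isRight_inr]
  cases b <;> cases s <;> simp

theorem card_varGluings_one :
    ((varGluings p).filter fun g => numPairs g = 1).card = 2 * p ^ 2 := by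
  rw [card_numPairs_eq_one, Finset.card_filter]
  simp only [Fintype.sum_prod_type, Fintype.sum_sum_type, side, Sum.elim_inl, Sum.elim_inr,
    Sum.isRight_inl, Sum.isRight_inr]
  simp
  ring

theorem card_varGluings_two (b : Bool) :
    ((varGluings p).filter fun g =>
      numPairs g = 2 ∧ numFree Sum.isRight (nextTwo p) g b = 1).card = p ^ 2 := by
  rw [card_numFree_eq_one isRight_nextTwo side_nextTwo, card_type_side, card_type_side, sq]

/-- The gluing of the two circles that identifies every edge of the first circle with an edge of the
second circle. -/
def fullGluing (p : ℕ) : Equiv.Perm (TwoCircleEdge p) :=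
  (Equiv.sumComm _ _).trans (Equiv.sumCongr (Equiv.sumComm _ _) (Equiv.sumComm _ _))

theorem fullGluing_ne (e : TwoCircleEdge p) : fullGluing p e ≠ e := by
  rcases e with (e | e) | (e | e) <;> simp [fullGluing]

theorem isCrossGluing_fullGluing : IsCrossGluing Sum.isRight side (fullGluing p) := by
  refine ⟨⟨?_, ?_⟩, ?_⟩ <;> rintro ((e | e) | (e | e)) <;> simp [fullGluing, side]

theorem fullGluing_mem (hp : 1 ≤ p) : fullGluing p ∈ varGluings p := by
  refine mem_crossGluings.2 ⟨isCrossGluing_fullGluing, fun h => ?_⟩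
  have := fullGluing_ne (p := p) (Sum.inl (Sum.inl ⟨0, hp⟩))
  rw [h] at this
  exact this rfl

theorem numPairs_fullGluing : numPairs (fullGluing p) = 2 * p := by
  rw [numPairs]
  simp only [ne_eq, fullGluing_ne, not_false_eq_true, Finset.filter_true, Finset.card_univ,
    Fintype.card_sum, Fintype.card_fin]
  omega

theorem orbWeight_fullGluing (o : Orb (nextTwo p * fullGluing p)) :
    orbWeight (nextTwo p) (fullGluing p) o = 0 :=
  orbWeight_eq_zero_iff.2 fun e _ => fullGluing_ne e

theorem blockProd_fullGluing {R : Type*} [CommMonoid R] (θ : ℕ → R) :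
    blockProd (nextTwo p) (fullGluing p) θ = 1 := by
  rw [blockProd]
  simp [orbWeight_fullGluing]

/-- The m-th even edges of the two circles form a free cycle; the invariant `f` reads off m and so
separates these cycles. -/
theorem le_numFree_fullGluing :
    p ≤ numFree Sum.isRight (nextTwo p) (fullGluing p) true := by
  have h : Fintype.card (Fin p) ≤ numFree Sum.isRight (nextTwo p) (fullGluing p) true := by
    rw [← Finset.card_univ]
    refine Finset.card_le_card_of_injOn (fun m => orb _ (Sum.inr (Sum.inl m))) ?_ ?_
    · intro m _
      simp only [Finset.coe_filter, Finset.mem_univ, true_and, Set.mem_ofPred_eq]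
      refine ⟨orbWeight_fullGluing _, ?_⟩
      rw [← type_eq_of_orbWeight_eq_zero isRight_nextTwo isCrossGluing_fullGluing.toIsGluing
        (orbWeight_fullGluing _) rfl]
      rfl
    · intro m _ m' _ h
      let f : TwoCircleEdge p → Option (Fin p) := Sum.elim (fun _ => none)
        (Sum.elim some some)
      have hf : ∀ x, f ((nextTwo p * fullGluing p) x) = f x := by
        rintro ((e | e) | (e | e)) <;> simp [f, fullGluing]
      exact Option.some_injective _ (eq_of_sameCycle hf (orb_eq_iff.1 h))
  rwa [Fintype.card_fin] at h

/-- A turn takes an odd edge to the next odd edge of the other circle. The two cycles through the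
odd edges of index m thus form an unordered pair that does not depend on m. -/
theorem numFree_fullGluing_le (hp : 1 ≤ p) :
    numFree Sum.isRight (nextTwo p) (fullGluing p) false ≤ 2 := by
  have key : ∀ m : Fin p, ({orb (nextTwo p * fullGluing p) (Sum.inl (Sum.inl m)),
      orb _ (Sum.inl (Sum.inr m))} : Set (Orb (nextTwo p * fullGluing p))) =
      {orb _ (Sum.inl (Sum.inl ⟨0, hp⟩)), orb _ (Sum.inl (Sum.inr ⟨0, hp⟩))} := by
    intro m
    let f : Fin p ⊕ Fin p → Set (Orb (nextTwo p * fullGluing p)) := Sum.elim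
      (fun m => {orb _ (Sum.inl (Sum.inl m)), orb _ (Sum.inl (Sum.inr m))})
      (fun m => {orb _ (Sum.inl (Sum.inl m)), orb _ (Sum.inl (Sum.inr m))})
    have hf : ∀ x, f (nextEdge (finRotate p) x) = f x := by
      rintro (x | x)
      · rfl
      · have h1 : orb (nextTwo p * fullGluing p) (Sum.inl (Sum.inl (finRotate p x))) =
            orb _ (Sum.inl (Sum.inr x)) := orb_apply (nextTwo p * fullGluing p) (Sum.inl (Sum.inr x))
        have h2 : orb (nextTwo p * fullGluing p) (Sum.inl (Sum.inr (finRotate p x))) =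
            orb _ (Sum.inl (Sum.inl x)) := orb_apply (nextTwo p * fullGluing p) (Sum.inl (Sum.inl x))
        simp only [nextEdge_inr, f, Sum.elim_inl, Sum.elim_inr]
        rw [h1, h2, Set.pair_comm]
    exact eq_of_sameCycle hf (sameCycle_nextEdge (Sum.inl m) (Sum.inl ⟨0, hp⟩))
  refine (Finset.card_le_card (t := {orb _ (Sum.inl (Sum.inl ⟨0, hp⟩)),
    orb _ (Sum.inl (Sum.inr ⟨0, hp⟩))}) fun o ho => ?_).trans Finset.card_le_two
  simp only [Finset.mem_filter, Finset.mem_univ, true_and] at ho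
  have hm : ∃ m, o ∈ ({orb (nextTwo p * fullGluing p) (Sum.inl (Sum.inl m)),
      orb _ (Sum.inl (Sum.inr m))} : Set (Orb (nextTwo p * fullGluing p))) := by
    have h1 := orb_out o
    rcases h2 : o.out with (m | m) | m
    · exact ⟨m, Or.inl (by rw [← h1, h2])⟩
    · exact ⟨m, Or.inr (by rw [← h1, h2]; rfl)⟩
    · rw [h2] at ho; simp at ho
  obtain ⟨m, hm⟩ := hm
  rw [key] at hm
  simpa using hm

/-- The gluing that identifies the even edges `m ∈ S` of the first circle with the odd edges of the
second circle in the opposite order. -/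
def reverseGluing (S : Finset (Fin p)) : Equiv.Perm (TwoCircleEdge p) :=
  Function.Involutive.toPerm
    (Sum.elim
      (Sum.elim (fun m => Sum.inl (Sum.inl m))
        fun x => if x.rev ∈ S then Sum.inr (Sum.inl x.rev) else Sum.inl (Sum.inr x))
      (Sum.elim (fun m => if m ∈ S then Sum.inl (Sum.inr m.rev) else Sum.inr (Sum.inl m))
        fun x => Sum.inr (Sum.inr x)) : TwoCircleEdge p → TwoCircleEdge p)
    (by
      rintro ((e | e) | (e | e))
      · rfl
      · by_cases h : e.rev ∈ S <;> simp [h]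
      · by_cases h : e ∈ S <;> simp [h]
      · rfl)

variable (S : Finset (Fin p))

theorem reverseGluing_inl_inl (m : Fin p) :
    reverseGluing S (Sum.inl (Sum.inl m)) = Sum.inl (Sum.inl m) := rfl

theorem reverseGluing_inl_inr (x : Fin p) : reverseGluing S (Sum.inl (Sum.inr x)) =
    if x.rev ∈ S then Sum.inr (Sum.inl x.rev) else Sum.inl (Sum.inr x) := rfl

theorem reverseGluing_inr_inl (m : Fin p) : reverseGluing S (Sum.inr (Sum.inl m)) =
    if m ∈ S then Sum.inl (Sum.inr m.rev) else Sum.inr (Sum.inl m) := rfl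

theorem reverseGluing_inr_inr (x : Fin p) :
    reverseGluing S (Sum.inr (Sum.inr x)) = Sum.inr (Sum.inr x) := rfl

theorem isCrossGluing_reverseGluing : IsCrossGluing Sum.isRight side (reverseGluing S) := by
  refine ⟨⟨Function.Involutive.toPerm_involutive _, ?_⟩, ?_⟩ <;>
    rintro ((e | e) | (e | e)) <;>
    simp only [reverseGluing_inl_inl, reverseGluing_inr_inr, reverseGluing_inl_inr,
      reverseGluing_inr_inl] <;> (try split_ifs) <;> simp [side]

theorem numPairs_reverseGluing : numPairs (reverseGluing S) = S.card := by
  rw [← card_type_eq (isCrossGluing_reverseGluing S).toIsGluing true, Finset.card_filter]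
  simp only [Fintype.sum_sum_type, reverseGluing_inl_inl, reverseGluing_inr_inr,
    reverseGluing_inl_inr, reverseGluing_inr_inl]
  simp

/-- Here the type of an identified edge determines its side, but along a free cycle the type is
constant while the side alternates. -/
theorem numFree_reverseGluing (b : Bool) :
    numFree Sum.isRight (nextTwo p) (reverseGluing S) b = 0 := by
  rw [numFree, Finset.card_eq_zero, Finset.filter_eq_empty_iff]
  rintro o - ⟨h0, hb⟩
  have hg := isCrossGluing_reverseGluing S
  have hts : ∀ e : TwoCircleEdge p, reverseGluing S e ≠ e → side e = !e.isRight := by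
    rintro ((e | e) | (e | e)) he
    · exact absurd (reverseGluing_inl_inl S e) he
    · rfl
    · rfl
    · exact absurd (reverseGluing_inr_inr S e) he
  have h1 := mem_free isRight_nextTwo hg.toIsGluing h0 hb (orb_out o)
  have h2 := mem_free isRight_nextTwo hg.toIsGluing h0 hb
    ((orb_apply (nextTwo p * reverseGluing S) o.out).trans (orb_out o))
  have h3 := side_turn side_nextTwo hg h1.1
  rw [hts _ h1.1, hts _ h2.1, h1.2, h2.2] at h3
  simp at h3

theorem reverseGluing_mem (hS : S.Nonempty) : reverseGluing S ∈ varGluings p := by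
  refine mem_crossGluings.2 ⟨isCrossGluing_reverseGluing S, ?_⟩
  rw [Ne, ← numPairs_eq_zero_iff (isCrossGluing_reverseGluing S).toIsGluing,
    numPairs_reverseGluing]
  exact hS.card_ne_zero

theorem finRotate_rev (x : Fin p) : finRotate p (Fin.rev (finRotate p x)) = Fin.rev x := by
  cases p with
  | zero => exact x.elim0
  | succ m =>
    rcases Nat.lt_or_ge x.1 m with h | h
    · have h1 : finRotate (m + 1) x = ⟨x.1 + 1, by omega⟩ := finRotate_of_lt h
      rw [h1]
      have h2 : Fin.rev (⟨x.1 + 1, by omega⟩ : Fin (m + 1)) = ⟨m - (x.1 + 1), by omega⟩ := by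
        ext; simp [Fin.rev]
      rw [h2, finRotate_of_lt (by omega)]
      ext; simp [Fin.rev]; omega
    · have h1 : x = Fin.last m := Fin.ext (by simp; omega)
      rw [h1, finRotate_last]
      simp

/-- Reversal conjugates the rotation into its inverse (`finRotate_rev`), which makes `f` invariant;
it takes p distinct values on the even edges of the first circle. -/
theorem le_card_orb_reverseGluing :
    p ≤ Fintype.card (Orb (nextTwo p * reverseGluing (Finset.univ : Finset (Fin p)))) := by
  have h : Fintype.card (Fin p) ≤ _ := Fintype.card_le_of_injective
    (fun m : Fin p => orb (nextTwo p * reverseGluing (Finset.univ : Finset (Fin p)))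
      (Sum.inr (Sum.inl m))) (by
    intro m m' h
    let f : TwoCircleEdge p → Fin p := Sum.elim
      (Sum.elim (fun x => x) fun x => Fin.rev ((finRotate p).symm x))
      (Sum.elim (fun m => m) fun x => Fin.rev x)
    have hf : ∀ x, f ((nextTwo p * reverseGluing (Finset.univ : Finset (Fin p)) : Equiv.Perm _) x) = f x := by
      rintro ((e | e) | (e | e))
      · simp [f, reverseGluing_inl_inl]
      · have := finRotate_rev ((finRotate p).symm e)
        rw [Equiv.apply_symm_apply] at this
        simpa [f, reverseGluing_inl_inr] using this
      · simp [f, reverseGluing_inr_inl]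
      · change Fin.rev ((finRotate p).symm (finRotate p e)) = Fin.rev e
        rw [Equiv.symm_apply_apply]
    exact eq_of_sameCycle hf (orb_eq_iff.1 h))
  rwa [Fintype.card_fin] at h

end TwoCircles

end Stacking

namespace Stacking

/-! ### The terms of the variance -/

section Terms

open scoped Classical

variable {p : ℕ}

/-- The number of classes of odd vertices that do not border to an unidentified edge. -/
noncomputable def oddFree (g : Equiv.Perm (TwoCircleEdge p)) : ℕ :=
  numFree Sum.isRight (nextTwo p) g false

/-- The number of classes of even vertices that do not border to an unidentified edge. -/
noncomputable def evenFree (g : Equiv.Perm (TwoCircleEdge p)) : ℕ :=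
  numFree Sum.isRight (nextTwo p) g true

/-- The cycles that contain an unidentified edge. -/
noncomputable def blocks (g : Equiv.Perm (TwoCircleEdge p)) : Finset (Orb (nextTwo p * g)) :=
  Finset.univ.filter fun o => orbWeight (nextTwo p) g o ≠ 0

/-- Half the number of unidentified edges of a cycle. -/
noncomputable def halfSize (g : Equiv.Perm (TwoCircleEdge p)) (o : Orb (nextTwo p * g)) : ℕ :=
  orbWeight (nextTwo p) g o / 2

variable {g : Equiv.Perm (TwoCircleEdge p)}

theorem blockProd_eq {R : Type*} [CommMonoid R] (θ : ℕ → R) :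
    blockProd (nextTwo p) g θ = ∏ o ∈ blocks g, θ (halfSize g o) := rfl

theorem two_mul_oddFree_le (hg : g ∈ varGluings p) : 2 * oddFree g ≤ numPairs g :=
  two_mul_numFree_le isRight_nextTwo side_nextTwo (mem_crossGluings.1 hg).1 _

theorem two_mul_evenFree_le (hg : g ∈ varGluings p) : 2 * evenFree g ≤ numPairs g :=
  two_mul_numFree_le isRight_nextTwo side_nextTwo (mem_crossGluings.1 hg).1 _

theorem oddFree_add_evenFree_add_card : oddFree g + evenFree g + (blocks g).card =
    Fintype.card (Orb (nextTwo p * g)) :=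
  numFree_add_numFree_add_card

theorem oddFree_add_evenFree_add_card_le (hg : g ∈ varGluings p) :
    oddFree g + evenFree g + (blocks g).card ≤ numPairs g := by
  rw [oddFree_add_evenFree_add_card]
  exact card_orb_le_numPairs side_nextTwo (fun _ _ => sameCycle_nextTwo) (mem_crossGluings.1 hg).1
    (mem_crossGluings.1 hg).2

theorem sum_halfSize (hg : g ∈ varGluings p) :
    ∑ o ∈ blocks g, halfSize g o + numPairs g = 2 * p := by
  have h := sum_half_orbWeight isRight_nextTwo (mem_crossGluings.1 hg).1.toIsGluing
  simp only [Fintype.card_sum, Fintype.card_fin] at h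
  change 2 * (∑ o ∈ blocks g, halfSize g o + numPairs g) = _ at h
  omega

theorem one_le_halfSize (hg : g ∈ varGluings p) {o : Orb (nextTwo p * g)} (ho : o ∈ blocks g) :
    1 ≤ halfSize g o := by
  obtain ⟨l, hl⟩ := even_orbWeight isRight_nextTwo (mem_crossGluings.1 hg).1.toIsGluing o
  have := (Finset.mem_filter.1 ho).2
  rw [halfSize]
  omega

theorem card_blocks_add_le (hg : g ∈ varGluings p) : (blocks g).card + numPairs g ≤ 2 * p := by
  rw [← sum_halfSize hg, Finset.card_eq_sum_ones]
  gcongr with o ho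
  exact one_le_halfSize hg ho

/-- Every other block has half size at least one, which limits what is left for `o`. -/
theorem halfSize_add_le (hg : g ∈ varGluings p) {o : Orb (nextTwo p * g)} (ho : o ∈ blocks g) :
    halfSize g o + (blocks g).card + numPairs g ≤ 2 * p + 1 := by
  have h1 := sum_halfSize hg
  rw [← Finset.add_sum_erase _ _ ho] at h1
  have h2 : ((blocks g).erase o).card ≤ ∑ o ∈ (blocks g).erase o, halfSize g o := by
    rw [Finset.card_eq_sum_ones]
    exact Finset.sum_le_sum fun o' ho' => one_le_halfSize hg (Finset.mem_of_mem_erase ho')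
  have h3 := Finset.card_erase_add_one ho
  omega

theorem blockProd_of_card_eq_one {R : Type*} [CommMonoid R] (hg : g ∈ varGluings p)
    (h : (blocks g).card = 1) (θ : ℕ → R) :
    blockProd (nextTwo p) g θ = θ (2 * p - numPairs g) := by
  obtain ⟨o, ho⟩ := Finset.card_eq_one.1 h
  have h1 := sum_halfSize hg
  rw [ho, Finset.sum_singleton] at h1
  rw [blockProd_eq, ho, Finset.prod_singleton]
  congr 1
  omega

theorem numPairs_one (hg : g ∈ varGluings p) (hk : numPairs g = 1) :
    oddFree g = 0 ∧ evenFree g = 0 ∧ (blocks g).card = 1 := by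
  have h1 := two_mul_oddFree_le hg
  have h2 := two_mul_evenFree_le hg
  have h3 := oddFree_add_evenFree_add_card_le hg
  have h4 := sum_halfSize hg
  have h5 : (blocks g).card ≠ 0 := by
    intro h
    rw [Finset.card_eq_zero.1 h] at h4
    simp at h4
    omega
  omega

theorem numPairs_two (hg : g ∈ varGluings p) (hk : numPairs g = 2) :
    oddFree g ≤ 1 ∧ evenFree g ≤ 1 ∧ oddFree g + evenFree g + (blocks g).card = 2 := by
  have h1 := two_mul_oddFree_le hg
  have h2 := two_mul_evenFree_le hg
  refine ⟨by omega, by omega, ?_⟩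
  rw [oddFree_add_evenFree_add_card]
  exact card_orb_eq_two side_nextTwo (fun _ _ => sameCycle_nextTwo) (mem_crossGluings.1 hg).1 hk

theorem card_blocks_pos (hg : g ∈ varGluings p) (hk : numPairs g < 2 * p) :
    0 < (blocks g).card := by
  by_contra h
  have h4 := sum_halfSize hg
  rw [Finset.card_eq_zero.1 (Nat.eq_zero_of_not_pos h)] at h4
  simp at h4
  omega

theorem numPairs_two_oddFree (hp : 2 ≤ p) (hg : g ∈ varGluings p) (hk : numPairs g = 2)
    (hf : oddFree g = 1) : evenFree g = 0 ∧ (blocks g).card = 1 := by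
  have h1 := numPairs_two hg hk
  have h2 := card_blocks_pos hg (by omega)
  omega

theorem numPairs_two_evenFree (hp : 2 ≤ p) (hg : g ∈ varGluings p) (hk : numPairs g = 2)
    (hf : evenFree g = 1) : oddFree g = 0 ∧ (blocks g).card = 1 := by
  have h1 := numPairs_two hg hk
  have h2 := card_blocks_pos hg (by omega)
  omega

/-- The exponent of `L₁⁻¹` in the term of a gluing. -/
noncomputable def oddGap (g : Equiv.Perm (TwoCircleEdge p)) : ℕ := numPairs g - 1 - oddFree g

/-- The exponent of `L₂⁻¹` in the term of a gluing. -/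
noncomputable def evenGap (g : Equiv.Perm (TwoCircleEdge p)) : ℕ := numPairs g - 1 - evenFree g

theorem oddFree_add_oddGap (hg : g ∈ varGluings p) :
    oddFree g + oddGap g + 1 = numPairs g := by
  have h1 := two_mul_oddFree_le hg
  have h2 := one_le_numPairs hg
  rw [oddGap]
  omega

theorem evenFree_add_evenGap (hg : g ∈ varGluings p) :
    evenFree g + evenGap g + 1 = numPairs g := by
  have h1 := two_mul_evenFree_le hg
  have h2 := one_le_numPairs hg
  rw [evenGap]
  omega

/-- Zero gap means `oddFree g = numPairs g - 1`; together with `2 * oddFree g ≤ numPairs g` this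
leaves at most two pairs. -/
theorem oddGap_eq_zero_iff (hg : g ∈ varGluings p) :
    oddGap g = 0 ↔ numPairs g = 1 ∨ numPairs g = 2 ∧ oddFree g = 1 := by
  have h1 := two_mul_oddFree_le hg
  have h2 := oddFree_add_oddGap hg
  omega

theorem evenGap_eq_zero_iff (hg : g ∈ varGluings p) :
    evenGap g = 0 ↔ numPairs g = 1 ∨ numPairs g = 2 ∧ evenFree g = 1 := by
  have h1 := two_mul_evenFree_le hg
  have h2 := evenFree_add_evenGap hg
  omega

end Terms

/-! ### Nonnegative moments and the values of the leading terms. -/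

section Moments

open scoped ComplexOrder

variable {n N : ℕ}

theorem matMoment_nonneg (hn : 0 < n) (hN : 0 < N) (D : Matrix (Fin n) (Fin N) ℂ) (l : ℕ) :
    0 ≤ matMoment D l := by
  have : NeZero n := ⟨hn.ne'⟩
  have : NeZero N := ⟨hN.ne'⟩
  have h := trace_pow_eq_matMoment D l
  have h2 := ((Matrix.posSemidef_self_mul_conjTranspose D).pow l).trace_nonneg
  rw [h] at h2
  simp only [Fintype.card_fin] at h2
  have h3 : (0 : ℝ) ≤ (n : ℝ) * (N : ℝ) ^ l * matMoment D l := by exact_mod_cast h2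
  have h4 : (0 : ℝ) < (n : ℝ) * (N : ℝ) ^ l := by positivity
  exact nonneg_of_mul_nonneg_right h3 h4

/-- The second moment is a positive multiple of the squared Frobenius norm of `D * Dᴴ`. -/
theorem matMoment_two_pos (hn : 0 < n) (hN : 0 < N) {D : Matrix (Fin n) (Fin N) ℂ} (hD : D ≠ 0) :
    0 < matMoment D 2 := by
  have : NeZero n := ⟨hn.ne'⟩
  have : NeZero N := ⟨hN.ne'⟩
  refine lt_of_le_of_ne (matMoment_nonneg hn hN D 2) fun h0 => hD ?_
  have h := trace_pow_eq_matMoment D 2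
  rw [← h0, Complex.ofReal_zero, mul_zero] at h
  have h1 : (D * Dᴴ)ᴴ = D * Dᴴ := by
    rw [Matrix.conjTranspose_mul, Matrix.conjTranspose_conjTranspose]
  have h2 : (D * Dᴴ) ^ 2 = (D * Dᴴ) * (D * Dᴴ)ᴴ := by rw [h1, sq]
  rw [h2, Matrix.trace_mul_conjTranspose_self_eq_zero_iff] at h
  exact Matrix.self_mul_conjTranspose_eq_zero.1 h

/-- The factor of a block with `2 l` unidentified edges. -/
noncomputable def blockFactor (D : Matrix (Fin n) (Fin N) ℂ) (l : ℕ) : ℝ :=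
  (n : ℝ) * (N : ℝ) ^ l * matMoment D l

theorem blockFactor_nonneg (hn : 0 < n) (hN : 0 < N) (D : Matrix (Fin n) (Fin N) ℂ) (l : ℕ) :
    0 ≤ blockFactor D l :=
  mul_nonneg (by positivity) (matMoment_nonneg hn hN D l)

theorem varTerm_eq (p : ℕ) (D : Matrix (Fin n) (Fin N) ℂ) (g : Equiv.Perm (TwoCircleEdge p)) :
    varTerm p D g = (n : ℝ) ^ oddFree g * (N : ℝ) ^ evenFree g *
      blockProd (nextTwo p) g (blockFactor D) :=
  glueWeight_eq_blockProd _ _ _ _ _ _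

theorem blockProd_nonneg (hn : 0 < n) (hN : 0 < N) {p : ℕ} (D : Matrix (Fin n) (Fin N) ℂ)
    (g : Equiv.Perm (TwoCircleEdge p)) : 0 ≤ blockProd (nextTwo p) g (blockFactor D) :=
  Finset.prod_nonneg fun _ _ => blockFactor_nonneg hn hN D _

theorem varTerm_nonneg (hn : 0 < n) (hN : 0 < N) (p : ℕ) (D : Matrix (Fin n) (Fin N) ℂ)
    (g : Equiv.Perm (TwoCircleEdge p)) : 0 ≤ varTerm p D g := by
  rw [varTerm_eq]
  exact mul_nonneg (by positivity) (blockProd_nonneg hn hN D g)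

/-- No edge remains free, so the term is a monomial in n and N, positive even for D = 0. Strict
inequalities valid for every D rest on it. -/
theorem varTerm_fullGluing_pos (hn : 0 < n) (hN : 0 < N) (p : ℕ) (D : Matrix (Fin n) (Fin N) ℂ) :
    0 < varTerm p D (fullGluing p) := by
  rw [varTerm_eq, blockProd_fullGluing]
  positivity

theorem varTerm_numPairs_one {p : ℕ} (D : Matrix (Fin n) (Fin N) ℂ)
    {g : Equiv.Perm (TwoCircleEdge p)} (hg : g ∈ varGluings p) (hk : numPairs g = 1) :
    varTerm p D g = blockFactor D (2 * p - 1) := by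
  obtain ⟨h1, h2, h3⟩ := numPairs_one hg hk
  rw [varTerm_eq, h1, h2, blockProd_of_card_eq_one hg h3, hk]
  simp

theorem varTerm_oddFree_one {p : ℕ} (hp : 2 ≤ p) (D : Matrix (Fin n) (Fin N) ℂ)
    {g : Equiv.Perm (TwoCircleEdge p)} (hg : g ∈ varGluings p) (hk : numPairs g = 2)
    (hf : oddFree g = 1) : varTerm p D g = n * blockFactor D (2 * p - 2) := by
  obtain ⟨h2, h3⟩ := numPairs_two_oddFree hp hg hk hf
  rw [varTerm_eq, hf, h2, blockProd_of_card_eq_one hg h3, hk]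
  simp

theorem varTerm_evenFree_one {p : ℕ} (hp : 2 ≤ p) (D : Matrix (Fin n) (Fin N) ℂ)
    {g : Equiv.Perm (TwoCircleEdge p)} (hg : g ∈ varGluings p) (hk : numPairs g = 2)
    (hf : evenFree g = 1) : varTerm p D g = N * blockFactor D (2 * p - 2) := by
  obtain ⟨h2, h3⟩ := numPairs_two_evenFree hp hg hk hf
  rw [varTerm_eq, hf, h2, blockProd_of_card_eq_one hg h3, hk]
  simp

end Moments

end Stacking

namespace Stacking

/-! ### The polynomial of the lower order terms for averaging -/

section LowerTerms

open scoped Classical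

variable {p : ℕ}

/-- The gluings that contribute to the limit for averaging, but for no stacking. -/
noncomputable def lowerGluings (p : ℕ) : Finset (Equiv.Perm (TwoCircleEdge p)) :=
  (varGluings p).filter fun g => oddGap g ≠ 0 ∧ evenGap g ≠ 0

variable {g : Equiv.Perm (TwoCircleEdge p)}

theorem two_le_numPairs_of_lower (hg : g ∈ lowerGluings p) : 2 ≤ numPairs g := by
  rw [lowerGluings, Finset.mem_filter] at hg
  have h1 := one_le_numPairs hg.1
  have h2 := oddGap_eq_zero_iff hg.1
  by_contra h
  exact hg.2.1 (h2.2 (Or.inl (by omega)))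

/-- With at least three pairs the edges left are too few for a larger block. With exactly two pairs
the nonzero gaps exclude free cycles, so there are two blocks that share the remaining edges. -/
theorem halfSize_le_of_lower (hg : g ∈ lowerGluings p) {o : Orb (nextTwo p * g)}
    (ho : o ∈ blocks g) : halfSize g o + 3 ≤ 2 * p := by
  have h0 := two_le_numPairs_of_lower hg
  rw [lowerGluings, Finset.mem_filter] at hg
  have h1 := halfSize_add_le hg.1 ho
  have h2 := Finset.card_pos.2 ⟨o, ho⟩
  rcases h0.lt_or_eq with h | h
  · omega
  · have h3 := numPairs_two hg.1 h.symm
    have h4 := oddGap_eq_zero_iff hg.1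
    have h5 := evenGap_eq_zero_iff hg.1
    omega

theorem reverseGluing_mem_lower {S : Finset (Fin p)} (hS : 2 ≤ S.card) :
    reverseGluing S ∈ lowerGluings p := by
  have hm := reverseGluing_mem S (Finset.card_pos.1 (by omega))
  have h1 : oddFree (reverseGluing S) = 0 := numFree_reverseGluing S _
  have h2 : evenFree (reverseGluing S) = 0 := numFree_reverseGluing S _
  have h3 := numPairs_reverseGluing S
  refine Finset.mem_filter.2 ⟨hm, ?_⟩
  rw [Ne, Ne, oddGap_eq_zero_iff hm, evenGap_eq_zero_iff hm]
  omega

/-- The index of the variable that stands for the moment of order `l`. -/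
def momentIndex (hp : 2 ≤ p) (l : ℕ) : Fin (2 * p - 3) :=
  -- The reduction serves only to make the index total; it is void for 1 ≤ l ≤ 2p - 3, the only
  -- orders that occur in lower gluings.
  ⟨(l - 1) % (2 * p - 3), Nat.mod_lt _ (by omega)⟩

theorem momentIndex_val (hp : 2 ≤ p) {l : ℕ} (h1 : 1 ≤ l) (h2 : l + 3 ≤ 2 * p) :
    (momentIndex hp l : ℕ) + 1 = l := by
  rw [momentIndex]
  simp only
  rw [Nat.mod_eq_of_lt (by omega)]
  omega

/-- The exponents of the monomial of a gluing. -/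
noncomputable def gluingExponents (hp : 2 ≤ p) (g : Equiv.Perm (TwoCircleEdge p)) :
    Fin (2 * p - 3) →₀ ℕ :=
  ∑ o ∈ blocks g, Finsupp.single (momentIndex hp (halfSize g o)) 1

theorem weight_gluingExponents (hp : 2 ≤ p) (hg : g ∈ lowerGluings p) :
    Finsupp.weight (fun i : Fin (2 * p - 3) => (i : ℕ) + 1) (gluingExponents hp g) =
      2 * p - numPairs g := by
  have hg' := (Finset.mem_filter.1 hg).1
  have h1 := sum_halfSize hg'
  rw [gluingExponents, map_sum]
  have h2 : ∑ o ∈ blocks g, Finsupp.weight (fun i : Fin (2 * p - 3) => (i : ℕ) + 1)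
      (Finsupp.single (momentIndex hp (halfSize g o)) 1) = ∑ o ∈ blocks g, halfSize g o := by
    refine Finset.sum_congr rfl fun o ho => ?_
    rw [Finsupp.weight_single, one_smul, momentIndex_val hp (one_le_halfSize hg' ho)
      (halfSize_le_of_lower hg ho)]
  rw [h2]
  omega

theorem degree_gluingExponents (hp : 2 ≤ p) (g : Equiv.Perm (TwoCircleEdge p)) :
    ((gluingExponents hp g).sum fun _ e => e) = (blocks g).card := by
  change (gluingExponents hp g).degree = _
  rw [gluingExponents, map_sum]
  simp

/-- The coefficient of the monomial of a gluing. -/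
noncomputable def gluingCoeff (n N : ℕ) (g : Equiv.Perm (TwoCircleEdge p)) : ℝ :=
  (((n : ℝ) * (N : ℝ) ^ p) ^ 2)⁻¹ * ((n : ℝ) ^ oddFree g * (N : ℝ) ^ evenFree g *
    ∏ o ∈ blocks g, ((n : ℝ) * (N : ℝ) ^ halfSize g o))

theorem gluingCoeff_pos {n N : ℕ} (hn : 0 < n) (hN : 0 < N) (g : Equiv.Perm (TwoCircleEdge p)) :
    0 < gluingCoeff n N g := by
  have : 0 < ∏ o ∈ blocks g, ((n : ℝ) * (N : ℝ) ^ halfSize g o) :=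
    Finset.prod_pos fun _ _ => by positivity
  rw [gluingCoeff]
  positivity

/-- The polynomial in the moments that the lower order terms for averaging add up to. -/
noncomputable def lowerPoly (n N : ℕ) (hp : 2 ≤ p) : MvPolynomial (Fin (2 * p - 3)) ℝ :=
  ∑ g ∈ lowerGluings p, MvPolynomial.monomial (gluingExponents hp g) (gluingCoeff n N g)

theorem coeff_lowerPoly (n N : ℕ) (hp : 2 ≤ p) (m : Fin (2 * p - 3) →₀ ℕ) :
    (lowerPoly n N hp).coeff m =
      ∑ g ∈ lowerGluings p with gluingExponents hp g = m, gluingCoeff n N g := by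
  rw [lowerPoly, MvPolynomial.coeff_sum, Finset.sum_filter]
  simp_rw [MvPolynomial.coeff_monomial]

/-- The coefficients of the gluings are positive, so monomials of different gluings cannot cancel.
-/
theorem support_lowerPoly {n N : ℕ} (hn : 0 < n) (hN : 0 < N) (hp : 2 ≤ p) :
    (lowerPoly n N hp).support = (lowerGluings p).image (gluingExponents hp) := by
  ext m
  rw [MvPolynomial.mem_support_iff, coeff_lowerPoly, Finset.mem_image]
  constructor
  · intro h
    obtain ⟨g, hg, -⟩ := Finset.exists_ne_zero_of_sum_ne_zero h
    exact ⟨g, Finset.mem_filter.1 hg⟩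
  · rintro ⟨g, hg⟩
    exact (Finset.sum_pos (fun _ _ => gluingCoeff_pos hn hN _) ⟨g, Finset.mem_filter.2 hg⟩).ne'

theorem coeff_lowerPoly_pos {n N : ℕ} (hn : 0 < n) (hN : 0 < N) (hp : 2 ≤ p)
    {m : Fin (2 * p - 3) →₀ ℕ} (hm : m ∈ (lowerPoly n N hp).support) :
    0 < (lowerPoly n N hp).coeff m := by
  rw [support_lowerPoly hn hN, Finset.mem_image] at hm
  obtain ⟨g, hg⟩ := hm
  rw [coeff_lowerPoly]
  exact Finset.sum_pos (fun _ _ => gluingCoeff_pos hn hN _) ⟨g, Finset.mem_filter.2 hg⟩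

/-- A gluing with k pairs has a monomial of weight 2p - k, and lower gluings have k ≥ 2. The reverse
gluing of two edges attains k = 2. -/
theorem weightedTotalDegree_lowerPoly {n N : ℕ} (hn : 0 < n) (hN : 0 < N) (hp : 2 ≤ p) :
    (lowerPoly n N hp).weightedTotalDegree (fun i : Fin (2 * p - 3) => (i : ℕ) + 1) =
      2 * p - 2 := by
  rw [MvPolynomial.weightedTotalDegree, support_lowerPoly hn hN, Finset.sup_image]
  refine le_antisymm (Finset.sup_le fun g hg => ?_) ?_
  · have := two_le_numPairs_of_lower hg
    rw [Function.comp_apply, weight_gluingExponents hp hg]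
    omega
  · have hS : ({⟨0, by omega⟩, ⟨1, by omega⟩} : Finset (Fin p)).card = 2 :=
      Finset.card_pair (by simp)
    have hm := reverseGluing_mem_lower hS.ge
    refine le_trans ?_ (Finset.le_sup hm)
    rw [Function.comp_apply, weight_gluingExponents hp hm, numPairs_reverseGluing, hS]

/-- The degree is the number of blocks, which is at most k and at most 2p - k, hence at most p. The
reverse gluing of all p edges has no free cycle and at least p cycles. -/
theorem totalDegree_lowerPoly {n N : ℕ} (hn : 0 < n) (hN : 0 < N) (hp : 2 ≤ p) :
    (lowerPoly n N hp).totalDegree = p := by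
  rw [MvPolynomial.totalDegree, support_lowerPoly hn hN, Finset.sup_image]
  refine le_antisymm (Finset.sup_le fun g hg => ?_) ?_
  · have hg' := (Finset.mem_filter.1 hg).1
    have h1 := oddFree_add_evenFree_add_card_le hg'
    have h2 := card_blocks_add_le hg'
    rw [Function.comp_apply, degree_gluingExponents]
    omega
  · have hS : (Finset.univ : Finset (Fin p)).card = p := by simp
    have hm := reverseGluing_mem_lower (p := p) (S := Finset.univ) (by omega)
    refine le_trans ?_ (Finset.le_sup hm)
    rw [Function.comp_apply, degree_gluingExponents]
    have h1 : oddFree (reverseGluing (Finset.univ : Finset (Fin p))) = 0 :=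
      numFree_reverseGluing _ _
    have h2 : evenFree (reverseGluing (Finset.univ : Finset (Fin p))) = 0 :=
      numFree_reverseGluing _ _
    have h3 := oddFree_add_evenFree_add_card (g := reverseGluing (Finset.univ : Finset (Fin p)))
    have h4 := le_card_orb_reverseGluing (p := p)
    omega

theorem eval_lowerPoly {n N : ℕ} (hp : 2 ≤ p) (D : Matrix (Fin n) (Fin N) ℂ) :
    MvPolynomial.eval (fun i : Fin (2 * p - 3) => matMoment D ((i : ℕ) + 1)) (lowerPoly n N hp) =
      (((n : ℝ) * (N : ℝ) ^ p) ^ 2)⁻¹ * ∑ g ∈ lowerGluings p, varTerm p D g := by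
  rw [lowerPoly, map_sum, Finset.mul_sum]
  refine Finset.sum_congr rfl fun g hg => ?_
  have hg' := (Finset.mem_filter.1 hg).1
  rw [gluingExponents, MvPolynomial.monomial_sum_index, map_mul, map_prod, MvPolynomial.eval_C,
    varTerm_eq, blockProd_eq, gluingCoeff]
  simp only [blockFactor, Finset.prod_mul_distrib]
  have h1 : ∏ o ∈ blocks g, MvPolynomial.eval
      (fun i : Fin (2 * p - 3) => matMoment D ((i : ℕ) + 1))
      (MvPolynomial.monomial (Finsupp.single (momentIndex hp (halfSize g o)) 1) 1) =
      ∏ o ∈ blocks g, matMoment D (halfSize g o) := by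
    refine Finset.prod_congr rfl fun o ho => ?_
    rw [MvPolynomial.eval_monomial, Finsupp.prod_single_index (by simp), one_mul, pow_one,
      momentIndex_val hp (one_le_halfSize hg' ho) (halfSize_le_of_lower hg ho)]
  rw [h1]
  ring

end LowerTerms

end Stacking

namespace Stacking

/-! ### Limits and comparison of the variances -/

/-! ### Evaluating the terms that survive in the limits. -/

section Sums

open scoped Classical

variable {n N p : ℕ} (D : Matrix (Fin n) (Fin N) ℂ)

theorem sum_varTerm_numPairs_one :
    ∑ g ∈ varGluings p with numPairs g = 1, varTerm p D g =
      2 * p ^ 2 * blockFactor D (2 * p - 1) := by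
  have h : ∀ g ∈ (varGluings p).filter (fun g => numPairs g = 1),
      varTerm p D g = blockFactor D (2 * p - 1) := fun g hg =>
    varTerm_numPairs_one D (Finset.mem_filter.1 hg).1 (Finset.mem_filter.1 hg).2
  rw [Finset.sum_congr rfl h, Finset.sum_const, card_varGluings_one]
  simp

theorem sum_varTerm_oddFree (hp : 2 ≤ p) :
    ∑ g ∈ varGluings p with numPairs g = 2 ∧ oddFree g = 1, varTerm p D g =
      p ^ 2 * (n * blockFactor D (2 * p - 2)) := by
  have h : ∀ g ∈ (varGluings p).filter (fun g => numPairs g = 2 ∧ oddFree g = 1),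
      varTerm p D g = n * blockFactor D (2 * p - 2) := fun g hg =>
    varTerm_oddFree_one hp D (Finset.mem_filter.1 hg).1 (Finset.mem_filter.1 hg).2.1
      (Finset.mem_filter.1 hg).2.2
  rw [Finset.sum_congr rfl h, Finset.sum_const]
  have hc : ((varGluings p).filter fun g => numPairs g = 2 ∧ oddFree g = 1).card = p ^ 2 :=
    card_varGluings_two false
  rw [hc]
  simp

theorem sum_varTerm_evenFree (hp : 2 ≤ p) :
    ∑ g ∈ varGluings p with numPairs g = 2 ∧ evenFree g = 1, varTerm p D g =
      p ^ 2 * (N * blockFactor D (2 * p - 2)) := by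
  have h : ∀ g ∈ (varGluings p).filter (fun g => numPairs g = 2 ∧ evenFree g = 1),
      varTerm p D g = N * blockFactor D (2 * p - 2) := fun g hg =>
    varTerm_evenFree_one hp D (Finset.mem_filter.1 hg).1 (Finset.mem_filter.1 hg).2.1
      (Finset.mem_filter.1 hg).2.2
  rw [Finset.sum_congr rfl h, Finset.sum_const]
  have hc : ((varGluings p).filter fun g => numPairs g = 2 ∧ evenFree g = 1).card = p ^ 2 :=
    card_varGluings_two true
  rw [hc]
  simp

/-- For p ≥ 2, two pairs create two cycles of which at least one is a block, so they cannot provide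
a free class of each parity: both gaps vanish only for a single pair. -/
theorem sum_varTerm_gaps (hp : 2 ≤ p) :
    ∑ g ∈ varGluings p with oddGap g = 0 ∧ evenGap g = 0, varTerm p D g =
      2 * p ^ 2 * blockFactor D (2 * p - 1) := by
  rw [← sum_varTerm_numPairs_one]
  congr 1
  refine Finset.filter_congr fun g hg => ?_
  rw [oddGap_eq_zero_iff hg, evenGap_eq_zero_iff hg]
  constructor
  · rintro ⟨h | h, h' | h'⟩
    · exact h
    · exact h
    · exact h'
    · have := numPairs_two_oddFree hp hg h.1 h.2
      omega
  · exact fun h => ⟨Or.inl h, Or.inl h⟩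

theorem sum_varTerm_oddGap (hp : 2 ≤ p) :
    ∑ g ∈ varGluings p with oddGap g = 0, varTerm p D g =
      2 * p ^ 2 * blockFactor D (2 * p - 1) + p ^ 2 * (n * blockFactor D (2 * p - 2)) := by
  rw [← sum_varTerm_numPairs_one, ← sum_varTerm_oddFree D hp, ← Finset.sum_union, ← Finset.filter_or]
  · congr 1
    exact Finset.filter_congr fun g hg => oddGap_eq_zero_iff hg
  · refine Finset.disjoint_filter.2 fun g _ h h' => ?_
    omega

theorem sum_varTerm_evenGap (hp : 2 ≤ p) :
    ∑ g ∈ varGluings p with evenGap g = 0, varTerm p D g =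
      2 * p ^ 2 * blockFactor D (2 * p - 1) + p ^ 2 * (N * blockFactor D (2 * p - 2)) := by
  rw [← sum_varTerm_numPairs_one, ← sum_varTerm_evenFree D hp, ← Finset.sum_union,
    ← Finset.filter_or]
  · congr 1
    exact Finset.filter_congr fun g hg => evenGap_eq_zero_iff hg
  · refine Finset.disjoint_filter.2 fun g _ h h' => ?_
    omega

theorem sum_varTerm (hp : 2 ≤ p) :
    ∑ g ∈ varGluings p, varTerm p D g =
      2 * p ^ 2 * blockFactor D (2 * p - 1) + p ^ 2 * (n * blockFactor D (2 * p - 2)) +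
        p ^ 2 * (N * blockFactor D (2 * p - 2)) + ∑ g ∈ lowerGluings p, varTerm p D g := by
  rw [← Finset.sum_filter_add_sum_filter_not (varGluings p) (fun g => oddGap g = 0),
    sum_varTerm_oddGap D hp, add_assoc (2 * p ^ 2 * blockFactor D (2 * p - 1) + _)]
  congr 1
  rw [← Finset.sum_filter_add_sum_filter_not _ (fun g => evenGap g = 0), Finset.filter_filter,
    Finset.filter_filter, ← sum_varTerm_evenFree D hp]
  congr 2
  refine Finset.filter_congr fun g hg => ?_
  rw [oddGap_eq_zero_iff hg, evenGap_eq_zero_iff hg]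
  constructor
  · rintro ⟨h, h' | h'⟩
    · exact absurd (Or.inl h') h
    · exact h'
  · intro h
    have := numPairs_two_evenFree hp hg h.1 h.2
    exact ⟨by omega, Or.inr h⟩

/-- For p = 1, two pairs use up all edges, and the two cycles are one free odd and one free even
class. This is why all stackings and averaging agree for the first moment. -/
theorem gaps_eq_zero_of_eq_one {g : Equiv.Perm (TwoCircleEdge 1)} (hg : g ∈ varGluings 1) :
    oddGap g = 0 ∧ evenGap g = 0 := by
  have h1 := one_le_numPairs hg
  have h2 := card_blocks_add_le hg
  have h3 : numPairs g ≠ 1 → numPairs g = 2 := by omega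
  rw [oddGap_eq_zero_iff hg, evenGap_eq_zero_iff hg]
  by_cases h : numPairs g = 1
  · exact ⟨Or.inl h, Or.inl h⟩
  · have h4 := numPairs_two hg (h3 h)
    omega

theorem sum_varTerm_of_eq_one :
    ∑ g ∈ varGluings 1, varTerm 1 D g = 2 * blockFactor D 1 + n * N := by
  rw [← Finset.sum_filter_add_sum_filter_not (varGluings 1) (fun g => numPairs g = 1),
    sum_varTerm_numPairs_one]
  have h0 : (varGluings 1).filter (fun g => ¬ numPairs g = 1) =
      (varGluings 1).filter fun g => numPairs g = 2 ∧ oddFree g = 1 := by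
    refine Finset.filter_congr fun g hg => ?_
    have h1 := (oddGap_eq_zero_iff hg).1 (gaps_eq_zero_of_eq_one hg).1
    omega
  have h : ∀ g ∈ (varGluings 1).filter (fun g => numPairs g = 2 ∧ oddFree g = 1),
      varTerm 1 D g = n * N := by
    intro g hg
    rw [Finset.mem_filter] at hg
    have h1 := card_blocks_add_le hg.1
    have h2 := numPairs_two hg.1 hg.2.1
    have h3 : (blocks g).card = 0 := by omega
    have h4 : evenFree g = 1 := by omega
    rw [varTerm_eq, hg.2.2, h4, blockProd_eq, Finset.card_eq_zero.1 h3]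
    simp
  have hc : ((varGluings 1).filter fun g => numPairs g = 2 ∧ oddFree g = 1).card = 1 ^ 2 :=
    card_varGluings_two false
  rw [h0, Finset.sum_congr rfl h, Finset.sum_const, hc]
  simp

end Sums

/-! ### Limits of L times the variance. -/

section Limits

open scoped Classical

variable {n N p : ℕ} {Ω : Type*} [MeasurableSpace Ω] {μ : Measure Ω} [IsProbabilityMeasure μ]
  {D : Matrix (Fin n) (Fin N) ℂ} {Y : ℕ → Ω → Matrix (Fin n) (Fin N) ℂ}

/-- The factor L₁ L₂ cancels one of the powers in the denominator, and the free classes cancel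
others; the exponents left are the gaps. Every summand is therefore nonincreasing in L₁ and in L₂.
-/
theorem mul_stackVar_eq (hn : 0 < n) (hN : 0 < N) (hp : 1 ≤ p) (hY : IsAdditiveModel μ D Y)
    {L₁ L₂ : ℕ} (h₁ : 0 < L₁) (h₂ : 0 < L₂) (e : Fin L₁ × Fin L₂ ≃ Fin (L₁ * L₂)) :
    ((L₁ * L₂ : ℕ) : ℝ) * stackVar μ Y p e = (((n : ℝ) * (N : ℝ) ^ p) ^ 2)⁻¹ *
      ∑ g ∈ varGluings p, varTerm p D g *
        (((L₁ : ℝ) ^ oddGap g)⁻¹ * ((L₂ : ℝ) ^ evenGap g)⁻¹) := by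
  have a1 : (L₁ : ℝ) ≠ 0 := by exact_mod_cast h₁.ne'
  have a2 : (L₂ : ℝ) ≠ 0 := by exact_mod_cast h₂.ne'
  rw [stackVar_eq hn hN hp hY h₁ h₂ e, mul_left_comm, Finset.mul_sum]
  congr 1
  refine Finset.sum_congr rfl fun g hg => ?_
  have e1 := oddFree_add_oddGap hg
  have e2 := evenFree_add_evenGap hg
  change _ * (_ * ((L₁ : ℝ) ^ oddFree g * (L₂ : ℝ) ^ evenFree g / _)) = _
  have f1 : (L₁ : ℝ) ^ numPairs g = (L₁ : ℝ) ^ oddFree g * (L₁ : ℝ) ^ oddGap g * L₁ := by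
    rw [← e1, pow_add, pow_add, pow_one]
  have f2 : (L₂ : ℝ) ^ numPairs g = (L₂ : ℝ) ^ evenFree g * (L₂ : ℝ) ^ evenGap g * L₂ := by
    rw [← e2, pow_add, pow_add, pow_one]
  rw [mul_pow, f1, f2]
  push_cast
  field_simp

theorem mul_avgVar_eq (hn : 0 < n) (hN : 0 < N) (hp : 1 ≤ p) (hY : IsAdditiveModel μ D Y)
    {L : ℕ} (hL : 0 < L) : (L : ℝ) * avgVar μ Y p L = (((n : ℝ) * (N : ℝ) ^ p) ^ 2)⁻¹ *
      ∑ g ∈ varGluings p, varTerm p D g := by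
  have a1 : (L : ℝ) ≠ 0 := by exact_mod_cast hL.ne'
  rw [avgVar_eq hn hN hp hY hL, ← Finset.sum_mul]
  field_simp

theorem avgLimit (hn : 0 < n) (hN : 0 < N) (hp : 1 ≤ p) (hY : IsAdditiveModel μ D Y) :
    AvgLimit μ Y p ((((n : ℝ) * (N : ℝ) ^ p) ^ 2)⁻¹ * ∑ g ∈ varGluings p, varTerm p D g) := by
  refine tendsto_const_nhds.congr' ?_
  filter_upwards [eventually_gt_atTop 0] with L hL
  exact (mul_avgVar_eq hn hN hp hY hL).symm

theorem tendsto_inv_pow {α : Type*} {l : Filter α} {f : α → ℝ} (hf : Tendsto f l atTop) (a : ℕ) :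
    Tendsto (fun k => (f k ^ a)⁻¹) l (𝓝 (if a = 0 then 1 else 0)) := by
  split_ifs with h
  · subst h
    simpa using tendsto_const_nhds
  · exact tendsto_inv_atTop_zero.comp ((tendsto_pow_atTop h).comp hf)

theorem vertLimit (hn : 0 < n) (hN : 0 < N) (hp : 1 ≤ p) (hY : IsAdditiveModel μ D Y) :
    VertLimit μ Y p ((((n : ℝ) * (N : ℝ) ^ p) ^ 2)⁻¹ *
      ∑ g ∈ varGluings p with oddGap g = 0, varTerm p D g) := by
  intro e
  have h : Tendsto (fun L : ℕ => (((n : ℝ) * (N : ℝ) ^ p) ^ 2)⁻¹ *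
      ∑ g ∈ varGluings p, varTerm p D g * ((L : ℝ) ^ oddGap g)⁻¹) atTop
      (𝓝 ((((n : ℝ) * (N : ℝ) ^ p) ^ 2)⁻¹ *
        ∑ g ∈ varGluings p, varTerm p D g * if oddGap g = 0 then 1 else 0)) :=
    (tendsto_finsetSum _ fun g _ =>
      (tendsto_inv_pow tendsto_natCast_atTop_atTop _).const_mul _).const_mul _
  simp only [mul_ite, mul_one, mul_zero] at h
  rw [← Finset.sum_filter] at h
  refine h.congr' ?_
  filter_upwards [eventually_gt_atTop 0] with L hL
  have h1 := mul_stackVar_eq hn hN hp hY hL one_pos (e L)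
  rw [mul_one] at h1
  rw [h1]
  simp

theorem horizLimit (hn : 0 < n) (hN : 0 < N) (hp : 1 ≤ p) (hY : IsAdditiveModel μ D Y) :
    HorizLimit μ Y p ((((n : ℝ) * (N : ℝ) ^ p) ^ 2)⁻¹ *
      ∑ g ∈ varGluings p with evenGap g = 0, varTerm p D g) := by
  intro e
  have h : Tendsto (fun L : ℕ => (((n : ℝ) * (N : ℝ) ^ p) ^ 2)⁻¹ *
      ∑ g ∈ varGluings p, varTerm p D g * ((L : ℝ) ^ evenGap g)⁻¹) atTop
      (𝓝 ((((n : ℝ) * (N : ℝ) ^ p) ^ 2)⁻¹ *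
        ∑ g ∈ varGluings p, varTerm p D g * if evenGap g = 0 then 1 else 0)) :=
    (tendsto_finsetSum _ fun g _ =>
      (tendsto_inv_pow tendsto_natCast_atTop_atTop _).const_mul _).const_mul _
  simp only [mul_ite, mul_one, mul_zero] at h
  rw [← Finset.sum_filter] at h
  refine h.congr' ?_
  filter_upwards [eventually_gt_atTop 0] with L hL
  have h1 := mul_stackVar_eq hn hN hp hY one_pos hL (e L)
  have h2 : ((1 * L : ℕ) : ℝ) = L := by rw [one_mul]
  rw [h2] at h1
  rw [h1]
  simp

theorem tendsto_atTop_of_sq {α : Type*} {l : Filter α} {f : α → ℝ} (hf : ∀ k, 0 ≤ f k)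
    (h : Tendsto (fun k => f k ^ 2) l atTop) : Tendsto f l atTop := by
  rw [tendsto_atTop] at h ⊢
  intro b
  filter_upwards [h (b ^ 2)] with k hk
  exact (le_abs_self b).trans (abs_le_of_sq_le_sq hk (hf k))

/-- L₁² is the product of L₁ L₂, which tends to infinity, and L₁ / L₂, which has a positive limit;
L₂² is treated with the inverse ratio. -/
theorem IsRectangular.tendsto {L₁ L₂ : ℕ → ℕ} (h : IsRectangular L₁ L₂) :
    Tendsto (fun k => (L₁ k : ℝ)) atTop atTop ∧ Tendsto (fun k => (L₂ k : ℝ)) atTop atTop := by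
  obtain ⟨h1, c, hc, h2⟩ := h
  have h3 : Tendsto (fun k => ((L₁ k * L₂ k : ℕ) : ℝ)) atTop atTop :=
    tendsto_natCast_atTop_atTop.comp h1
  have h4 : ∀ᶠ k in atTop, 0 < L₁ k * L₂ k := h1.eventually_gt_atTop 0
  constructor
  · refine tendsto_atTop_of_sq (fun k => Nat.cast_nonneg _) ?_
    refine (h3.atTop_mul_pos hc h2).congr' ?_
    filter_upwards [h4] with k hk
    have : (L₂ k : ℝ) ≠ 0 := by exact_mod_cast (Nat.pos_of_mul_pos_left hk).ne'
    push_cast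
    field_simp
  · refine tendsto_atTop_of_sq (fun k => Nat.cast_nonneg _) ?_
    refine (h3.atTop_mul_pos (inv_pos.2 hc) (h2.inv₀ hc.ne')).congr' ?_
    filter_upwards [h4] with k hk
    have : (L₁ k : ℝ) ≠ 0 := by exact_mod_cast (Nat.pos_of_mul_pos_right hk).ne'
    push_cast
    field_simp

theorem rectLimit (hn : 0 < n) (hN : 0 < N) (hp : 1 ≤ p) (hY : IsAdditiveModel μ D Y) :
    RectLimit μ Y p ((((n : ℝ) * (N : ℝ) ^ p) ^ 2)⁻¹ *
      ∑ g ∈ varGluings p with oddGap g = 0 ∧ evenGap g = 0, varTerm p D g) := by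
  intro L₁ L₂ hL e
  obtain ⟨t1, t2⟩ := hL.tendsto
  have h : Tendsto (fun k : ℕ => (((n : ℝ) * (N : ℝ) ^ p) ^ 2)⁻¹ *
      ∑ g ∈ varGluings p, varTerm p D g *
        (((L₁ k : ℝ) ^ oddGap g)⁻¹ * ((L₂ k : ℝ) ^ evenGap g)⁻¹)) atTop
      (𝓝 ((((n : ℝ) * (N : ℝ) ^ p) ^ 2)⁻¹ * ∑ g ∈ varGluings p, varTerm p D g *
        ((if oddGap g = 0 then 1 else 0) * if evenGap g = 0 then 1 else 0))) :=
    (tendsto_finsetSum _ fun g _ =>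
      ((tendsto_inv_pow t1 _).mul (tendsto_inv_pow t2 _)).const_mul _).const_mul _
  have h2 : ∑ g ∈ varGluings p, varTerm p D g *
      ((if oddGap g = 0 then 1 else 0) * if evenGap g = 0 then 1 else 0) =
      ∑ g ∈ varGluings p with oddGap g = 0 ∧ evenGap g = 0, varTerm p D g := by
    rw [Finset.sum_filter]
    refine Finset.sum_congr rfl fun g _ => ?_
    by_cases h3 : oddGap g = 0 <;> by_cases h4 : evenGap g = 0 <;> simp [h3, h4]
  rw [h2] at h
  refine h.congr' ?_
  filter_upwards [hL.1.eventually_gt_atTop 0] with k hk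
  exact (mul_stackVar_eq hn hN hp hY (Nat.pos_of_mul_pos_right hk) (Nat.pos_of_mul_pos_left hk)
    (e k)).symm

end Limits

end Stacking

namespace Stacking

/-! ### Comparison of stackings -/

/-! ### Symmetric monomials at a fixed product. -/

section PowerSums

/-- At a fixed product the sums differ by `(u' - u) * (u' - v) / u'`. -/
theorem add_lt_add_of_mul_eq_mul {u v u' v' : ℝ} (hv : 0 < v) (hvu : v ≤ u) (hu : u < u')
    (h : u * v = u' * v') : u + v < u' + v' := by
  have hu' : 0 < u' := by linarith
  have h1 : v' = u * v / u' := by field_simp; linarith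
  have h2 : u' + v' - (u + v) = (u' - u) * (u' - v) / u' := by
    rw [h1]; field_simp; ring
  have h3 : 0 < (u' - u) * (u' - v) / u' :=
    div_pos (mul_pos (by linarith) (by linarith)) hu'
  linarith

/-- The symmetrization of the monomial `x ^ i * y ^ j`. -/
def symMonomial (x y : ℝ) (i j : ℕ) : ℝ := x ^ i * y ^ j + x ^ j * y ^ i

theorem symMonomial_comm (x y : ℝ) (i j : ℕ) : symMonomial x y i j = symMonomial y x i j := by
  unfold symMonomial; ring

theorem symMonomial_comm' (x y : ℝ) (i j : ℕ) : symMonomial x y i j = symMonomial x y j i := by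
  unfold symMonomial; ring

theorem symMonomial_max_min (x y : ℝ) (i j : ℕ) :
    symMonomial x y i j = symMonomial (max x y) (min x y) i j := by
  rcases le_total x y with h | h
  · rw [max_eq_right h, min_eq_left h, symMonomial_comm]
  · rw [max_eq_left h, min_eq_right h]

theorem symMonomial_add (x y : ℝ) (i d : ℕ) :
    symMonomial x y i (i + d) = (x * y) ^ i * (x ^ d + y ^ d) := by
  unfold symMonomial; ring

/-- Extracting the common power of the product leaves a sum of two d-th powers, whose product is
again fixed. -/
theorem symMonomial_lt {M m M' m' : ℝ} (hm : 0 < m) (hmM : m ≤ M) (hM : M < M')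
    (h : M * m = M' * m') {i j : ℕ} (hij : i ≠ j) : symMonomial M m i j < symMonomial M' m' i j := by
  wlog hlt : i < j generalizing i j
  · rw [symMonomial_comm' M, symMonomial_comm' M']
    exact this hij.symm (by omega)
  obtain ⟨d, rfl⟩ := Nat.exists_eq_add_of_lt hlt
  rw [add_assoc, symMonomial_add, symMonomial_add, ← h]
  refine mul_lt_mul_of_pos_left ?_ (pow_pos (mul_pos (hm.trans_le hmM) hm) _)
  refine add_lt_add_of_mul_eq_mul (pow_pos hm _) (pow_le_pow_left₀ hm.le hmM _)
    (pow_lt_pow_left₀ hM (hm.le.trans hmM) (by omega)) ?_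
  rw [← mul_pow, ← mul_pow, h]

theorem symMonomial_le {M m M' m' : ℝ} (hm : 0 < m) (hmM : m ≤ M) (hM : M ≤ M')
    (h : M * m = M' * m') (i j : ℕ) : symMonomial M m i j ≤ symMonomial M' m' i j := by
  rcases hM.lt_or_eq with hM | rfl
  · by_cases hij : i = j
    · subst hij
      unfold symMonomial
      rw [← mul_pow, ← mul_pow, h]
    · exact (symMonomial_lt hm hmM hM h hij).le
  · rw [mul_left_cancel₀ (hm.trans_le hmM).ne' h]

/-- For rectangles of the same area, the more square one has the smaller longer side. -/
theorem moreSquare_iff {a b a' b' : ℕ} (ha : 0 < a) (hb : 0 < b) (ha' : 0 < a') (hb' : 0 < b')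
    (h : a * b = a' * b') : MoreSquare a b a' b' ↔ max a b < max a' b' := by
  have hm : 0 < min a b := lt_min ha hb
  have hm' : 0 < min a' b' := lt_min ha' hb'
  have e1 : max a b * min a b = max a' b' * min a' b' := by
    rw [max_mul_min, max_mul_min, h]
  rw [MoreSquare, div_lt_div_iff₀ (by exact_mod_cast hm) (by exact_mod_cast hm')]
  norm_cast
  generalize max a b = M at *
  generalize max a' b' = M' at *
  generalize min a b = m at *
  generalize min a' b' = m' at *
  constructor
  · intro h1
    by_contra! h2
    have h3 : m ≤ m' := by
      by_contra! h3
      have : M' * m' < M * m := by nlinarith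
      omega
    have : M' * m ≤ M * m' := Nat.mul_le_mul h2 h3
    omega
  · intro h1
    have h3 : m' < m := by
      by_contra! h3
      have : M * m < M' * m' := by nlinarith
      omega
    nlinarith

end PowerSums

/-! ### Comparing the variances of different schemes. -/

section Comparison

open scoped Classical

variable {n N p : ℕ} {Ω : Type*} [MeasurableSpace Ω] {μ : Measure Ω} [IsProbabilityMeasure μ]
  {D : Matrix (Fin n) (Fin N) ℂ} {Y : ℕ → Ω → Matrix (Fin n) (Fin N) ℂ}

theorem scale_pos (hn : 0 < n) (hN : 0 < N) : 0 < (((n : ℝ) * (N : ℝ) ^ p) ^ 2)⁻¹ := by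
  positivity

theorem gap_factor_le {L₁ L₂ : ℕ} (h₁ : 0 < L₁) (h₂ : 0 < L₂) {M₁ M₂ : ℕ} (h₁' : L₁ ≤ M₁)
    (h₂' : L₂ ≤ M₂) (a b : ℕ) :
    ((M₁ : ℝ) ^ a)⁻¹ * ((M₂ : ℝ) ^ b)⁻¹ ≤ ((L₁ : ℝ) ^ a)⁻¹ * ((L₂ : ℝ) ^ b)⁻¹ := by
  have a1 : (0 : ℝ) < L₁ := by exact_mod_cast h₁
  have a2 : (0 : ℝ) < L₂ := by exact_mod_cast h₂
  gcongr

theorem mul_stackVar_le_sum (hn : 0 < n) (hN : 0 < N) (hp : 1 ≤ p) (hY : IsAdditiveModel μ D Y)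
    {L₁ L₂ : ℕ} (h₁ : 0 < L₁) (h₂ : 0 < L₂) (e : Fin L₁ × Fin L₂ ≃ Fin (L₁ * L₂)) :
    ((L₁ * L₂ : ℕ) : ℝ) * stackVar μ Y p e ≤ (((n : ℝ) * (N : ℝ) ^ p) ^ 2)⁻¹ *
      ∑ g ∈ varGluings p, varTerm p D g := by
  rw [mul_stackVar_eq hn hN hp hY h₁ h₂]
  refine mul_le_mul_of_nonneg_left (Finset.sum_le_sum fun g _ => ?_) (scale_pos hn hN).le
  refine mul_le_of_le_one_right (varTerm_nonneg hn hN p D g) ?_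
  simpa using gap_factor_le one_pos one_pos h₁ h₂ (oddGap g) (evenGap g)

/-- Equal ratios and a larger product force both L₁ and L₂ not to decrease, so L times the variance
does not increase. As the variance is positive, the strictly larger L makes the inequality strict.
-/
theorem stackVar_lt_of_aspect_eq (hn : 0 < n) (hN : 0 < N) (hp : 1 ≤ p)
    (hY : IsAdditiveModel μ D Y) {L₁ L₂ L₁' L₂' : ℕ} (h₁ : 0 < L₁) (h₂ : 0 < L₂) (h₁' : 0 < L₁')
    (h₂' : 0 < L₂') (hr : (L₁ : ℝ) / (L₂ : ℝ) = (L₁' : ℝ) / (L₂' : ℝ)) (hL : L₁ * L₂ < L₁' * L₂')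
    (e : Fin L₁ × Fin L₂ ≃ Fin (L₁ * L₂)) (e' : Fin L₁' × Fin L₂' ≃ Fin (L₁' * L₂')) :
    stackVar μ Y p e' < stackVar μ Y p e := by
  have hr' : L₁ * L₂' = L₁' * L₂ := by
    rw [div_eq_div_iff (by positivity) (by positivity)] at hr
    exact_mod_cast hr
  have hle1 : L₁ ≤ L₁' := by
    by_contra! h
    have : L₂' < L₂ := by
      by_contra! h3
      have : L₁' * L₂ < L₁ * L₂' := by nlinarith
      omega
    have : L₁' * L₂' < L₁ * L₂ := by nlinarith
    omega
  have hle2 : L₂ ≤ L₂' := by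
    by_contra! h
    have : L₁ * L₂' < L₁' * L₂ := by nlinarith
    omega
  have hA := mul_stackVar_eq hn hN hp hY h₁ h₂ e
  have hB := mul_stackVar_eq hn hN hp hY h₁' h₂' e'
  have hle : ((L₁' * L₂' : ℕ) : ℝ) * stackVar μ Y p e' ≤
      ((L₁ * L₂ : ℕ) : ℝ) * stackVar μ Y p e := by
    rw [hA, hB]
    refine mul_le_mul_of_nonneg_left (Finset.sum_le_sum fun g _ => ?_) (scale_pos hn hN).le
    exact mul_le_mul_of_nonneg_left (gap_factor_le h₁ h₂ hle1 hle2 _ _)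
      (varTerm_nonneg hn hN p D g)
  have hpos : 0 < ((L₁ * L₂ : ℕ) : ℝ) * stackVar μ Y p e := by
    rw [hA]
    refine mul_pos (scale_pos hn hN) (Finset.sum_pos' (fun g _ => ?_)
      ⟨fullGluing p, fullGluing_mem hp, ?_⟩)
    · exact mul_nonneg (varTerm_nonneg hn hN p D g) (by positivity)
    · exact mul_pos (varTerm_fullGluing_pos hn hN p D) (by positivity)
  have hL0 : (0 : ℝ) < ((L₁ * L₂ : ℕ) : ℝ) := by exact_mod_cast Nat.mul_pos h₁ h₂
  have hV : 0 < stackVar μ Y p e := pos_of_mul_pos_right hpos hL0.le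
  have hL' : ((L₁ * L₂ : ℕ) : ℝ) < ((L₁' * L₂' : ℕ) : ℝ) := by exact_mod_cast hL
  have h5 : ((L₁' * L₂' : ℕ) : ℝ) * stackVar μ Y p e' <
      ((L₁' * L₂' : ℕ) : ℝ) * stackVar μ Y p e :=
    hle.trans_lt (mul_lt_mul_of_pos_right hL' hV)
  exact lt_of_mul_lt_mul_left h5 (hL0.trans hL').le

/-- No term is larger than for averaging. For p ≥ 2 the full gluing has both gaps positive, so its
positive term is strictly damped as soon as L₁ L₂ ≥ 2. -/
theorem stackVar_lt_avgVar (hn : 0 < n) (hN : 0 < N) (hp : 2 ≤ p) (hY : IsAdditiveModel μ D Y)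
    {L₁ L₂ : ℕ} (hL : 2 ≤ L₁ * L₂) (e : Fin L₁ × Fin L₂ ≃ Fin (L₁ * L₂)) :
    stackVar μ Y p e < avgVar μ Y p (L₁ * L₂) := by
  have hL0 : 0 < L₁ * L₂ := by omega
  have h₁ : 0 < L₁ := Nat.pos_of_mul_pos_right hL0
  have h₂ : 0 < L₂ := Nat.pos_of_mul_pos_left hL0
  have hp1 : 1 ≤ p := by omega
  have h5 : ((L₁ * L₂ : ℕ) : ℝ) * stackVar μ Y p e <
      ((L₁ * L₂ : ℕ) : ℝ) * avgVar μ Y p (L₁ * L₂) := by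
    rw [mul_stackVar_eq hn hN hp1 hY h₁ h₂, mul_avgVar_eq hn hN hp1 hY hL0]
    refine mul_lt_mul_of_pos_left (Finset.sum_lt_sum (fun g _ => ?_)
      ⟨fullGluing p, fullGluing_mem hp1, ?_⟩) (scale_pos hn hN)
    · refine mul_le_of_le_one_right (varTerm_nonneg hn hN p D g) ?_
      simpa using gap_factor_le one_pos one_pos h₁ h₂ (oddGap g) (evenGap g)
    · refine mul_lt_of_lt_one_right (varTerm_fullGluing_pos hn hN p D) ?_
      have hm := fullGluing_mem hp1
      have hk := numPairs_fullGluing (p := p)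
      have g1 := two_mul_oddFree_le hm
      have g2 := two_mul_evenFree_le hm
      have g3 := oddFree_add_oddGap hm
      have g4 := evenFree_add_evenGap hm
      have g5 : oddGap (fullGluing p) ≠ 0 := by omega
      have g6 : evenGap (fullGluing p) ≠ 0 := by omega
      have b1 : (1 : ℝ) ≤ L₁ := by exact_mod_cast h₁
      have b2 : (1 : ℝ) ≤ L₂ := by exact_mod_cast h₂
      rw [← mul_inv]
      apply inv_lt_one_of_one_lt₀
      have c1 : (L₁ : ℝ) ≤ (L₁ : ℝ) ^ oddGap (fullGluing p) := le_self_pow₀ b1 g5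
      have c2 : (L₂ : ℝ) ≤ (L₂ : ℝ) ^ evenGap (fullGluing p) := le_self_pow₀ b2 g6
      have c3 : (2 : ℝ) ≤ L₁ * L₂ := by exact_mod_cast hL
      calc (1 : ℝ) < L₁ * L₂ := by linarith
        _ ≤ _ := mul_le_mul c1 c2 (by linarith) (by linarith)
  exact lt_of_mul_lt_mul_left h5 (Nat.cast_nonneg _)

/-- Adding the sum in which every gluing is replaced by its conjugate makes the variance a symmetric
function of the sides nL₁ and NL₂, with coefficients that depend only on their product. -/
theorem pow_mul_stackVar_eq (hn : 0 < n) (hN : 0 < N) (hp : 1 ≤ p) (hY : IsAdditiveModel μ D Y)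
    {L₁ L₂ : ℕ} (h₁ : 0 < L₁) (h₂ : 0 < L₂) (e : Fin L₁ × Fin L₂ ≃ Fin (L₁ * L₂)) :
    2 * stackVar μ Y p e = (((n : ℝ) * (N : ℝ) ^ p) ^ 2)⁻¹ *
      ∑ g ∈ varGluings p, blockProd (nextTwo p) g (blockFactor D) /
        (((L₁ * L₂ : ℕ) : ℝ)) ^ numPairs g *
        symMonomial ((n * L₁ : ℕ) : ℝ) ((N * L₂ : ℕ) : ℝ) (oddFree g) (evenFree g) := by
  have h := sum_crossGluings_comm (τ := Sum.isRight) (σ := side) (φ := nextTwo p)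
    isRight_nextTwo side_nextTwo (blockFactor D) fun i j k r => r / (((L₁ * L₂ : ℕ) : ℝ)) ^ k *
      (((n * L₁ : ℕ) : ℝ) ^ i * ((N * L₂ : ℕ) : ℝ) ^ j)
  have h2 : stackVar μ Y p e = (((n : ℝ) * (N : ℝ) ^ p) ^ 2)⁻¹ *
      ∑ g ∈ varGluings p, blockProd (nextTwo p) g (blockFactor D) /
        (((L₁ * L₂ : ℕ) : ℝ)) ^ numPairs g *
        (((n * L₁ : ℕ) : ℝ) ^ oddFree g * ((N * L₂ : ℕ) : ℝ) ^ evenFree g) := by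
    rw [stackVar_eq hn hN hp hY h₁ h₂ e]
    congr 1
    refine Finset.sum_congr rfl fun g _ => ?_
    rw [varTerm_eq]
    change _ * ((L₁ : ℝ) ^ oddFree g * (L₂ : ℝ) ^ evenFree g / _) = _
    push_cast
    ring
  rw [two_mul]
  nth_rw 2 [h2]
  rw [h2]
  change _ + _ * (∑ g ∈ crossGluings Sum.isRight side, _) = _
  unfold oddFree evenFree
  nth_rw 2 [h]
  rw [← mul_add, ← Finset.sum_add_distrib]
  congr 1
  refine Finset.sum_congr rfl fun g _ => ?_
  unfold symMonomial
  ring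

/-- Strictness needs a positive term that is not constant at a fixed area. For p ≥ 3 the full gluing
has at least p even but at most two odd free classes. For p = 2 these bounds do not separate the
counts; a gluing with two pairs and one free odd class is used instead, whose block contributes D₂,
and this is where D ≠ 0 enters. -/
theorem exists_asymmetric (hn : 0 < n) (hN : 0 < N) (hp : 2 ≤ p) (hD : p = 2 → D ≠ 0) :
    ∃ g ∈ varGluings p, 0 < blockProd (nextTwo p) g (blockFactor D) ∧ oddFree g ≠ evenFree g := by
  rcases hp.lt_or_eq with h | h
  · refine ⟨fullGluing p, fullGluing_mem (by omega), ?_, ?_⟩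
    · rw [blockProd_fullGluing]
      exact one_pos
    · have h1 : p ≤ evenFree (fullGluing p) := le_numFree_fullGluing
      have h2 : oddFree (fullGluing p) ≤ 2 := numFree_fullGluing_le (by omega)
      omega
  · have hc : ((varGluings p).filter fun g => numPairs g = 2 ∧ oddFree g = 1).card = p ^ 2 :=
      card_varGluings_two false
    obtain ⟨g, hg⟩ := Finset.card_pos.1 (by rw [hc]; positivity)
    rw [Finset.mem_filter] at hg
    obtain ⟨h1, h2⟩ := numPairs_two_oddFree hp hg.1 hg.2.1 hg.2.2
    refine ⟨g, hg.1, ?_, by omega⟩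
    rw [blockProd_of_card_eq_one hg.1 h2, hg.2.1]
    subst h
    exact mul_pos (by positivity) (matMoment_two_pos hn hN (hD rfl))

/-- Equal numbers of observations give compound matrices of equal area, so all terms can be compared
through the longer side: weakly by `symMonomial_le`, and strictly at the gluing from
`exists_asymmetric`. -/
theorem stackVar_lt_iff (hn : 0 < n) (hN : 0 < N) (hp : 2 ≤ p) (hD : p = 2 → D ≠ 0)
    (hY : IsAdditiveModel μ D Y) {L₁ L₂ L₁' L₂' : ℕ} (hL : 0 < L₁ * L₂)
    (hLL : L₁ * L₂ = L₁' * L₂') (e : Fin L₁ × Fin L₂ ≃ Fin (L₁ * L₂))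
    (e' : Fin L₁' × Fin L₂' ≃ Fin (L₁' * L₂')) :
    stackVar μ Y p e < stackVar μ Y p e' ↔ MoreSquare (n * L₁) (N * L₂) (n * L₁') (N * L₂') := by
  have h₁ : 0 < L₁ := Nat.pos_of_mul_pos_right hL
  have h₂ : 0 < L₂ := Nat.pos_of_mul_pos_left hL
  have h₁' : 0 < L₁' := Nat.pos_of_mul_pos_right (hLL ▸ hL)
  have h₂' : 0 < L₂' := Nat.pos_of_mul_pos_left (hLL ▸ hL)
  have harea : n * L₁ * (N * L₂) = n * L₁' * (N * L₂') := by
    calc n * L₁ * (N * L₂) = n * N * (L₁ * L₂) := by ring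
      _ = n * N * (L₁' * L₂') := by rw [hLL]
      _ = _ := by ring
  have hp1 : 1 ≤ p := by omega
  have hV := pow_mul_stackVar_eq hn hN hp1 hY h₁ h₂ e
  have hV' := pow_mul_stackVar_eq hn hN hp1 hY h₁' h₂' e'
  rw [moreSquare_iff (by positivity) (by positivity) (by positivity) (by positivity) harea]
  have hmin : ∀ a b : ℕ, 0 < a → 0 < b → (0 : ℝ) < ((min a b : ℕ) : ℝ) := fun a b ha hb => by
    exact_mod_cast lt_min ha hb
  have hmm : ∀ a b : ℕ, ((min a b : ℕ) : ℝ) ≤ ((max a b : ℕ) : ℝ) := fun a b => by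
    exact_mod_cast min_le_max
  have hprod : ((max (n * L₁) (N * L₂) : ℕ) : ℝ) * ((min (n * L₁) (N * L₂) : ℕ) : ℝ) =
      ((max (n * L₁') (N * L₂') : ℕ) : ℝ) * ((min (n * L₁') (N * L₂') : ℕ) : ℝ) := by
    rw [← Nat.cast_mul, ← Nat.cast_mul, max_mul_min, max_mul_min, harea]
  have hsym : ∀ (a b : ℕ) (i j : ℕ), symMonomial (a : ℝ) b i j =
      symMonomial ((max a b : ℕ) : ℝ) ((min a b : ℕ) : ℝ) i j := fun a b i j => by
    rw [symMonomial_max_min, Nat.cast_max, Nat.cast_min]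
  simp only [hsym (n * L₁) (N * L₂)] at hV
  simp only [hsym (n * L₁') (N * L₂')] at hV'
  have hcoef : ∀ g : Equiv.Perm (TwoCircleEdge p), 0 ≤ blockProd (nextTwo p) g (blockFactor D) /
      (((L₁ * L₂ : ℕ) : ℝ)) ^ numPairs g := fun g =>
    div_nonneg (blockProd_nonneg hn hN D g) (by positivity)
  rw [← hLL] at hV'
  constructor
  · intro hlt
    by_contra! hle
    have : 2 * stackVar μ Y p e' ≤ 2 * stackVar μ Y p e := by
      rw [hV, hV']
      refine mul_le_mul_of_nonneg_left (Finset.sum_le_sum fun g _ => ?_) (scale_pos hn hN).le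
      exact mul_le_mul_of_nonneg_left (symMonomial_le (hmin _ _ (by positivity) (by positivity))
        (hmm _ _) (by exact_mod_cast hle) hprod.symm _ _) (hcoef g)
    linarith
  · intro hlt
    have : 2 * stackVar μ Y p e < 2 * stackVar μ Y p e' := by
      rw [hV, hV']
      obtain ⟨g, hg, hpos, hne⟩ := exists_asymmetric (D := D) hn hN hp hD
      have hlt' : ((max (n * L₁) (N * L₂) : ℕ) : ℝ) < ((max (n * L₁') (N * L₂') : ℕ) : ℝ) := by
        exact_mod_cast hlt
      refine mul_lt_mul_of_pos_left (Finset.sum_lt_sum (fun g _ => ?_) ⟨g, hg, ?_⟩)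
        (scale_pos hn hN)
      · exact mul_le_mul_of_nonneg_left (symMonomial_le (hmin _ _ (by positivity) (by positivity))
          (hmm _ _) hlt'.le hprod _ _) (hcoef g)
      · exact mul_lt_mul_of_pos_left (symMonomial_lt (hmin _ _ (by positivity) (by positivity))
          (hmm _ _) hlt' hprod hne) (div_pos hpos (by positivity))
    linarith

end Comparison

end Stacking
theorem theorem1 (n N : ℕ) (hn : 0 < n) (hN : 0 < N) :
    -- Unbiasedness, the bound on the variances, and monotonicity for a fixed aspect ratio.
    (∀ (p : ℕ), 1 ≤ p → ∀ (D : Matrix (Fin n) (Fin N) ℂ)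
      (Ω : Type u) [MeasurableSpace Ω] (μ : Measure Ω) [IsProbabilityMeasure μ]
      (Y : ℕ → Ω → Matrix (Fin n) (Fin N) ℂ), IsAdditiveModel μ D Y →
        (∀ k : ℕ, IsUnbiased μ (fun ω => estimator p (Y k ω)) (matMoment D p)) ∧
        (∀ (L₁ L₂ : ℕ), 0 < L₁ → 0 < L₂ → ∀ e : Fin L₁ × Fin L₂ ≃ Fin (L₁ * L₂),
          IsUnbiased μ (fun ω => stackEstimator p e (fun k => Y k ω)) (matMoment D p)) ∧
        (∀ L : ℕ, 0 < L →
          IsUnbiased μ (fun ω => avgEstimator p L (fun k => Y k ω)) (matMoment D p)) ∧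
        (∃ C : ℝ,
          (∀ (L₁ L₂ : ℕ), 0 < L₁ → 0 < L₂ → ∀ e : Fin L₁ × Fin L₂ ≃ Fin (L₁ * L₂),
            stackVar μ Y p e ≤ C / ((L₁ * L₂ : ℕ) : ℝ)) ∧
          (∀ L : ℕ, 0 < L → avgVar μ Y p L ≤ C / (L : ℝ))) ∧
        (∀ (L₁ L₂ L₁' L₂' : ℕ), 0 < L₁ → 0 < L₂ → 0 < L₁' → 0 < L₂' →
          (L₁ : ℝ) / (L₂ : ℝ) = (L₁' : ℝ) / (L₂' : ℝ) → L₁ * L₂ < L₁' * L₂' →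
          ∀ (e : Fin L₁ × Fin L₂ ≃ Fin (L₁ * L₂)) (e' : Fin L₁' × Fin L₂' ≃ Fin (L₁' * L₂')),
            stackVar μ Y p e' < stackVar μ Y p e)) ∧
    -- The limits for the first moment.
    (∀ (D : Matrix (Fin n) (Fin N) ℂ)
      (Ω : Type u) [MeasurableSpace Ω] (μ : Measure Ω) [IsProbabilityMeasure μ]
      (Y : ℕ → Ω → Matrix (Fin n) (Fin N) ℂ), IsAdditiveModel μ D Y →
        ∃ l : ℝ, l = 2 / (n * N : ℝ) * matMoment D 1 + 1 / (n * N : ℝ) ∧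
          RectLimit μ Y 1 l ∧ VertLimit μ Y 1 l ∧ HorizLimit μ Y 1 l ∧ AvgLimit μ Y 1 l) ∧
    -- The limits for the higher moments and the comparison of the variances.
    (∀ (p : ℕ), 2 ≤ p →
      -- The variable number `i` of `Q`, where `0 ≤ i < 2p - 3`, stands for the moment `D_{i+1}`.
      (∃ Q : MvPolynomial (Fin (2 * p - 3)) ℝ,
        (∀ m ∈ Q.support, 0 < Q.coeff m) ∧
        Q.weightedTotalDegree (fun i : Fin (2 * p - 3) => (i : ℕ) + 1) = 2 * p - 2 ∧
        Q.totalDegree = p ∧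
        ∀ (D : Matrix (Fin n) (Fin N) ℂ)
          (Ω : Type u) [MeasurableSpace Ω] (μ : Measure Ω) [IsProbabilityMeasure μ]
          (Y : ℕ → Ω → Matrix (Fin n) (Fin N) ℂ), IsAdditiveModel μ D Y →
            ∃ lR lV lH lA : ℝ,
              lR = 2 * p ^ 2 / (n * N : ℝ) * matMoment D (2 * p - 1) ∧
              lV = 2 * p ^ 2 / (n * N : ℝ) * matMoment D (2 * p - 1)
                + p ^ 2 / (N ^ 2 : ℝ) * matMoment D (2 * p - 2) ∧
              lH = 2 * p ^ 2 / (n * N : ℝ) * matMoment D (2 * p - 1)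
                + p ^ 2 / (n * N : ℝ) * matMoment D (2 * p - 2) ∧
              lA = 2 * p ^ 2 / (n * N : ℝ) * matMoment D (2 * p - 1)
                + (p ^ 2 / (N ^ 2 : ℝ) + p ^ 2 / (n * N : ℝ)) * matMoment D (2 * p - 2)
                + MvPolynomial.eval (fun i : Fin (2 * p - 3) => matMoment D ((i : ℕ) + 1)) Q ∧
              RectLimit μ Y p lR ∧ VertLimit μ Y p lV ∧ HorizLimit μ Y p lH ∧ AvgLimit μ Y p lA ∧
              lR ≤ lV ∧ lV ≤ lA ∧ lR ≤ lH ∧ lH ≤ lA) ∧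
      (∀ (D : Matrix (Fin n) (Fin N) ℂ)
        (Ω : Type u) [MeasurableSpace Ω] (μ : Measure Ω) [IsProbabilityMeasure μ]
        (Y : ℕ → Ω → Matrix (Fin n) (Fin N) ℂ), IsAdditiveModel μ D Y →
          -- The most square compound matrix is best.
          ((p = 2 → D ≠ 0) →
            ∀ (L L₁ L₂ L₁' L₂' : ℕ), 0 < L → L₁ * L₂ = L → L₁' * L₂' = L →
              ∀ (e : Fin L₁ × Fin L₂ ≃ Fin (L₁ * L₂))
                (e' : Fin L₁' × Fin L₂' ≃ Fin (L₁' * L₂')),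
                (stackVar μ Y p e < stackVar μ Y p e' ↔
                  MoreSquare (n * L₁) (N * L₂) (n * L₁') (N * L₂'))) ∧
          -- Every stacking of at least two observations is better than averaging.
          (∀ (L₁ L₂ : ℕ), 2 ≤ L₁ * L₂ → ∀ e : Fin L₁ × Fin L₂ ≃ Fin (L₁ * L₂),
            stackVar μ Y p e < avgVar μ Y p (L₁ * L₂)))) := by
  have hn' : (n : ℝ) ≠ 0 := by exact_mod_cast hn.ne'
  have hN' : (N : ℝ) ≠ 0 := by exact_mod_cast hN.ne'
  refine ⟨?_, ?_, ?_⟩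
  · intro p hp D Ω _ μ _ Y hY
    refine ⟨fun k => isUnbiased_single hn hN hp hY k,
      fun L₁ L₂ h₁ h₂ e => isUnbiased_stack hn hN hp hY h₁ h₂ e,
      fun L hL => isUnbiased_avg hn hN hp hY hL,
      -- The constant is L times the variance of averaging, which does not depend on L and dominates
      -- every stacking.
      ⟨(((n : ℝ) * (N : ℝ) ^ p) ^ 2)⁻¹ * ∑ g ∈ varGluings p, varTerm p D g, ?_, ?_⟩,
      fun L₁ L₂ L₁' L₂' h₁ h₂ h₁' h₂' hr hL e e' =>
        stackVar_lt_of_aspect_eq hn hN hp hY h₁ h₂ h₁' h₂' hr hL e e'⟩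
    · intro L₁ L₂ h₁ h₂ e
      rw [le_div_iff₀' (by exact_mod_cast Nat.mul_pos h₁ h₂)]
      exact mul_stackVar_le_sum hn hN hp hY h₁ h₂ e
    · intro L hL
      rw [le_div_iff₀' (by exact_mod_cast hL)]
      exact (mul_avgVar_eq hn hN hp hY hL).le
  · intro D Ω _ μ _ Y hY
    have hl : 2 / (n * N : ℝ) * matMoment D 1 + 1 / (n * N : ℝ) =
        (((n : ℝ) * (N : ℝ) ^ 1) ^ 2)⁻¹ * ∑ g ∈ varGluings 1, varTerm 1 D g := by
      rw [sum_varTerm_of_eq_one, blockFactor]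
      field_simp
    have hR := rectLimit hn hN le_rfl hY
    have hV := vertLimit hn hN le_rfl hY
    have hH := horizLimit hn hN le_rfl hY
    have hA := avgLimit hn hN le_rfl hY
    -- All gaps vanish for p = 1, so each of the restricted sums is the full one.
    rw [Finset.filter_true_of_mem fun g hg => gaps_eq_zero_of_eq_one hg] at hR
    rw [Finset.filter_true_of_mem fun g hg => (gaps_eq_zero_of_eq_one hg).1] at hV
    rw [Finset.filter_true_of_mem fun g hg => (gaps_eq_zero_of_eq_one hg).2] at hH
    exact ⟨_, hl.symm, hR, hV, hH, hA⟩
  · intro p hp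
    have hp1 : 1 ≤ p := by omega
    refine ⟨⟨lowerPoly n N hp, fun m hm => coeff_lowerPoly_pos hn hN hp hm,
      weightedTotalDegree_lowerPoly hn hN hp, totalDegree_lowerPoly hn hN hp, ?_⟩, ?_⟩
    · intro D Ω _ μ _ Y hY
      have e1 : (((n : ℝ) * (N : ℝ) ^ p) ^ 2)⁻¹ * (2 * p ^ 2 * blockFactor D (2 * p - 1)) =
          2 * p ^ 2 / (n * N : ℝ) * matMoment D (2 * p - 1) := by
        have h : ((N : ℝ) ^ p) ^ 2 = (N : ℝ) ^ (2 * p - 1) * N := by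
          rw [← pow_mul, ← pow_succ]
          congr 1
          omega
        rw [blockFactor, mul_pow, h]
        field_simp
      have h2 : ((N : ℝ) ^ p) ^ 2 = (N : ℝ) ^ (2 * p - 2) * N ^ 2 := by
        rw [← pow_mul, ← pow_add]
        congr 1
        omega
      have e2 : (((n : ℝ) * (N : ℝ) ^ p) ^ 2)⁻¹ * (p ^ 2 * (n * blockFactor D (2 * p - 2))) =
          p ^ 2 / (N ^ 2 : ℝ) * matMoment D (2 * p - 2) := by
        rw [blockFactor, mul_pow, h2]
        field_simp
      have e3 : (((n : ℝ) * (N : ℝ) ^ p) ^ 2)⁻¹ * (p ^ 2 * (N * blockFactor D (2 * p - 2))) =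
          p ^ 2 / (n * N : ℝ) * matMoment D (2 * p - 2) := by
        rw [blockFactor, mul_pow, h2]
        field_simp
      have hR := rectLimit hn hN hp1 hY
      have hV := vertLimit hn hN hp1 hY
      have hH := horizLimit hn hN hp1 hY
      have hA := avgLimit hn hN hp1 hY
      rw [sum_varTerm_gaps D hp, e1] at hR
      rw [sum_varTerm_oddGap D hp, mul_add, e1, e2] at hV
      rw [sum_varTerm_evenGap D hp, mul_add, e1, e3] at hH
      rw [sum_varTerm D hp, mul_add, mul_add, mul_add, e1, e2, e3, ← eval_lowerPoly hp] at hA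
      rw [add_assoc (2 * (p : ℝ) ^ 2 / (n * N : ℝ) * matMoment D (2 * p - 1)), ← add_mul] at hA
      have m2 : 0 ≤ matMoment D (2 * p - 2) := matMoment_nonneg hn hN D _
      have q1 : 0 ≤ (p : ℝ) ^ 2 / (N ^ 2 : ℝ) * matMoment D (2 * p - 2) :=
        mul_nonneg (by positivity) m2
      have q2 : 0 ≤ (p : ℝ) ^ 2 / (n * N : ℝ) * matMoment D (2 * p - 2) :=
        mul_nonneg (by positivity) m2
      have q3 : 0 ≤ MvPolynomial.eval (fun i : Fin (2 * p - 3) => matMoment D ((i : ℕ) + 1))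
          (lowerPoly n N hp) := by
        rw [eval_lowerPoly]
        exact mul_nonneg (scale_pos hn hN).le
          (Finset.sum_nonneg fun g _ => varTerm_nonneg hn hN p D g)
      refine ⟨_, _, _, _, rfl, rfl, rfl, rfl, hR, hV, hH, hA, ?_, ?_, ?_, ?_⟩
      · linarith
      · rw [add_mul]
        linarith
      · linarith
      · rw [add_mul]
        linarith
    · intro D Ω _ μ _ Y hY
      refine ⟨fun hD L L₁ L₂ L₁' L₂' hL h h' e e' => ?_,
        fun L₁ L₂ hL e => stackVar_lt_avgVar hn hN hp hY hL e⟩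
      subst h
      exact stackVar_lt_iff hn hN hp hD hY hL h'.symm e e'
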